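/- Let $P$ be a $d$-polytope with $d+4$ vertices, and let $\mathrm{xc}(P)$ be its extension complexity, i.e. the minimal number of facets of a polytope that has $P$ as its image under an affine map. Write $\Delta_n$ for the $n$-simplex and $\mathrm{pyr}_k(B)$ for a $k$-fold pyramid over $B$. (Necessarily $d\ge 2$.) Then: 1. $\mathrm{xc}(P)=d+2$ if and only if $P$ has exactly $d+2$ facets. 2. $\mathrm{xc}(P)=d+3$ if and only if $P$ does not have exactly $d+2$ facets and at least one of the following two conditions holds: (2.1) $P$ has exactly $d+3$ facets; (2.2) $P=\pi(Q)$ for some affine projection $\pi$ and some polytope $Q$ combinatorially equivalent to $\mathrm{pyr}_{d-2}(\Delta_1\times\Delta_2)$. Whenever (2.2) holds, at least one of the following is true: (2.2.1) $P=\mathrm{pyr}_{d-2}(H)$ for a Desarguian hexagon $H$, and $\mathrm{xc}(H)=5$. Here a hexagon is Desarguian if, for some cyclic labeling $p_0,\dots,p_5$ of its vertices, the lines $p_0p_1$, $p_5p_2$ and $p_3p_4$ are concurrent (pass through a common point, or are all parallel); (2.2.2) some $6$ of the vertices of $P$ have a convex hull combinatorially equivalent to the triangular prism $\Delta_1\times\Delta_2$.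 3. $\mathrm{xc}(P)=d+4$ in all other cases, i.e. if $P$ has neither $d+2$ nor $d+3$ facets and (2.2) fails. -/

import Mathlib

open scoped Affine

noncomputable section

namespace Polytope

section

variable {E : Type*} [NormedAddCommGroup E] [NormedSpace ℝ E]
variable {F : Type*} [NormedAddCommGroup F] [NormedSpace ℝ F]

/-- A (convex) polytope: the convex hull of a finite set of points. Its vertices are its extreme
points, `P.extremePoints ℝ`. -/
def IsPolytope (P : Set E) : Prop :=
  ∃ s : Finset E, P = convexHull ℝ (s : Set E)

/-- The dimension of the affine hull of a (nonempty) set. -/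
def dim (P : Set E) : ℕ :=
  Module.finrank ℝ (vectorSpan ℝ P)

/-- The facets of `P`: the nonempty faces of dimension `dim P - 1`. A face of a polytope is the
empty set or the set of maximizers of a linear functional, that is, an exposed subset. -/
def facets (P : Set E) : Set (Set E) :=
  {G | IsExposed ℝ P G ∧ G.Nonempty ∧ dim G + 1 = dim P}

/-- The number of facets. -/
def numFacets (P : Set E) : ℕ :=
  (facets P).ncard

/-- The extension complexity of `P`: the least number of facets of a polytope (in a Euclidean space
of any dimension) that has `P` as its image under an affine map. -/
def xc (P : Set E) : ℕ :=
  sInf {m : ℕ | ∃ (N : ℕ) (Q : Set (EuclideanSpace ℝ (Fin N)))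
    (π : EuclideanSpace ℝ (Fin N) →ᵃ[ℝ] E),
    IsPolytope Q ∧ π '' Q = P ∧ numFacets Q = m}

/-- Combinatorial equivalence: the face lattices (all faces, including `∅` and the polytope itself,
ordered by inclusion) are isomorphic. -/
def CombEquiv (P : Set E) (Q : Set F) : Prop :=
  Nonempty ({G : Set E // IsExposed ℝ P G} ≃o {G : Set F // IsExposed ℝ Q G})

/-- The triangular prism `Δ₁ × Δ₂`. -/
def prism : Set ((Fin 2 → ℝ) × (Fin 3 → ℝ)) :=
  stdSimplex ℝ (Fin 2) ×ˢ stdSimplex ℝ (Fin 3)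

/-- A model of the `k`-fold pyramid over `B`: the base is placed in `E × {0}` and the apices are the
points `(0, e_i)`, where `e_i` is the `i`-th standard basis vector of `ℝ^k`. -/
def pyr (k : ℕ) (B : Set E) : Set (E × (Fin k → ℝ)) :=
  convexHull ℝ ((B ×ˢ {0}) ∪ Set.range fun i : Fin k => ((0 : E), (Pi.single i 1 : Fin k → ℝ)))

/-- `P` is a `k`-fold pyramid with base `B`, where `B` and `P` lie in the same space: starting from
`B`, one takes `k` times the convex hull with a point outside the current affine hull. -/
def IsIteratedPyramid : ℕ → Set E → Set E → Prop
  | 0, B, P => P = B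
  | k + 1, B, P => ∃ C : Set E, IsIteratedPyramid k B C ∧
      ∃ v : E, v ∉ affineSpan ℝ C ∧ P = convexHull ℝ (insert v C)

/-- Three lines are concurrent in the projective sense: they have a common point, or they are all
parallel (a common point at infinity). -/
def Concurrent (L₁ L₂ L₃ : AffineSubspace ℝ E) : Prop :=
  (∃ x : E, x ∈ L₁ ∧ x ∈ L₂ ∧ x ∈ L₃) ∨ (L₁ ∥ L₂ ∧ L₂ ∥ L₃)

/-- A hexagon with vertices `p 0, …, p 5` in cyclic order, possibly lying in a space of dimension
larger than two. -/
def IsHexagon (H : Set E) (p : Fin 6 → E) : Prop :=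
  IsPolytope H ∧ dim H = 2 ∧ Function.Injective p ∧ Set.range p = H.extremePoints ℝ ∧
    ∀ i : Fin 6, IsExposed ℝ H (segment ℝ (p i) (p (i + 1)))

/-- A Desarguian hexagon: for some cyclic labeling `p` of the vertices, the lines `p 0 ∧ p 1`,
`p 5 ∧ p 2` and `p 3 ∧ p 4` are concurrent. -/
def IsDesarguianHexagon (H : Set E) : Prop :=
  ∃ p : Fin 6 → E, IsHexagon H p ∧
    Concurrent line[ℝ, p 0, p 1] line[ℝ, p 5, p 2] line[ℝ, p 3, p 4]

/-- `P` is the image under an affine map of a polytope that is combinatorially equivalent to the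
`(d - 2)`-fold pyramid over the triangular prism (with `2 ≤ d`). -/
def IsProjOfPyrPrism (d : ℕ) (P : Set E) : Prop :=
  ∃ (k N : ℕ) (Q : Set (EuclideanSpace ℝ (Fin N))) (π : EuclideanSpace ℝ (Fin N) →ᵃ[ℝ] E),
    k + 2 = d ∧ IsPolytope Q ∧ CombEquiv Q (pyr k prism) ∧ π '' Q = P

end

end Polytope

end

/-!
Let `P` be a `d`-polytope with `d + 4` vertices. Every polytope is a projection of a simplex on its
vertices and of itself, so `xc P` is at most `d + 4` and at most the number of facets of `P`; a
`(d - 2)`-fold pyramid over the prism has `d + 3` facets, so its projections have extension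
complexity at most `d + 3`. The substance lies in the converse bounds (`xc_lower`) and in the dichotomy for
projections of pyramids over the prism (`IsProjOfPyrPrism.dichotomy`).

*Converse bounds.* Let `Q` be an extension of `P` with at most `d + 3` facets. A polytope of
dimension `n` has at least `n + 1` facets, with equality only for simplices, which have too few
vertices to project onto `P`. So either `dim Q = d`, and then `Q` is affinely isomorphic to `P`, or
`Q` has dimension `d + 1` and exactly `d + 3` facets. In the second case the slacks of the facets
(`exists_slack_model`) satisfy, up to scaling, a single homogeneous linear relation
`∑ i, s i = ∑ j, s j` over disjoint sets `A` and `B` of facets (`exists_model`), which shows that `Q` is a pyramid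
over a product of two simplices with vertex sets `A` and `B`. The projection `Q → P` has
one-dimensional fibres, in a direction `v`. The signs of the slacks on `v` control both the facets
of `P`, by Fourier–Motzkin elimination (`numFacets_image_model_le`), and the vertices of `Q` that
survive in `P` (`modelVertex_extreme`). If elimination allows more than `d + 3` facets, at most one
vertex is lost, and counting leaves only pyramids over `Δ₁ × Δ₂` and `Δ₁ × Δ₃`
(`numFacets_le_or_isProj`); the second kind reduces to the first by deleting the lost vertex.

*Combinatorial type.* Pyramids over products of simplices are handled through `IsPyrProd`: labelled
vertices and facet functions with the right incidences, plus the fact that the diagonals of every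
quadrilateral face cross. Such data determine the face lattice (`IsPyrProd.combEquiv`), and can be
recovered from it (`exists_isPyrProd_of_combEquiv`).

*Dichotomy.* If `P` is a projection of a pyramid over the prism, no vertex can be lost, since there
are only `d + 4` of them. The crossing diagonals imply that the three lines through corresponding
vertices of the two triangles of the prism are concurrent (`IsPyrProd.exists_relation`), so the
prism spans at most three dimensions, and its image spans two or three. If three, the prism is
mapped injectively and its six vertices span a prism in `P`. If two, its image is a hexagon `H`, the
lines remain concurrent, and `P` is an iterated pyramid over `H`. That the three lines join vertices
of `H` in the positions required of a Desarguian hexagon is a sign computation with `3 × 3`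
determinants (`det3_cyclicHexagon`): convex position forces the signs of all minors up to
relabelling. Finally `xc H ≤ 5`, as `H` is a projection of a prism, and `xc H > 4` by `xc_lower`, as
`H` has six edges.
-/

noncomputable section

namespace Polytope

/-! ### Polytopes, faces and extension complexity -/

section Affine

variable {E : Type*} [AddCommGroup E] [Module ℝ E]
variable {F : Type*} [AddCommGroup F] [Module ℝ F]

lemma map_sum_smul {ι : Type*} (t : Finset ι) (f : E →ᵃ[ℝ] F) (c : ι → ℝ) (w : ι → E)
    (hc : ∑ i ∈ t, c i = 1) : f (∑ i ∈ t, c i • w i) = ∑ i ∈ t, c i • f (w i) := by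
  have h : ∀ x, f x = f.linear x + f 0 := fun x => congrFun f.decomp x
  rw [h, map_sum, Finset.sum_congr rfl fun i _ => congrArg (c i • ·) (h (w i))]
  simp only [smul_add, Finset.sum_add_distrib, ← Finset.sum_smul, hc, one_smul, map_smul]

lemma map_add_smul (f : E →ᵃ[ℝ] F) (x v : E) (t : ℝ) : f (x + t • v) = f x + t • f.linear v := by
  have h : ∀ x, f x = f.linear x + f 0 := fun x => congrFun f.decomp x
  rw [h (x + t • v), h x, map_add, map_smul]; abel

lemma linear_sub_eq (f : E →ᵃ[ℝ] F) (x y : E) : f.linear (x - y) = f x - f y := by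
  have := f.linearMap_vsub x y
  simpa using this

lemma mem_convexHull_range_iff {ι : Type*} [Fintype ι] {w : ι → E} {x : E} :
    x ∈ convexHull ℝ (Set.range w) ↔
      ∃ c : ι → ℝ, (∀ i, 0 ≤ c i) ∧ ∑ i, c i = 1 ∧ ∑ i, c i • w i = x := by
  constructor
  · intro hx
    have hs : Convex ℝ {x : E | ∃ c : ι → ℝ, (∀ i, 0 ≤ c i) ∧ ∑ i, c i = 1 ∧ ∑ i, c i • w i = x} := by
      rintro x ⟨c, hc, hc1, rfl⟩ y ⟨d, hd, hd1, rfl⟩ a b ha hb hab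
      refine ⟨fun i => a * c i + b * d i, fun i => by have := hc i; have := hd i; positivity, ?_, ?_⟩
      · rw [Finset.sum_add_distrib, ← Finset.mul_sum, ← Finset.mul_sum, hc1, hd1]; linarith
      · simp_rw [add_smul, mul_smul, Finset.sum_add_distrib, Finset.smul_sum]
    refine convexHull_min ?_ hs hx
    classical
    rintro _ ⟨i, rfl⟩
    exact ⟨Pi.single i 1, fun j => by by_cases h : j = i <;> simp [h], by simp,
      by simp [Pi.single_apply]⟩
  · rintro ⟨c, hc, hc1, rfl⟩
    exact (convex_convexHull ℝ _).sum_mem (fun i _ => hc i) hc1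
      fun i _ => subset_convexHull ℝ _ ⟨i, rfl⟩

lemma nonneg_on_convexHull {V : Set E} (a : E →ᵃ[ℝ] ℝ) (h : ∀ x ∈ V, 0 ≤ a x) :
    ∀ x ∈ convexHull ℝ V, 0 ≤ a x := by
  have hs : Convex ℝ {x | 0 ≤ a x} := (convex_Ici (0 : ℝ)).affine_preimage a
  exact fun x hx => convexHull_min h hs hx

/-- The face of a convex hull cut out by a supporting hyperplane is the hull of the generators
lying on the hyperplane. -/
lemma face_convexHull {V : Set E} (a : E →ᵃ[ℝ] ℝ) (h : ∀ x ∈ V, 0 ≤ a x) :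
    {x ∈ convexHull ℝ V | a x = 0} = convexHull ℝ {x ∈ V | a x = 0} := by
  apply Set.Subset.antisymm
  · rintro x ⟨hx, hax⟩
    rw [mem_convexHull_iff_exists_fintype] at hx
    obtain ⟨ι, _, c, z, hc, hc1, hz, rfl⟩ := hx
    rw [map_sum_smul _ _ _ _ hc1] at hax
    have h0 := (Finset.sum_eq_zero_iff_of_nonneg
      (fun i _ => by have := hc i; have := h _ (hz i); simp only [smul_eq_mul]; positivity)).1 hax
    classical
    rw [← Finset.sum_filter_of_ne (p := fun i => c i ≠ 0)
      (fun i _ hi hci => hi (by rw [hci, zero_smul]))]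
    apply (convex_convexHull ℝ _).sum_mem
    · exact fun i _ => hc i
    · rw [← hc1]
      exact Finset.sum_filter_of_ne (fun i _ hi => hi)
    · intro i hi
      apply subset_convexHull
      refine ⟨hz i, ?_⟩
      have := h0 i (Finset.mem_univ i)
      simp only [smul_eq_mul, mul_eq_zero] at this
      exact this.resolve_left (Finset.mem_filter.1 hi).2
  · intro x hx
    refine ⟨convexHull_mono (fun y hy => hy.1) hx, ?_⟩
    have hs : Convex ℝ {x | a x = 0} := (convex_singleton (0 : ℝ)).affine_preimage a
    exact convexHull_min (fun y hy => hy.2) hs hx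

lemma face_convexHull_range {ι : Type*} {w : ι → E} (a : E →ᵃ[ℝ] ℝ) (h : ∀ i, 0 ≤ a (w i)) :
    {x ∈ convexHull ℝ (Set.range w) | a x = 0} = convexHull ℝ (w '' {i | a (w i) = 0}) := by
  rw [face_convexHull a (by rintro _ ⟨i, rfl⟩; exact h i)]
  congr 1
  ext x
  constructor
  · rintro ⟨⟨i, rfl⟩, h⟩; exact ⟨i, h, rfl⟩
  · rintro ⟨i, h, rfl⟩; exact ⟨⟨i, rfl⟩, h⟩

lemma linear_eq_zero_of_vanish {S : Set E} (a : E →ᵃ[ℝ] F) {c : F} (h : ∀ x ∈ S, a x = c) {v : E}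
    (hv : v ∈ vectorSpan ℝ S) : a.linear v = 0 := by
  have : vectorSpan ℝ S ≤ LinearMap.ker a.linear := by
    rw [vectorSpan_def, Submodule.span_le]
    rintro _ ⟨x, hx, y, hy, rfl⟩
    simp [linear_sub_eq, h x hx, h y hy]
  exact this hv

lemma eq_on_affineSpan {S : Set E} (a b : E →ᵃ[ℝ] F) (h : ∀ x ∈ S, a x = b x) {x : E}
    (hx : x ∈ affineSpan ℝ S) : a x = b x := by
  have : affineSpan ℝ S ≤ (AffineSubspace.mk' (0 : F) ⊥).comap (a - b) := by
    rw [affineSpan_le]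
    intro y hy
    simp [h y hy]
  have := this hx
  simpa [sub_eq_zero] using this

lemma mem_affineSpan_iff {S : Set E} {x y : E} (hx : x ∈ affineSpan ℝ S) :
    y ∈ affineSpan ℝ S ↔ y - x ∈ vectorSpan ℝ S := by
  rw [← direction_affineSpan]
  constructor
  · intro hy; exact AffineSubspace.vsub_mem_direction hy hx
  · intro h
    have := AffineSubspace.vadd_mem_of_mem_direction h hx
    simpa using this

lemma add_mem_affineSpan {S : Set E} {x v : E} (hx : x ∈ affineSpan ℝ S)
    (hv : v ∈ vectorSpan ℝ S) : x + v ∈ affineSpan ℝ S := by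
  rw [mem_affineSpan_iff hx]; simpa using hv

lemma vectorSpan_convexHull (S : Set E) : vectorSpan ℝ (convexHull ℝ S) = vectorSpan ℝ S := by
  rw [← direction_affineSpan, affineSpan_convexHull, direction_affineSpan]

/-- A point outside the affine span of `S` is separated from `S` by an affine function vanishing
on `S`. -/
lemma exists_affine_of_notMem {S : Set E} {x : E} (hS : S.Nonempty) (hx : x ∉ affineSpan ℝ S) :
    ∃ a : E →ᵃ[ℝ] ℝ, (∀ y ∈ S, a y = 0) ∧ a x = 1 := by
  obtain ⟨y, hy⟩ := hS
  have hv : x - y ∉ vectorSpan ℝ S := fun h =>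
    hx ((mem_affineSpan_iff (subset_affineSpan ℝ S hy)).2 h)
  obtain ⟨f, hf, hfS⟩ := Submodule.exists_le_ker_of_notMem hv
  refine ⟨(f (x - y))⁻¹ • (f.toAffineMap - AffineMap.const ℝ E (f y)), fun z hz => ?_, ?_⟩
  · have : f (z - y) = 0 := hfS (vsub_mem_vectorSpan ℝ hz hy)
    simp [map_sub] at this
    simp [this]
  · simp only [map_sub] at hf
    simp [map_sub, inv_mul_cancel₀ hf]

end Affine

section

variable {E : Type*} [NormedAddCommGroup E] [NormedSpace ℝ E]
variable {F : Type*} [NormedAddCommGroup F] [NormedSpace ℝ F]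

/-- Faces are the zero sets of affine functions that are nonnegative on the set. -/
lemma isExposed_iff [FiniteDimensional ℝ E] {Q G : Set E} :
    IsExposed ℝ Q G ↔ ∃ a : E →ᵃ[ℝ] ℝ, (∀ x ∈ Q, 0 ≤ a x) ∧ G = {x ∈ Q | a x = 0} := by
  constructor
  · intro h
    rcases G.eq_empty_or_nonempty with rfl | ⟨g, hg⟩
    · exact ⟨AffineMap.const ℝ E 1, by simp, by ext; simp⟩
    · obtain ⟨l, rfl⟩ := h ⟨g, hg⟩
      refine ⟨AffineMap.const ℝ E (l g) - l.toLinearMap.toAffineMap, fun x hx => ?_, ?_⟩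
      · simpa using hg.2 x hx
      · ext x
        constructor
        · rintro ⟨hx, hx2⟩
          refine ⟨hx, ?_⟩
          have h1 := hx2 g hg.1
          have h2 := hg.2 x hx
          simp; linarith
        · rintro ⟨hx, hx2⟩
          simp [sub_eq_zero] at hx2
          exact ⟨hx, fun y hy => hx2 ▸ hg.2 y hy⟩
  · rintro ⟨a, ha, rfl⟩ ⟨g, hg, hag⟩
    refine ⟨-(LinearMap.toContinuousLinearMap a.linear), ?_⟩
    have key : ∀ x y, a.linear x - a.linear y = a x - a y := fun x y => by
      rw [← map_sub, linear_sub_eq]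
    ext x
    simp only [Set.mem_ofPred_eq, neg_apply, neg_le_neg_iff,
      LinearMap.coe_toContinuousLinearMap', and_congr_right_iff]
    intro hx
    constructor
    · intro h y hy
      have := key x y
      have := ha y hy
      linarith
    · intro h
      have := key x g
      have := h g hg
      have := ha x hx
      linarith

lemma IsPolytope.isCompact {Q : Set E} (h : IsPolytope Q) : IsCompact Q := by
  obtain ⟨s, rfl⟩ := h; exact Set.Finite.isCompact_convexHull (𝕜 := ℝ) s.finite_toSet

lemma IsPolytope.convex {Q : Set E} (h : IsPolytope Q) : Convex ℝ Q := by
  obtain ⟨s, rfl⟩ := h; exact convex_convexHull ℝ _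

lemma isPolytope_of_finite {s : Set E} (hs : s.Finite) : IsPolytope (convexHull ℝ s) :=
  ⟨hs.toFinset, by simp⟩

lemma isPolytope_range {ι : Type*} [Finite ι] (w : ι → E) :
    IsPolytope (convexHull ℝ (Set.range w)) := isPolytope_of_finite (Set.finite_range w)

lemma IsPolytope.image {Q : Set E} (h : IsPolytope Q) (f : E →ᵃ[ℝ] F) : IsPolytope (f '' Q) := by
  obtain ⟨s, rfl⟩ := h
  rw [AffineMap.image_convexHull]
  exact isPolytope_of_finite (s.finite_toSet.image f)

lemma IsPolytope.exposed [FiniteDimensional ℝ E] {Q G : Set E} (h : IsPolytope Q)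
    (hG : IsExposed ℝ Q G) : IsPolytope G := by
  obtain ⟨a, ha, rfl⟩ := isExposed_iff.1 hG
  obtain ⟨s, rfl⟩ := h
  rw [face_convexHull a fun x hx => ha x (subset_convexHull ℝ _ hx)]
  exact isPolytope_of_finite (s.finite_toSet.subset fun x hx => hx.1)

lemma IsPolytope.finite_extremePoints {Q : Set E} (h : IsPolytope Q) :
    (Q.extremePoints ℝ).Finite := by
  obtain ⟨s, rfl⟩ := h
  exact s.finite_toSet.subset extremePoints_convexHull_subset

lemma IsPolytope.eq_convexHull {Q : Set E} (h : IsPolytope Q) :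
    Q = convexHull ℝ (Q.extremePoints ℝ) := by
  conv_lhs => rw [← closure_convexHull_extremePoints h.isCompact h.convex]
  exact (Set.Finite.isCompact_convexHull (𝕜 := ℝ) h.finite_extremePoints).isClosed.closure_eq

lemma IsPolytope.exposed_finite [FiniteDimensional ℝ E] {Q : Set E} (h : IsPolytope Q) :
    {G | IsExposed ℝ Q G}.Finite := by
  obtain ⟨s, rfl⟩ := h
  refine (s.finite_toSet.finite_subsets.image (convexHull ℝ)).subset ?_
  intro G hG
  obtain ⟨a, ha, rfl⟩ := isExposed_iff.1 hG
  exact ⟨_, fun x hx => hx.1, (face_convexHull a fun x hx => ha x (subset_convexHull ℝ _ hx)).symm⟩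

lemma IsPolytope.facets_finite [FiniteDimensional ℝ E] {Q : Set E} (h : IsPolytope Q) :
    (facets Q).Finite := h.exposed_finite.subset fun _ hG => hG.1

lemma dim_mono [FiniteDimensional ℝ E] {S T : Set E} (h : S ⊆ T) : dim S ≤ dim T :=
  Submodule.finrank_mono (vectorSpan_mono ℝ h)

lemma dim_convexHull (S : Set E) : dim (convexHull ℝ S) = dim S := by
  rw [dim, vectorSpan_convexHull, dim]

lemma dim_image_le [FiniteDimensional ℝ E] (f : E →ᵃ[ℝ] F) (S : Set E) : dim (f '' S) ≤ dim S := by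
  rw [dim, ← AffineMap.map_vectorSpan]
  exact Submodule.finrank_map_le _ _

lemma dim_insert_le [FiniteDimensional ℝ E] (S : Set E) (x : E) : dim (insert x S) ≤ dim S + 1 :=
  finrank_vectorSpan_insert_le_set ℝ S x

lemma dim_insert_of_notMem [FiniteDimensional ℝ E] {S : Set E} (hS : S.Nonempty) {x : E}
    (hx : x ∉ affineSpan ℝ S) : dim (insert x S) = dim S + 1 := by
  refine le_antisymm (dim_insert_le S x) (Nat.succ_le_of_lt ?_)
  obtain ⟨y, hy⟩ := hS
  refine Submodule.finrank_lt_finrank_of_lt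
    ((vectorSpan_mono ℝ (Set.subset_insert x S)).lt_of_ne fun h => hx ?_)
  rw [mem_affineSpan_iff (subset_affineSpan ℝ S hy), h]
  exact vsub_mem_vectorSpan ℝ (Set.mem_insert _ _) (Set.mem_insert_of_mem _ hy)

lemma dim_insert_of_mem {S : Set E} {x : E} (hx : x ∈ affineSpan ℝ S) :
    dim (insert x S) = dim S := by
  rw [dim, vectorSpan_insert_eq_vectorSpan hx, dim]

lemma dim_image_of_injOn [FiniteDimensional ℝ E] (f : E →ᵃ[ℝ] F) {S T : Set E}
    (hf : Set.InjOn f (affineSpan ℝ T)) (hST : S ⊆ T) : dim (f '' S) = dim S := by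
  rw [dim, ← AffineMap.map_vectorSpan, dim]
  rcases S.eq_empty_or_nonempty with rfl | ⟨y, hy⟩
  · rw [vectorSpan_empty, Submodule.map_bot, finrank_bot, finrank_bot]
  rw [← LinearMap.range_domRestrict]
  refine LinearMap.finrank_range_of_inj ?_
  rintro ⟨v, hv⟩ ⟨w, hw⟩ hvw
  have hvw' : f.linear v = f.linear w := hvw
  have hy' : y ∈ affineSpan ℝ T := subset_affineSpan ℝ T (hST hy)
  have h1 := add_mem_affineSpan hy' (vectorSpan_mono ℝ hST hv)
  have h2 := add_mem_affineSpan hy' (vectorSpan_mono ℝ hST hw)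
  have : y + v = y + w := hf h1 h2 (by
    have e1 := map_add_smul f y v 1
    have e2 := map_add_smul f y w 1
    simp only [one_smul] at e1 e2
    rw [e1, e2, hvw'])
  exact Subtype.ext (add_left_cancel this)

/-- Two sets of equal dimension, one projecting onto the other: the projection is injective. -/
lemma injOn_of_dim_eq [FiniteDimensional ℝ E] (f : E →ᵃ[ℝ] F) {S : Set E}
    (h : dim (f '' S) = dim S) : Set.InjOn f (affineSpan ℝ S) := by
  intro x hx y hy hxy
  rw [dim, ← AffineMap.map_vectorSpan, dim] at h
  have hinj : LinearMap.ker (f.linear.domRestrict (vectorSpan ℝ S)) = ⊥ := by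
    have := LinearMap.finrank_range_add_finrank_ker (f.linear.domRestrict (vectorSpan ℝ S))
    rw [LinearMap.range_domRestrict, h] at this
    exact Submodule.finrank_eq_zero.1 (by omega)
  have hm : x - y ∈ vectorSpan ℝ S := (mem_affineSpan_iff hy).1 hx
  have : (⟨x - y, hm⟩ : vectorSpan ℝ S) ∈ LinearMap.ker (f.linear.domRestrict (vectorSpan ℝ S)) := by
    simp only [LinearMap.mem_ker, LinearMap.domRestrict_apply]
    rw [linear_sub_eq, hxy, sub_self]
  rw [hinj, Submodule.mem_bot, Submodule.mk_eq_zero, sub_eq_zero] at this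
  exact this

/-- An affine function on `S` that is constant on the fibres of `π` descends to the image. -/
lemma exists_affine_descend (π : E →ᵃ[ℝ] F) (S : Set E) (a : E →ᵃ[ℝ] ℝ)
    (h : ∀ v ∈ vectorSpan ℝ S, π.linear v = 0 → a.linear v = 0) :
    ∃ b : F →ᵃ[ℝ] ℝ, ∀ x ∈ affineSpan ℝ S, b (π x) = a x := by
  rcases S.eq_empty_or_nonempty with rfl | ⟨y, hy⟩
  · exact ⟨0, fun x hx => by rw [AffineSubspace.span_empty] at hx; exact hx.elim⟩
  have hy := subset_affineSpan ℝ S hy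
  let p := π.linear.domRestrict (vectorSpan ℝ S)
  have : a.linear.domRestrict (vectorSpan ℝ S) ∈ LinearMap.range p.dualMap := by
    rw [LinearMap.range_dualMap_eq_dualAnnihilator_ker, Submodule.mem_dualAnnihilator]
    rintro ⟨v, hv⟩ hv2
    exact h v hv hv2
  obtain ⟨g, hg⟩ := this
  refine ⟨g.toAffineMap + AffineMap.const ℝ F (a y - g (π y)), fun x hx => ?_⟩
  have h1 := (mem_affineSpan_iff hy).1 hx
  have h2 : g (π.linear (x - y)) = a.linear (x - y) :=
    DFunLike.congr_fun hg (⟨x - y, h1⟩ : vectorSpan ℝ S)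
  rw [linear_sub_eq, linear_sub_eq, map_sub] at h2
  simp; linarith

/-- A facet is a maximal proper face. -/
lemma facet_eq_of_subset [FiniteDimensional ℝ E] {Q G : Set E} (hG : G ∈ facets Q)
    (a : E →ᵃ[ℝ] ℝ) (h0 : ∀ x ∈ G, a x = 0) (hne : ∃ x ∈ Q, a x ≠ 0) :
    G = {x ∈ Q | a x = 0} := by
  obtain ⟨hexp, ⟨g, hg⟩, hdim⟩ := hG
  refine Set.Subset.antisymm (fun x hx => ⟨hexp.subset hx, h0 x hx⟩) ?_
  rintro x ⟨hx, hax⟩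
  by_contra hxG
  obtain ⟨b, hb, rfl⟩ := isExposed_iff.1 hexp
  have hbx : b x ≠ 0 := fun h => hxG ⟨hx, h⟩
  have hxs : x ∉ affineSpan ℝ {x ∈ Q | b x = 0} := fun h =>
    hbx (eq_on_affineSpan b (AffineMap.const ℝ E 0) (fun y hy => by simpa using hy.2) h)
  have h1 := dim_insert_of_notMem ⟨g, hg⟩ hxs
  have hsub : insert x {x ∈ Q | b x = 0} ⊆ Q := Set.insert_subset hx fun y hy => hy.1
  have h2 : vectorSpan ℝ (insert x {x ∈ Q | b x = 0}) = vectorSpan ℝ Q :=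
    Submodule.eq_of_le_of_finrank_eq (vectorSpan_mono ℝ hsub) (by rw [← dim, ← dim]; omega)
  obtain ⟨y, hy, hay⟩ := hne
  have h3 : a.linear (y - x) = 0 := by
    apply linear_eq_zero_of_vanish (S := insert x {x ∈ Q | b x = 0}) a (c := 0)
    · rintro z (rfl | hz)
      · exact hax
      · exact h0 z hz
    · rw [h2]; exact vsub_mem_vectorSpan ℝ hy hx
  rw [linear_sub_eq, hax, sub_zero] at h3
  exact hay h3

lemma facet_ne_self [FiniteDimensional ℝ E] {Q G : Set E} (hG : G ∈ facets Q) : G ≠ Q := by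
  rintro rfl; have := hG.2.2; omega

/-- If every proper nonempty face lies on one of finitely many hyperplanes, none of which contains
the whole set, there are at most as many facets as hyperplanes. -/
lemma numFacets_le_card [FiniteDimensional ℝ E] {ι : Type*} [Fintype ι] {Q : Set E}
    (a : ι → E →ᵃ[ℝ] ℝ)
    (h : ∀ G, IsExposed ℝ Q G → G.Nonempty → G ≠ Q →
      ∃ i, (∀ x ∈ G, a i x = 0) ∧ ∃ x ∈ Q, a i x ≠ 0) :
    numFacets Q ≤ Fintype.card ι := by
  rw [numFacets, ← Nat.card_eq_fintype_card, ← Nat.card_coe_set_eq]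
  have h' : ∀ G : facets Q, ∃ i, (∀ x ∈ G.1, a i x = 0) ∧ ∃ x ∈ Q, a i x ≠ 0 := fun G =>
    h G.1 G.2.1 G.2.2.1 (facet_ne_self G.2)
  choose i hi using h'
  refine Nat.card_le_card_of_injective i fun G G' hGG => Subtype.ext ?_
  rw [facet_eq_of_subset G.2 _ (hi G).1 (hi G).2, facet_eq_of_subset G'.2 _ (hi G').1 (hi G').2,
    hGG]

lemma eventually_nonneg_add_mul {a b : ℝ} (ha : 0 ≤ a) (h : a = 0 → 0 ≤ b) :
    ∃ ε > 0, ∀ t, 0 ≤ t → t ≤ ε → 0 ≤ a + t * b := by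
  rcases ha.eq_or_lt with h0 | h0
  · exact ⟨1, one_pos, fun t ht _ => by rw [← h0]; have := h h0.symm; positivity⟩
  · refine ⟨a / (|b| + 1), by positivity, fun t ht hte => ?_⟩
    rw [le_div_iff₀ (by positivity)] at hte
    have := neg_abs_le b
    nlinarith [abs_nonneg b]

/-- Finitely many nonnegative values `a i`, with slopes `b i` that are nonnegative where the value
is zero, stay nonnegative along a short step. -/
lemma exists_pos_step {ι : Type*} [Finite ι] {a b : ι → ℝ} (ha : ∀ i, 0 ≤ a i)
    (h : ∀ i, a i = 0 → 0 ≤ b i) : ∃ ε : ℝ, 0 < ε ∧ ∀ i, 0 ≤ a i + ε * b i := by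
  have := Fintype.ofFinite ι
  choose e he he2 using fun i => eventually_nonneg_add_mul (ha i) (h i)
  rcases isEmpty_or_nonempty ι with hι | hι
  · exact ⟨1, one_pos, fun i => (hι.false i).elim⟩
  obtain ⟨i0, -, hi0⟩ := Finset.exists_min_image Finset.univ e Finset.univ_nonempty
  exact ⟨e i0, he i0, fun i => he2 i _ (he i0).le (hi0 i (Finset.mem_univ i))⟩

/-- A set cut out of its affine span by `m` halfspaces has at most `m` facets. -/
lemma numFacets_le_of_halfspaces [FiniteDimensional ℝ E] {ι : Type*} [Fintype ι] {Q : Set E}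
    (a : ι → E →ᵃ[ℝ] ℝ) (hconv : Convex ℝ Q) (hnn : ∀ i, ∀ x ∈ Q, 0 ≤ a i x)
    (h : ∀ x ∈ affineSpan ℝ Q, (∀ i, 0 ≤ a i x) → x ∈ Q) : numFacets Q ≤ Fintype.card ι := by
  classical
  refine numFacets_le_card a fun G hG hne hGQ => ?_
  obtain ⟨b, hb, rfl⟩ := isExposed_iff.1 hG
  obtain ⟨g0, hg0⟩ := hne
  by_contra hcon
  push Not at hcon
  apply hGQ
  refine Set.Subset.antisymm (fun x hx => hx.1) fun x hx => ⟨hx, ?_⟩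
  have hgi : ∀ i, ∃ g ∈ Q, b g = 0 ∧ ((∃ x ∈ Q, a i x ≠ 0) → a i g ≠ 0) := by
    intro i
    by_cases hi : ∃ x ∈ Q, a i x ≠ 0
    · have := hcon i
      by_contra hc
      push Not at hc
      obtain ⟨x, hx, hxi⟩ := hi
      exact hxi (this (fun y hy => (hc y hy.1 hy.2).2) x hx)
    · exact ⟨g0, hg0.1, hg0.2, fun h => (hi h).elim⟩
  choose g hgQ hgb hga using hgi
  -- the barycentre of the chosen points lies in the relative interior of `Q`, so the segment
  -- from `x` to it can be prolonged inside `Q`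
  let c : ℝ := (Fintype.card (Option ι) : ℝ)⁻¹
  have hcpos : 0 < c := by simp only [c]; have := Fintype.card_pos (α := Option ι); positivity
  let p : Option ι → E := fun o => o.elim g0 g
  have hpQ : ∀ o, p o ∈ Q := by rintro (_ | i); exacts [hg0.1, hgQ i]
  have hpb : ∀ o, b (p o) = 0 := by rintro (_ | i); exacts [hg0.2, hgb i]
  have hc1 : ∑ _o : Option ι, c = 1 := by
    simp only [Finset.sum_const, Finset.card_univ, nsmul_eq_mul, c]
    exact mul_inv_cancel₀ (by simp; positivity)
  let z := ∑ o, c • p o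
  have hzQ : z ∈ Q := hconv.sum_mem (fun _ _ => hcpos.le) hc1 fun o _ => hpQ o
  have hzb : b z = 0 := by
    simp only [z]
    rw [map_sum_smul _ _ _ _ hc1]; simp [hpb]
  have hza : ∀ i, a i z = 0 → ∀ x ∈ Q, a i x = 0 := by
    intro i hi
    by_contra hx
    push Not at hx
    have := hga i hx
    simp only [z] at hi
    rw [map_sum_smul _ _ _ _ hc1] at hi
    have h0 := (Finset.sum_eq_zero_iff_of_nonneg (fun o _ => by
      have := hnn i _ (hpQ o); simp only [smul_eq_mul]; positivity)).1 hi (some i)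
      (Finset.mem_univ _)
    simp only [smul_eq_mul, mul_eq_zero, hcpos.ne', false_or] at h0
    exact this h0
  obtain ⟨ε, hε, hstep⟩ := exists_pos_step (a := fun i => a i z)
    (b := fun i => (a i).linear (z - x)) (fun i => hnn i z hzQ) (fun i hi => by
      rw [linear_sub_eq, hza i hi z hzQ, hza i hi x hx, sub_zero])
  have hy : z + ε • (z - x) ∈ Q := by
    apply h
    · exact add_mem_affineSpan (subset_affineSpan ℝ Q hzQ)
        (Submodule.smul_mem _ _ (vsub_mem_vectorSpan ℝ hzQ hx))
    · intro i
      rw [map_add_smul, smul_eq_mul]; exact hstep i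
  have h1 := hb _ hy
  rw [map_add_smul, linear_sub_eq, hzb, smul_eq_mul] at h1
  have h2 := hb x hx
  nlinarith

/-- An affine map that is injective on a polytope does not create facets. -/
lemma numFacets_image_le [FiniteDimensional ℝ E] [FiniteDimensional ℝ F] {Q : Set E}
    (hQ : IsPolytope Q) (f : E →ᵃ[ℝ] F) (hf : Set.InjOn f (affineSpan ℝ Q)) :
    numFacets (f '' Q) ≤ numFacets Q := by
  have hsub := subset_affineSpan ℝ Q
  refine Set.ncard_le_ncard_of_injOn (fun G => f ⁻¹' G ∩ Q) ?_ ?_ hQ.facets_finite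
  · rintro G ⟨hexp, hne, hdim⟩
    have himg : f '' (f ⁻¹' G ∩ Q) = G := by
      rw [Set.image_preimage_inter, Set.inter_eq_left]
      exact hexp.subset
    refine ⟨?_, ?_, ?_⟩
    · obtain ⟨a, ha, rfl⟩ := isExposed_iff.1 hexp
      refine isExposed_iff.2 ⟨a.comp f, fun x hx => ha _ ⟨x, hx, rfl⟩, ?_⟩
      ext x
      simp only [Set.mem_inter_iff, Set.mem_preimage, Set.mem_ofPred_eq, AffineMap.comp_apply]
      constructor
      · rintro ⟨⟨-, h⟩, hx⟩; exact ⟨hx, h⟩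
      · rintro ⟨hx, h⟩; exact ⟨⟨⟨x, hx, rfl⟩, h⟩, hx⟩
    · exact Set.image_nonempty.1 (himg.symm ▸ hne)
    · rw [← dim_image_of_injOn f hf Set.inter_subset_right, himg, hdim,
        dim_image_of_injOn f hf subset_rfl]
  · intro G hG G' hG' hGG
    simp only at hGG
    have h1 : ∀ G ∈ facets (f '' Q), f '' (f ⁻¹' G ∩ Q) = G := fun G hG => by
      rw [Set.image_preimage_inter, Set.inter_eq_left]
      exact hG.1.subset
    rw [← h1 G hG, ← h1 G' hG', hGG]

/-- Any finite-dimensional normed space may be used instead of the Euclidean spaces in the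
definition of the extension complexity. -/
lemma xc_le_of_image [FiniteDimensional ℝ F] {P : Set E} {Q : Set F} (hQ : IsPolytope Q)
    (f : F →ᵃ[ℝ] E) (h : f '' Q = P) : xc P ≤ numFacets Q := by
  let e := toEuclidean (E := F)
  let e' : F →ᵃ[ℝ] _ := e.toLinearEquiv.toLinearMap.toAffineMap
  have h1 : numFacets (e' '' Q) ≤ numFacets Q :=
    numFacets_image_le hQ e' (e.injective.injOn)
  refine le_trans (Nat.sInf_le ⟨_, e' '' Q, f.comp e.symm.toLinearEquiv.toLinearMap.toAffineMap,
    hQ.image e', ?_, rfl⟩) h1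
  rw [← h, ← Set.image_comp]
  congr 1
  ext x
  simp [e']

lemma exists_of_xc [FiniteDimensional ℝ E] {P : Set E} (hP : IsPolytope P) :
    ∃ (N : ℕ) (Q : Set (EuclideanSpace ℝ (Fin N))) (π : EuclideanSpace ℝ (Fin N) →ᵃ[ℝ] E),
      IsPolytope Q ∧ π '' Q = P ∧ numFacets Q = xc P := by
  let e := toEuclidean (E := E)
  let e' : E →ᵃ[ℝ] _ := e.toLinearEquiv.toLinearMap.toAffineMap
  refine Nat.sInf_mem (s := {m : ℕ | ∃ (N : ℕ) (Q : Set (EuclideanSpace ℝ (Fin N)))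
    (π : EuclideanSpace ℝ (Fin N) →ᵃ[ℝ] E), IsPolytope Q ∧ π '' Q = P ∧ numFacets Q = m})
    ⟨_, _, e' '' P, e.symm.toLinearEquiv.toLinearMap.toAffineMap, hP.image e', ?_, rfl⟩
  rw [← Set.image_comp]
  have : (e.symm.toLinearEquiv.toLinearMap.toAffineMap : _ →ᵃ[ℝ] E) ∘ e' = id := by
    funext x; simp [e']
  rw [this, Set.image_id]

lemma xc_le_numFacets [FiniteDimensional ℝ E] {P : Set E} (hP : IsPolytope P) :
    xc P ≤ numFacets P := xc_le_of_image hP (AffineMap.id ℝ E) (by simp)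

/-- Every polytope is a projection of a simplex with as many vertices. -/
lemma xc_le_ncard_extremePoints {P : Set E} (hP : IsPolytope P) :
    xc P ≤ (P.extremePoints ℝ).ncard := by
  classical
  have := hP.finite_extremePoints.fintype
  let ι := (P.extremePoints ℝ : Set E)
  let f : (ι → ℝ) →ᵃ[ℝ] E := (Fintype.linearCombination ℝ (fun i : ι => (i : E))).toAffineMap
  have hstd : stdSimplex ℝ ι = convexHull ℝ (Set.range fun i : ι => (Pi.single i 1 : ι → ℝ)) :=
    (convexHull_rangle_single_eq_stdSimplex ℝ ι).symm
  have himg : f '' stdSimplex ℝ ι = P := by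
    rw [hstd, AffineMap.image_convexHull, ← Set.range_comp]
    conv_rhs => rw [hP.eq_convexHull]
    congr 1
    ext x
    simp [f, ι, Fintype.linearCombination_apply_single]
  have hpoly : IsPolytope (stdSimplex ℝ ι) := by rw [hstd]; exact isPolytope_range _
  refine (xc_le_of_image hpoly f himg).trans ?_
  rw [← Nat.card_coe_set_eq, Nat.card_eq_fintype_card]
  refine numFacets_le_of_halfspaces (fun i : ι => (LinearMap.proj i : (ι → ℝ) →ₗ[ℝ] ℝ).toAffineMap)
    (convex_stdSimplex ℝ ι) (fun i x hx => hx.1 i) fun x hx hx0 => ⟨hx0, ?_⟩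
  have := eq_on_affineSpan (S := stdSimplex ℝ ι)
    (∑ i : ι, (LinearMap.proj i : (ι → ℝ) →ₗ[ℝ] ℝ)).toAffineMap (AffineMap.const ℝ _ 1)
    (fun x hx => by simpa using hx.2) hx
  simpa using this

end

/-! ### Facet functions and the slack representation -/

section

variable {E : Type*} [NormedAddCommGroup E] [NormedSpace ℝ E]
variable {F : Type*} [NormedAddCommGroup F] [NormedSpace ℝ F]

lemma sum_smul_affine_apply {ι : Type*} (t : Finset ι) (c : ι → ℝ) (a : ι → F →ᵃ[ℝ] ℝ) (x : F) :
    (∑ i ∈ t, c i • a i) x = ∑ i ∈ t, c i * a i x := by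
  classical
  induction t using Finset.induction_on with
  | empty => simp
  | insert i t hi ih => rw [Finset.sum_insert hi, Finset.sum_insert hi, ← ih]; simp

/-- Moving an affine function `h ≥ 0` in the direction `-h'` until it acquires a new zero. -/
lemma exists_new_zero (V : Finset F) (h h' : F →ᵃ[ℝ] ℝ) (hh : ∀ v ∈ V, 0 ≤ h v)
    (hz : ∀ v ∈ V, h v = 0 → h' v = 0) (hpos : ∃ v ∈ V, 0 < h' v) :
    ∃ t : ℝ, 0 < t ∧ (∀ v ∈ V, 0 ≤ (h - t • h') v) ∧
      (V.filter fun v => (h - t • h') v ≠ 0).card < (V.filter fun v => h v ≠ 0).card := by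
  obtain ⟨v0, hv0, hv0'⟩ := hpos
  obtain ⟨w, hw, hmin⟩ := Finset.exists_min_image (V.filter fun v => 0 < h' v)
    (fun v => h v / h' v) ⟨v0, Finset.mem_filter.2 ⟨hv0, hv0'⟩⟩
  obtain ⟨hwV, hw'⟩ := Finset.mem_filter.1 hw
  have hhw : h w ≠ 0 := fun h0 => hw'.ne' (hz w hwV h0)
  have hhw' : 0 < h w := (hh w hwV).lt_of_ne' hhw
  refine ⟨h w / h' w, by positivity, fun v hv => ?_, Finset.card_lt_card ?_⟩
  · simp only [AffineMap.coe_sub, Pi.sub_apply, AffineMap.coe_smul, Pi.smul_apply, smul_eq_mul]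
    rcases le_or_gt (h' v) 0 with hle | hgt
    · have := hh v hv
      have h2 : 0 < h w / h' w := by positivity
      nlinarith
    · have := hmin v (Finset.mem_filter.2 ⟨hv, hgt⟩)
      rw [le_div_iff₀ hgt] at this
      linarith
  · rw [Finset.ssubset_iff_of_subset]
    · refine ⟨w, by simp [hwV, hhw], ?_⟩
      simp [div_mul_cancel₀ _ hw'.ne']
    · intro v hv
      simp only [Finset.mem_filter] at hv ⊢
      refine ⟨hv.1, fun h0 => hv.2 ?_⟩
      simp [h0, hz v hv.1 h0]

/-- Every affine function that is nonnegative on a polytope of positive dimension agrees on it with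
a nonnegative combination of facet-defining functions. -/
lemma exists_nonneg_comb [FiniteDimensional ℝ F] {Q : Set F} [Fintype (facets Q)] (V : Finset F)
    (hV : Q = convexHull ℝ V) (hd : 1 ≤ dim Q) (a : facets Q → F →ᵃ[ℝ] ℝ)
    (ha : ∀ G x, x ∈ Q → 0 ≤ a G x) (ha' : ∀ G : facets Q, G.1 = {x ∈ Q | a G x = 0})
    (h : F →ᵃ[ℝ] ℝ) (hh : ∀ v ∈ V, 0 ≤ h v) :
    ∃ c : facets Q → ℝ, (∀ G, 0 ≤ c G) ∧ ∀ v ∈ V, h v = ∑ G, c G * a G v := by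
  classical
  -- induction on the number of points at which `h` does not vanish
  induction hn : (V.filter fun v => h v ≠ 0).card using Nat.strong_induction_on generalizing h with
  | _ n ih =>
  by_cases hall : ∀ v ∈ V, h v = 0
  · exact ⟨0, fun _ => le_rfl, fun v hv => by simp [hall v hv]⟩
  push Not at hall
  obtain ⟨v0, hv0, hhv0⟩ := hall
  set Z : Set F := {v ∈ (V : Set F) | h v = 0} with hZ
  by_cases hcase : ∃ x ∈ V, x ∉ affineSpan ℝ (insert v0 Z)
  · -- some affine function `h'` vanishes on `Z` and `v0` but not on `V`
    obtain ⟨x, hxV, hx⟩ := hcase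
    obtain ⟨h', h'0, h'x⟩ := exists_affine_of_notMem (Set.insert_nonempty v0 Z) hx
    have hz : ∀ v ∈ V, h v = 0 → h' v = 0 := fun v hv h0 =>
      h'0 v (Set.mem_insert_of_mem _ ⟨hv, h0⟩)
    obtain ⟨t, ht, hnn, hlt⟩ := exists_new_zero V h h' hh hz ⟨x, hxV, by rw [h'x]; exact one_pos⟩
    obtain ⟨c, hc, hc'⟩ := ih _ (hn ▸ hlt) _ hnn rfl
    by_cases hneg : ∃ y ∈ V, h' y < 0
    · obtain ⟨y, hyV, hy⟩ := hneg
      obtain ⟨t2, ht2, hnn2, hlt2⟩ := exists_new_zero V h (-h') hh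
        (fun v hv h0 => by simp [hz v hv h0]) ⟨y, hyV, by simpa using hy⟩
      obtain ⟨c2, hc2, hc2'⟩ := ih _ (hn ▸ hlt2) _ hnn2 rfl
      refine ⟨fun G => (t2 * c G + t * c2 G) / (t + t2), fun G => ?_, fun v hv => ?_⟩
      · have := hc G; have := hc2 G; positivity
      · have e1 := hc' v hv
        have e2 := hc2' v hv
        simp only [AffineMap.coe_sub, Pi.sub_apply, AffineMap.coe_smul, Pi.smul_apply,
          AffineMap.coe_neg, Pi.neg_apply, smul_eq_mul] at e1 e2
        have e3 : ∑ G, (t2 * c G + t * c2 G) / (t + t2) * a G v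
            = (t2 * ∑ G, c G * a G v + t * ∑ G, c2 G * a G v) / (t + t2) := by
          rw [Finset.mul_sum, Finset.mul_sum, ← Finset.sum_add_distrib, Finset.sum_div]
          exact Finset.sum_congr rfl fun G _ => by ring
        rw [e3, ← e1, ← e2]
        field_simp
        ring
    · push Not at hneg
      have hlt2 : (V.filter fun v => h' v ≠ 0).card < (V.filter fun v => h v ≠ 0).card := by
        refine Finset.card_lt_card ?_
        rw [Finset.ssubset_iff_of_subset]
        · exact ⟨v0, by simp [hv0, hhv0], by simp [h'0 v0 (Set.mem_insert _ _)]⟩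
        · intro v hv
          simp only [Finset.mem_filter] at hv ⊢
          exact ⟨hv.1, fun h0 => hv.2 (hz v hv.1 h0)⟩
      obtain ⟨c2, hc2, hc2'⟩ := ih _ (hn ▸ hlt2) _ hneg rfl
      refine ⟨fun G => c G + t * c2 G, fun G => ?_, fun v hv => ?_⟩
      · have := hc G; have := hc2 G; positivity
      · have e1 := hc' v hv
        simp only [AffineMap.coe_sub, Pi.sub_apply, AffineMap.coe_smul, Pi.smul_apply,
          smul_eq_mul] at e1
        have e3 : ∑ G, (c G + t * c2 G) * a G v
            = ∑ G, c G * a G v + t * ∑ G, c2 G * a G v := by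
          rw [Finset.mul_sum, ← Finset.sum_add_distrib]
          exact Finset.sum_congr rfl fun G _ => by ring
        rw [e3, ← e1, ← hc2' v hv]
        ring
  · -- `h` defines a facet
    push Not at hcase
    have hsub : insert v0 Z ⊆ V := Set.insert_subset hv0 fun v hv => hv.1
    have hdimV : dim (insert v0 Z) = dim Q := by
      rw [hV, dim_convexHull]
      refine le_antisymm (dim_mono hsub) ?_
      rw [dim, dim, ← direction_affineSpan, ← direction_affineSpan]
      exact Submodule.finrank_mono (AffineSubspace.direction_le (affineSpan_le.2 hcase))
    have hZne : Z.Nonempty := by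
      by_contra hZe
      rw [Set.not_nonempty_iff_eq_empty] at hZe
      rw [hZe, dim, insert_empty_eq, vectorSpan_singleton, finrank_bot] at hdimV
      omega
    have hv0Z : v0 ∉ affineSpan ℝ Z := fun hmem =>
      hhv0 (eq_on_affineSpan h (AffineMap.const ℝ F 0) (fun y hy => by simpa using hy.2) hmem)
    have hdimZ := dim_insert_of_notMem hZne hv0Z
    have hface : {x ∈ Q | h x = 0} = convexHull ℝ Z := by
      rw [hV]; exact face_convexHull h (fun v hv => hh v hv)
    have hfacet : {x ∈ Q | h x = 0} ∈ facets Q := by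
      refine ⟨isExposed_iff.2 ⟨h, ?_, rfl⟩, ?_, ?_⟩
      · rw [hV]; exact nonneg_on_convexHull h (fun v hv => hh v hv)
      · rw [hface]; exact hZne.convexHull
      · rw [hface, dim_convexHull, ← hdimZ, hdimV]
    let G : facets Q := ⟨_, hfacet⟩
    have hVQ : ∀ v ∈ V, v ∈ Q := fun v hv => by rw [hV]; exact subset_convexHull ℝ _ hv
    have hGZ : ∀ x ∈ Q, a G x = 0 ↔ h x = 0 := by
      intro x hx
      have : x ∈ G.1 ↔ x ∈ {x ∈ Q | a G x = 0} := by rw [← ha' G]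
      simp only [G, Set.mem_ofPred_eq, hx, true_and] at this
      exact this.symm
    have hav0 : a G v0 ≠ 0 := fun h0 => hhv0 ((hGZ v0 (hVQ v0 hv0)).1 h0)
    refine ⟨Pi.single G (h v0 / a G v0), fun G' => ?_, fun v hv => ?_⟩
    · by_cases hG : G' = G
      · subst hG; simp only [Pi.single_eq_same]
        exact div_nonneg (hh v0 hv0) (ha _ _ (hVQ v0 hv0))
      · simp [hG]
    · rw [Finset.sum_eq_single G (fun G' _ hG => by simp [hG]) (by simp)]
      simp only [Pi.single_eq_same]
      have := eq_on_affineSpan h ((h v0 / a G v0) • a G) (S := insert v0 Z) ?_ (hcase v hv)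
      · simpa using this
      · rintro x (rfl | hx)
        · simp [div_mul_cancel₀ _ hav0]
        · simp [hx.2, (hGZ x (hVQ x hx.1)).2 hx.2]

/-- Facet-defining functions of a polytope, with a positive combination equal to `1`. The polytope
is the intersection of its affine hull with its facet-defining halfspaces. -/
theorem exists_facet_functions [FiniteDimensional ℝ F] {Q : Set F} [Fintype (facets Q)]
    (hQ : IsPolytope Q) (hd : 1 ≤ dim Q) :
    ∃ (a : facets Q → F →ᵃ[ℝ] ℝ) (l : facets Q → ℝ), (∀ i, 0 < l i) ∧
      (∀ x ∈ affineSpan ℝ Q, ∑ i, l i * a i x = 1) ∧ (∀ i, ∀ x ∈ Q, 0 ≤ a i x) ∧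
      (∀ x ∈ affineSpan ℝ Q, (∀ i, 0 ≤ a i x) → x ∈ Q) ∧ ∀ i, ∃ x ∈ Q, 0 < a i x := by
  have hex : ∀ G : facets Q, ∃ a : F →ᵃ[ℝ] ℝ, (∀ x ∈ Q, 0 ≤ a x) ∧ G.1 = {x ∈ Q | a x = 0} :=
    fun G => isExposed_iff.1 G.2.1
  choose a ha ha' using hex
  obtain ⟨V, hV⟩ := hQ
  have hQ : IsPolytope Q := ⟨V, hV⟩
  have hVQ : ∀ v ∈ V, v ∈ Q := fun v hv => by rw [hV]; exact subset_convexHull ℝ _ hv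
  have hspan : affineSpan ℝ Q = affineSpan ℝ (V : Set F) := by rw [hV, affineSpan_convexHull]
  have hcomb := exists_nonneg_comb V hV hd a ha ha'
  -- `1` is a nonnegative combination even after subtracting a small multiple of the sum
  set M := ∑ v ∈ V, ∑ i, a i v with hM
  have hM0 : 0 ≤ M := Finset.sum_nonneg fun v hv => Finset.sum_nonneg fun i _ => ha i v (hVQ v hv)
  have hMle : ∀ v ∈ V, ∑ i, a i v ≤ M := fun v hv =>
    Finset.single_le_sum (f := fun v => ∑ i, a i v)
      (fun v hv => Finset.sum_nonneg fun i _ => ha i v (hVQ v hv)) hv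
  obtain ⟨c, hc, hc'⟩ := hcomb (AffineMap.const ℝ F 1 - ∑ i, (M + 1)⁻¹ • a i) (fun v hv => by
    have h1 := hMle v hv
    rw [AffineMap.coe_sub, Pi.sub_apply, sum_smul_affine_apply, ← Finset.mul_sum,
      AffineMap.const_apply, sub_nonneg, inv_mul_le_iff₀ (by positivity)]
    linarith)
  refine ⟨a, fun i => (M + 1)⁻¹ + c i, fun i => ?_, fun x hx => ?_, ha, fun x hx hx0 => ?_,
    fun i => ?_⟩
  · have := hc i; positivity
  · rw [hspan] at hx
    rw [← sum_smul_affine_apply]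
    have := eq_on_affineSpan (∑ i, ((M + 1)⁻¹ + c i) • a i) (AffineMap.const ℝ F 1)
      (fun v hv => ?_) hx
    · simpa using this
    · have h1 := hc' v hv
      rw [AffineMap.coe_sub, Pi.sub_apply, sum_smul_affine_apply, AffineMap.const_apply] at h1
      rw [sum_smul_affine_apply, AffineMap.const_apply]
      simp_rw [add_mul, Finset.sum_add_distrib]
      linarith
  · by_contra hxQ
    obtain ⟨f, u, hfu, hux⟩ := geometric_hahn_banach_closed_point hQ.convex hQ.isCompact.isClosed hxQ
    obtain ⟨c, hc, hc'⟩ := hcomb (AffineMap.const ℝ F u - f.toLinearMap.toAffineMap) (fun v hv => by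
      have := hfu v (hVQ v hv)
      simpa using this.le)
    rw [hspan] at hx
    have := eq_on_affineSpan (AffineMap.const ℝ F u - f.toLinearMap.toAffineMap) (∑ i, c i • a i)
      (fun v hv => by rw [sum_smul_affine_apply]; exact hc' v hv) hx
    rw [sum_smul_affine_apply] at this
    have h2 : 0 ≤ ∑ i, c i * a i x := Finset.sum_nonneg fun i _ => mul_nonneg (hc i) (hx0 i)
    rw [← this] at h2
    simp at h2
    linarith
  · by_contra hcon
    push Not at hcon
    refine facet_ne_self i.2 ?_
    rw [ha' i]
    exact Set.Subset.antisymm (fun x hx => hx.1) fun x hx => ⟨hx, le_antisymm (hcon x hx) (ha i x hx)⟩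

/-- A bounded set contains no half-line. -/
lemma eq_zero_of_forall_add_smul_mem {Q : Set F} (hQ : Bornology.IsBounded Q) {z v : F}
    (h : ∀ t : ℝ, 0 ≤ t → z + t • v ∈ Q) : v = 0 := by
  obtain ⟨R, hR⟩ := hQ.exists_norm_le
  by_contra hv
  have hv' : 0 < ‖v‖ := norm_pos_iff.2 hv
  have h0 := hR z (by simpa using h 0 le_rfl)
  have hR0 : 0 ≤ R := (norm_nonneg z).trans h0
  have ht : 0 ≤ (2 * R + 1) / ‖v‖ := by positivity
  have h1 := hR _ (h _ ht)
  have h2 : ‖((2 * R + 1) / ‖v‖) • v‖ = 2 * R + 1 := by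
    rw [norm_smul, Real.norm_of_nonneg ht, div_mul_cancel₀ _ hv'.ne']
  have h3 := norm_sub_le (z + ((2 * R + 1) / ‖v‖) • v) z
  rw [add_sub_cancel_left, h2] at h3
  linarith

/-- An affine map that is injective on an affine span has an affine left inverse there. -/
lemma exists_affine_factor {G : Type*} [AddCommGroup G] [Module ℝ G] (σ : F →ᵃ[ℝ] G) (π : F →ᵃ[ℝ] E)
    {S : Set F} (hσ : Set.InjOn σ (affineSpan ℝ S)) :
    ∃ ρ : G →ᵃ[ℝ] E, ∀ x ∈ affineSpan ℝ S, ρ (σ x) = π x := by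
  rcases S.eq_empty_or_nonempty with rfl | ⟨y, hy⟩
  · exact ⟨AffineMap.const ℝ G 0, fun x hx => by
      rw [AffineSubspace.span_empty] at hx; exact hx.elim⟩
  have hy := subset_affineSpan ℝ S hy
  obtain ⟨r, hr⟩ := LinearMap.exists_leftInverse_of_injective
    (σ.linear.domRestrict (vectorSpan ℝ S)) (by
      rw [LinearMap.ker_eq_bot']
      rintro ⟨v, hv⟩ hv0
      have hv0 : σ.linear v = 0 := hv0
      have := hσ (add_mem_affineSpan hy hv) hy (by
        have := map_add_smul σ y v 1
        rwa [one_smul, hv0, smul_zero, add_zero] at this)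
      simpa using this)
  let g : G →ₗ[ℝ] E := π.linear ∘ₗ (vectorSpan ℝ S).subtype ∘ₗ r
  refine ⟨g.toAffineMap + AffineMap.const ℝ G (π y - g (σ y)), fun x hx => ?_⟩
  have h1 := (mem_affineSpan_iff hy).1 hx
  have h2 : r (σ.linear (x - y)) = ⟨x - y, h1⟩ :=
    LinearMap.congr_fun hr (⟨x - y, h1⟩ : vectorSpan ℝ S)
  have h3 : g (σ x - σ y) = π x - π y := by
    rw [← linear_sub_eq, ← linear_sub_eq]
    simp only [g, LinearMap.comp_apply, h2, Submodule.subtype_apply]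
  rw [map_sub] at h3
  simp only [AffineMap.coe_add, Pi.add_apply, LinearMap.coe_toAffineMap, AffineMap.const_apply]
  rw [sub_eq_iff_eq_add.1 h3]
  abel

/-- The slack representation: a polytope of positive dimension with `m` facets is affinely
isomorphic to the section of the nonnegative orthant of `ℝ^m` by the affine space
`{s ∈ M | ∑ l i * s i = 1}`. -/
theorem exists_slack_model [FiniteDimensional ℝ F] {Q : Set F} [Fintype (facets Q)]
    (hQ : IsPolytope Q) (hd : 1 ≤ dim Q) :
    ∃ (σ : F →ᵃ[ℝ] (facets Q → ℝ)) (M : Submodule ℝ (facets Q → ℝ)) (l : facets Q → ℝ),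
      Module.finrank ℝ M = dim Q + 1 ∧ (∀ i, 0 < l i) ∧ Set.InjOn σ (affineSpan ℝ Q) ∧
      (∀ x ∈ affineSpan ℝ Q, σ x ∈ M ∧ ∑ i, l i * σ x i = 1) ∧
      (∀ s ∈ M, ∑ i, l i * s i = 1 → ∃ x ∈ affineSpan ℝ Q, σ x = s) ∧
      (∀ x ∈ affineSpan ℝ Q, x ∈ Q ↔ ∀ i, 0 ≤ σ x i) ∧ ∃ s ∈ M, ∀ i, 0 < s i := by
  obtain ⟨a, l, hl, h1, hnn, hmem, hpos⟩ := exists_facet_functions hQ hd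
  have hsub := subset_affineSpan ℝ Q
  have hne : Q.Nonempty := by
    by_contra h
    rw [Set.not_nonempty_iff_eq_empty] at h
    rw [h, dim, vectorSpan_empty, finrank_bot] at hd
    omega
  obtain ⟨x0, hx0⟩ := hne
  have hx0' : x0 ∈ affineSpan ℝ Q := hsub hx0
  let σ : F →ᵃ[ℝ] (facets Q → ℝ) := AffineMap.pi a
  have hσ : ∀ x i, σ x i = a i x := fun x i => rfl
  have hlin : ∀ w ∈ vectorSpan ℝ Q, ∑ i, l i * σ.linear w i = 0 := by
    intro w hw
    have e1 := h1 _ (add_mem_affineSpan hx0' hw)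
    have e2 := h1 _ hx0'
    have e3 : ∀ i, a i (x0 + w) = a i x0 + σ.linear w i := fun i => by
      have := congrFun (map_add_smul σ x0 w 1) i
      simpa [hσ] using this
    simp_rw [e3, mul_add, Finset.sum_add_distrib] at e1
    linarith
  have hinj0 : ∀ w ∈ vectorSpan ℝ Q, σ.linear w = 0 → w = 0 := by
    intro w hw hw0
    refine eq_zero_of_forall_add_smul_mem hQ.isCompact.isBounded (z := x0) fun t _ => ?_
    refine hmem _ (add_mem_affineSpan hx0' (Submodule.smul_mem _ _ hw)) fun i => ?_
    have := congrFun (map_add_smul σ x0 w t) i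
    rw [hw0, smul_zero, add_zero] at this
    rw [← hσ, this]
    exact hnn i x0 hx0
  let g : (ℝ × vectorSpan ℝ Q) →ₗ[ℝ] (facets Q → ℝ) :=
    (LinearMap.toSpanSingleton ℝ _ (σ x0)).coprod (σ.linear.domRestrict (vectorSpan ℝ Q))
  have hg : ∀ c w, g (c, w) = c • σ x0 + σ.linear w := fun c w => by
    simp [g]
  have hlg : ∀ c w, ∑ i, l i * g (c, w) i = c := by
    intro c w
    have e2 := h1 _ hx0'
    have e3 := hlin w w.2
    simp_rw [hg, Pi.add_apply, Pi.smul_apply, smul_eq_mul, hσ, mul_add, Finset.sum_add_distrib]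
    have e4 : ∑ i, l i * (c * a i x0) = c * ∑ i, l i * a i x0 := by
      rw [Finset.mul_sum]
      exact Finset.sum_congr rfl fun i _ => by ring
    rw [e3, add_zero, e4, e2, mul_one]
  have hginj : Function.Injective g := by
    rw [← LinearMap.ker_eq_bot, LinearMap.ker_eq_bot']
    rintro ⟨c, w⟩ h0
    have hc : c = 0 := by rw [← hlg c w, h0]; simp
    subst hc
    rw [hg, zero_smul, zero_add] at h0
    have := hinj0 w w.2 h0
    simp only [Prod.mk_eq_zero, true_and]
    exact Subtype.ext this
  refine ⟨σ, LinearMap.range g, l, ?_, hl, ?_, fun x hx => ⟨?_, h1 x hx⟩, ?_, fun x hx => ?_, ?_⟩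
  · rw [LinearMap.finrank_range_of_inj hginj, Module.finrank_prod, Module.finrank_self, dim]; ring
  · intro x hx y hy hxy
    have := hinj0 (x - y) ((mem_affineSpan_iff hy).1 hx) (by rw [linear_sub_eq, hxy, sub_self])
    exact sub_eq_zero.1 this
  · refine ⟨(1, ⟨x - x0, (mem_affineSpan_iff hx0').1 hx⟩), ?_⟩
    rw [hg, one_smul, linear_sub_eq, add_sub_cancel]
  · rintro _ ⟨⟨c, w⟩, rfl⟩ hs
    rw [hlg] at hs
    subst hs
    refine ⟨x0 + w, add_mem_affineSpan hx0' w.2, ?_⟩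
    have := map_add_smul σ x0 (w : F) 1
    rw [one_smul, one_smul] at this
    rw [this, hg, one_smul]
  · exact ⟨fun hxQ i => hnn i x hxQ, fun h => hmem x hx h⟩
  · choose z hz hzpos using hpos
    refine ⟨∑ i, σ (z i), ?_, fun i => ?_⟩
    · refine Submodule.sum_mem _ fun i _ => ⟨(1, ⟨z i - x0, vsub_mem_vectorSpan ℝ (hz i) hx0⟩), ?_⟩
      rw [hg, one_smul, linear_sub_eq, add_sub_cancel]
    · rw [Finset.sum_apply]
      exact Finset.sum_pos' (fun j _ => hnn i _ (hz j)) ⟨i, Finset.mem_univ i, hzpos i⟩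

/-- The points `e i / l i` generate the simplex `{s ≥ 0 | ∑ l i * s i = 1}`. -/
lemma weighted_simplex_eq {ι : Type*} [Fintype ι] [DecidableEq ι] {l : ι → ℝ} (hl : ∀ i, 0 < l i) :
    {s : ι → ℝ | (∀ i, 0 ≤ s i) ∧ ∑ i, l i * s i = 1} =
      convexHull ℝ (Set.range fun i => (Pi.single i (l i)⁻¹ : ι → ℝ)) := by
  ext s
  rw [mem_convexHull_range_iff]
  constructor
  · rintro ⟨h0, h1⟩
    refine ⟨fun i => l i * s i, fun i => mul_nonneg (hl i).le (h0 i), h1, ?_⟩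
    ext j
    have := (hl j).ne'
    rw [Finset.sum_apply, Finset.sum_eq_single j (fun i _ hij => by simp [hij.symm]) (by simp)]
    simp; field_simp
  · rintro ⟨c, hc, hc1, rfl⟩
    have key : ∀ j, (∑ i, c i • (Pi.single i (l i)⁻¹ : ι → ℝ)) j = c j * (l j)⁻¹ := fun j => by
      rw [Finset.sum_apply, Finset.sum_eq_single j (fun i _ hij => by simp [hij.symm]) (by simp)]
      simp
    refine ⟨fun j => ?_, ?_⟩
    · rw [key]; have := hc j; have := hl j; positivity
    · simp_rw [key]
      rw [← hc1]
      exact Finset.sum_congr rfl fun j _ => by have := (hl j).ne'; field_simp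

lemma ncard_extremePoints_le {ι : Type*} [Fintype ι] (w : ι → E) :
    ((convexHull ℝ (Set.range w)).extremePoints ℝ).ncard ≤ Fintype.card ι := by
  refine (Set.ncard_le_ncard extremePoints_convexHull_subset (Set.finite_range w)).trans ?_
  rw [← Set.image_univ, ← Nat.card_eq_fintype_card, ← Set.ncard_univ]
  exact Set.ncard_image_le Set.finite_univ

end

/-! ### Pyramids over products of simplices and their face lattice -/

section

variable {E : Type*} [NormedAddCommGroup E] [NormedSpace ℝ E]
variable {F : Type*} [NormedAddCommGroup F] [NormedSpace ℝ F]
variable {A B C : Type*}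

/-- Incidence between the facets `A ⊕ B ⊕ C` and the vertices `A × B ⊕ C` of a `C`-fold pyramid over
a product of simplices with vertex sets `A` and `B`: the vertex `(i, j)` lies off the facets `i` and
`j`, the apex `c` off the facet `c`, and they lie on all other facets. The relation holds when the
vertex lies off the facet. -/
def Off : A ⊕ B ⊕ C → A × B ⊕ C → Prop
  | .inl i, .inl p => i = p.1
  | .inr (.inl j), .inl p => j = p.2
  | .inr (.inr c), .inr c' => c = c'
  | _, _ => False

@[simp] lemma off_inl_inl (i : A) (p : A × B) : Off (C := C) (.inl i) (.inl p) ↔ i = p.1 := Iff.rfl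
@[simp] lemma off_mid_inl (j : B) (p : A × B) : Off (C := C) (.inr (.inl j)) (.inl p) ↔ j = p.2 :=
  Iff.rfl
@[simp] lemma off_inr_inr (c c' : C) : Off (A := A) (B := B) (.inr (.inr c)) (.inr c') ↔ c = c' :=
  Iff.rfl
@[simp] lemma off_inl_inr (i : A) (c : C) : Off (B := B) (.inl i) (.inr c) ↔ False := Iff.rfl
@[simp] lemma off_mid_inr (j : B) (c : C) : Off (A := A) (.inr (.inl j)) (.inr c) ↔ False := Iff.rfl
@[simp] lemma off_inr_inl (c : C) (p : A × B) : Off (.inr (.inr c)) (.inl p) ↔ False := Iff.rfl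

/-- The points `w` and affine functions `a` exhibit `convexHull (range w)` as a polytope with the
face lattice of a `C`-fold pyramid over a product of two simplices: the functions are nonnegative
with the right zeros, and the two diagonals of each quadrilateral face cross. No dimension is
prescribed; it is determined by the crossing relations. -/
structure IsPyrProd (w : A × B ⊕ C → E) (a : A ⊕ B ⊕ C → E →ᵃ[ℝ] ℝ) : Prop where
  nonneg : ∀ i σ, 0 ≤ a i (w σ)
  eq_zero_iff : ∀ i σ, a i (w σ) = 0 ↔ ¬ Off i σ
  cross : ∀ i i' j j', ∃ α β γ δ : ℝ, 0 < α ∧ 0 < β ∧ 0 < γ ∧ 0 < δ ∧ α + β = γ + δ ∧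
    α • w (.inl (i, j)) + β • w (.inl (i', j')) = γ • w (.inl (i, j')) + δ • w (.inl (i', j))

lemma map_cross (f : E →ᵃ[ℝ] F) {α β γ δ : ℝ} {x y z t : E} (h : α + β = γ + δ)
    (h2 : α • x + β • y = γ • z + δ • t) : α • f x + β • f y = γ • f z + δ • f t := by
  have hf : ∀ x, f x = f.linear x + f 0 := fun x => congrFun f.decomp x
  have := congrArg f.linear h2
  simp only [map_add, map_smul] at this
  have e : α • f 0 + β • f 0 = γ • f 0 + δ • f 0 := by rw [← add_smul, ← add_smul, h]
  rw [hf x, hf y, hf z, hf t]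
  simp only [smul_add]
  rw [add_add_add_comm, add_add_add_comm (γ • f.linear z), this, e]

namespace IsPyrProd

variable {w : A × B ⊕ C → E} {a : A ⊕ B ⊕ C → E →ᵃ[ℝ] ℝ}

lemma pos (h : IsPyrProd w a) {i σ} (hi : Off i σ) : 0 < a i (w σ) :=
  lt_of_le_of_ne (h.nonneg i σ) fun h0 => (h.eq_zero_iff i σ).1 h0.symm hi

/-- A face containing two opposite vertices of a quadrilateral contains the other two. -/
lemma zero_of_cross (h : IsPyrProd w a) (b : E →ᵃ[ℝ] ℝ) (hb : ∀ σ, 0 ≤ b (w σ)) {i i' : A}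
    {j j' : B} (h1 : b (w (.inl (i, j))) = 0) (h2 : b (w (.inl (i', j'))) = 0) :
    b (w (.inl (i, j'))) = 0 := by
  obtain ⟨α, β, γ, δ, hα, hβ, hγ, hδ, hs, he⟩ := h.cross i i' j j'
  have := map_cross b hs he
  simp only [smul_eq_mul, h1, h2, mul_zero, add_zero] at this
  have h3 := hb (.inl (i, j'))
  have h4 := hb (.inl (i', j))
  have h5 := mul_nonneg hδ.le h4
  have h6 := mul_nonneg hγ.le h3
  have h7 : γ * b (w (.inl (i, j'))) = 0 := by linarith
  exact (mul_eq_zero.1 h7).resolve_left hγ.ne'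

/-- The vertex set of a face is the set of vertices lying on a set of facets. -/
lemma zeros_eq (h : IsPyrProd w a) (b : E →ᵃ[ℝ] ℝ) (hb : ∀ σ, 0 ≤ b (w σ)) :
    {σ | b (w σ) = 0} =
      {σ | ∀ i ∈ {i | ∀ σ, b (w σ) = 0 → ¬ Off i σ}, ¬ Off i σ} := by
  ext σ
  constructor
  · intro hσ i hi; exact hi σ hσ
  · intro hσ
    have key : ∀ i, Off i σ → ∃ τ, b (w τ) = 0 ∧ Off i τ := by
      intro i hi
      by_contra hc
      push Not at hc
      exact hσ i hc hi
    rcases σ with ⟨i, j⟩ | c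
    · obtain ⟨⟨i1, j1⟩ | c1, h1, h1'⟩ := key (.inl i) rfl
      · obtain ⟨⟨i2, j2⟩ | c2, h2, h2'⟩ := key (.inr (.inl j)) rfl
        · obtain rfl : i = i1 := h1'
          obtain rfl : j = j2 := h2'
          exact h.zero_of_cross b hb h1 h2
        · exact h2'.elim
      · exact h1'.elim
    · obtain ⟨⟨i1, j1⟩ | c1, h1, h1'⟩ := key (.inr (.inr c)) rfl
      · exact h1'.elim
      · obtain rfl : c = c1 := h1'
        exact h1

/-- Sets of vertices cut out by facets; these are the vertex sets of the faces. -/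
def FaceSet (A B C : Type*) : Set (Set (A × B ⊕ C)) :=
  {J | ∃ I : Set (A ⊕ B ⊕ C), J = {σ | ∀ i ∈ I, ¬ Off i σ}}

lemma zeros_mem_faceSet (h : IsPyrProd w a) (b : E →ᵃ[ℝ] ℝ) (hb : ∀ σ, 0 ≤ b (w σ)) :
    {σ | b (w σ) = 0} ∈ FaceSet A B C := ⟨_, h.zeros_eq b hb⟩

lemma range_mem (σ : A × B ⊕ C) : w σ ∈ convexHull ℝ (Set.range w) :=
  subset_convexHull ℝ _ ⟨σ, rfl⟩

lemma exists_face [Finite A] [Finite B] [Finite C] (h : IsPyrProd w a) {J : Set (A × B ⊕ C)}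
    (hJ : J ∈ FaceSet A B C) :
    ∃ b : E →ᵃ[ℝ] ℝ, (∀ σ, 0 ≤ b (w σ)) ∧ J = {σ | b (w σ) = 0} := by
  classical
  have := Fintype.ofFinite A
  have := Fintype.ofFinite B
  have := Fintype.ofFinite C
  obtain ⟨I, rfl⟩ := hJ
  have hb : ∀ x, (∑ i ∈ I.toFinset, (1 : ℝ) • a i) x = ∑ i ∈ I.toFinset, a i x := fun x => by
    rw [sum_smul_affine_apply]; simp
  refine ⟨∑ i ∈ I.toFinset, (1 : ℝ) • a i, fun σ => ?_, ?_⟩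
  · rw [hb]; exact Finset.sum_nonneg fun i _ => h.nonneg i σ
  · ext σ
    simp only [Set.mem_ofPred_eq]
    rw [hb, Finset.sum_eq_zero_iff_of_nonneg fun i _ => h.nonneg i σ]
    simp [h.eq_zero_iff]

/-- The face lattice is the lattice of face sets. -/
def faceOrderIso [FiniteDimensional ℝ E] [Finite A] [Finite B] [Finite C] (h : IsPyrProd w a) :
    {G : Set E // IsExposed ℝ (convexHull ℝ (Set.range w)) G} ≃o FaceSet A B C := by
  refine RelIso.ofSurjective (OrderEmbedding.ofMapLEIff
    (fun G => (⟨{σ | w σ ∈ G.1}, ?_⟩ : FaceSet A B C)) ?_) ?_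
  · obtain ⟨b, hb, hG⟩ := isExposed_iff.1 G.2
    rw [hG]
    convert h.zeros_mem_faceSet b fun σ => hb _ (range_mem σ) using 2
    ext σ; simp [range_mem σ]
  · intro G G'
    have hhull : G.1 = convexHull ℝ (w '' {σ | w σ ∈ G.1}) := by
      obtain ⟨b, hb, hG⟩ := isExposed_iff.1 G.2
      conv_lhs => rw [hG, face_convexHull_range b fun σ => hb _ (range_mem σ)]
      rw [hG]
      congr 2; ext σ; simp [range_mem σ]
    constructor
    · intro hle
      change G.1 ⊆ G'.1
      rw [hhull]
      refine convexHull_min ?_ (G'.2.convex (convex_convexHull ℝ _))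
      rintro _ ⟨σ, hσ, rfl⟩
      exact hle hσ
    · intro hle σ hσ; exact hle hσ
  · rintro ⟨J, hJ⟩
    obtain ⟨b, hb, rfl⟩ := h.exists_face hJ
    refine ⟨⟨{x ∈ convexHull ℝ (Set.range w) | b x = 0}, isExposed_iff.2 ⟨b, ?_, rfl⟩⟩, ?_⟩
    · exact nonneg_on_convexHull b (by rintro _ ⟨σ, rfl⟩; exact hb σ)
    · apply Subtype.ext
      change {σ | w σ ∈ _} = _
      ext σ; simp [range_mem σ]

lemma combEquiv [FiniteDimensional ℝ E] [Finite A] [Finite B] [Finite C] [FiniteDimensional ℝ F]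
    (h : IsPyrProd w a)
    {w' : A × B ⊕ C → F} {a' : A ⊕ B ⊕ C → F →ᵃ[ℝ] ℝ} (h' : IsPyrProd w' a') :
    CombEquiv (convexHull ℝ (Set.range w)) (convexHull ℝ (Set.range w')) :=
  ⟨h.faceOrderIso.trans h'.faceOrderIso.symm⟩

lemma numFacets_le [FiniteDimensional ℝ E] [Fintype A] [Fintype B] [Fintype C] [Nonempty A]
    [Nonempty B] (h : IsPyrProd w a) :
    numFacets (convexHull ℝ (Set.range w)) ≤ Fintype.card (A ⊕ B ⊕ C) := by
  refine numFacets_le_card a fun G hG _ hGQ => ?_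
  obtain ⟨b, hb, rfl⟩ := isExposed_iff.1 hG
  have hb' : ∀ σ, 0 ≤ b (w σ) := fun σ => hb _ (range_mem σ)
  have hz := h.zeros_eq b hb'
  have : ∃ i, ∀ σ, b (w σ) = 0 → ¬ Off i σ := by
    by_contra hc
    push Not at hc
    apply hGQ
    rw [face_convexHull_range b hb']
    congr 1
    rw [hz, ← Set.image_univ]
    congr 1
    ext σ
    simp only [Set.mem_ofPred_eq, Set.mem_univ, iff_true]
    intro i hi
    obtain ⟨τ, h1, h2⟩ := hc i
    exact (hi τ h1 h2).elim
  obtain ⟨i, hi⟩ := this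
  refine ⟨i, fun x hx => ?_, ?_⟩
  · rw [face_convexHull_range b hb'] at hx
    have hs : Convex ℝ {x | a i x = 0} := (convex_singleton (0 : ℝ)).affine_preimage (a i)
    refine convexHull_min ?_ hs hx
    rintro _ ⟨σ, hσ, rfl⟩
    exact (h.eq_zero_iff i σ).2 (hi σ hσ)
  · have : ∃ σ, Off i σ := by
      inhabit A
      inhabit B
      rcases i with i | j | c
      · exact ⟨.inl (i, default), rfl⟩
      · exact ⟨.inl (default, j), rfl⟩
      · exact ⟨.inr c, rfl⟩
    obtain ⟨σ, hσ⟩ := this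
    exact ⟨w σ, range_mem σ, (h.pos hσ).ne'⟩

end IsPyrProd

lemma singleton_mem_faceSet (σ : A × B ⊕ C) : {σ} ∈ IsPyrProd.FaceSet A B C := by
  refine ⟨{i | ¬ Off i σ}, ?_⟩
  ext τ
  simp only [Set.mem_singleton_iff, Set.mem_ofPred_eq]
  constructor
  · rintro rfl i hi; exact hi
  · intro h
    have h' : ∀ i, Off i τ → Off i σ := fun i hi => by
      by_contra hc; exact h i hc hi
    rcases τ with ⟨i, j⟩ | c
    · have h1 := h' (.inl i) rfl
      have h2 := h' (.inr (.inl j)) rfl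
      rcases σ with ⟨i', j'⟩ | c'
      · obtain rfl : i = i' := h1
        obtain rfl : j = j' := h2
        rfl
      · exact h1.elim
    · have h1 := h' (.inr (.inr c)) rfl
      rcases σ with ⟨i', j'⟩ | c'
      · exact h1.elim
      · obtain rfl : c = c' := h1
        rfl

lemma face_mem_faceSet (i : A ⊕ B ⊕ C) : {σ | ¬ Off i σ} ∈ IsPyrProd.FaceSet A B C :=
  ⟨{i}, by ext; simp⟩

/-- Either some supporting hyperplane touches the points `u`, `v` and no point of the finite set
`T`, or the line `uv` meets the hull of `T`. -/
lemma exists_edge_or_mem [FiniteDimensional ℝ E] {T : Set E} (hT : T.Finite) (u v : E) :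
    (∃ b : E →ᵃ[ℝ] ℝ, b u = 0 ∧ b v = 0 ∧ ∀ x ∈ T, 0 < b x) ∨
      ∃ t : ℝ, u + t • (v - u) ∈ convexHull ℝ T := by
  by_cases hd : Disjoint (convexHull ℝ T) (line[ℝ, u, v] : Set E)
  · left
    obtain ⟨f, s, t, hs, hst, ht⟩ := geometric_hahn_banach_compact_closed (convex_convexHull ℝ T)
      (Set.Finite.isCompact_convexHull (𝕜 := ℝ) hT) (AffineSubspace.convex line[ℝ, u, v])
      (AffineSubspace.closed_of_finiteDimensional _) hd
    have hline : ∀ r : ℝ, t < f u + r * f (v - u) := by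
      intro r
      have := ht (AffineMap.lineMap u v r) (AffineMap.lineMap_mem_affineSpan_pair r u v)
      rw [AffineMap.lineMap_apply] at this
      simp only [vsub_eq_sub, vadd_eq_add, map_add, map_smul, smul_eq_mul] at this
      linarith
    have h0 : f (v - u) = 0 := by
      by_contra hne
      have := hline ((t - f u) / f (v - u))
      rw [div_mul_cancel₀ _ hne] at this
      linarith
    refine ⟨AffineMap.const ℝ E (f u) - f.toLinearMap.toAffineMap, by simp, ?_, fun x hx => ?_⟩
    · rw [map_sub] at h0; simp; linarith
    · have h1 := hs x (subset_convexHull ℝ T hx)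
      have h2 := hline 0
      simp; linarith
  · right
    rw [Set.not_disjoint_iff] at hd
    obtain ⟨x, hx, hx2⟩ := hd
    have hx3 : (x - u) +ᵥ u ∈ line[ℝ, u, v] := by
      rw [vadd_eq_add, sub_add_cancel]; exact hx2
    obtain ⟨r, hr⟩ := vadd_left_mem_affineSpan_pair.1 hx3
    refine ⟨r, ?_⟩
    rw [← vsub_eq_sub v u, hr, add_sub_cancel]
    exact hx

lemma sum_eq_pair {ι M : Type*} [Fintype ι] [AddCommMonoid M] (f : ι → M) {i j : ι} (hij : i ≠ j)
    (h : ∀ k, k ≠ i → k ≠ j → f k = 0) : ∑ k, f k = f i + f j := by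
  classical
  rw [← Finset.sum_pair hij]
  refine (Finset.sum_subset (Finset.subset_univ _) fun k _ hk => ?_).symm
  simp only [Finset.mem_insert, Finset.mem_singleton, not_or] at hk
  exact h k hk.1 hk.2

/-- The crossing relation, when the pair of opposite vertices does not span a face. -/
lemma cross_of_not_edge [FiniteDimensional ℝ E] [Finite A] [Finite B] [Finite C]
    {w : A × B ⊕ C → E} {a : A ⊕ B ⊕ C → E →ᵃ[ℝ] ℝ}
    (hnn : ∀ i σ, 0 ≤ a i (w σ)) (hz : ∀ i σ, a i (w σ) = 0 ↔ ¬ Off i σ)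
    (hedge : ∀ b : E →ᵃ[ℝ] ℝ, (∀ σ, 0 ≤ b (w σ)) → ∀ i i' j j', b (w (.inl (i, j))) = 0 →
      b (w (.inl (i', j'))) = 0 → b (w (.inl (i, j'))) = 0) : IsPyrProd w a := by
  classical
  have := Fintype.ofFinite A
  have := Fintype.ofFinite B
  have := Fintype.ofFinite C
  refine ⟨hnn, hz, fun i i' j j' => ?_⟩
  by_cases hi : i = i'
  · subst hi
    exact ⟨1, 1, 1, 1, one_pos, one_pos, one_pos, one_pos, rfl, add_comm _ _⟩
  by_cases hj : j = j'
  · subst hj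
    exact ⟨1, 1, 1, 1, one_pos, one_pos, one_pos, one_pos, rfl, rfl⟩
  let S : Set (A × B ⊕ C) := {σ | σ ≠ .inl (i, j) ∧ σ ≠ .inl (i', j')}
  have hS1 : (.inl (i, j') : A × B ⊕ C) ∈ S := by
    constructor <;> simp [Ne.symm hj, hi]
  have hS2 : (.inl (i', j) : A × B ⊕ C) ∈ S := by
    constructor <;> simp [Ne.symm hi, hj]
  rcases exists_edge_or_mem (S.toFinite.image w) (w (.inl (i, j))) (w (.inl (i', j')))
    with ⟨b, hu, hv, hpos⟩ | ⟨t, ht⟩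
  · have hb : ∀ σ, 0 ≤ b (w σ) := by
      intro σ
      by_cases h1 : σ = .inl (i, j)
      · rw [h1, hu]
      by_cases h2 : σ = .inl (i', j')
      · rw [h2, hv]
      exact (hpos _ ⟨σ, ⟨h1, h2⟩, rfl⟩).le
    have h0 := hedge b hb i i' j j' hu hv
    exact absurd h0 (hpos _ ⟨_, hS1, rfl⟩).ne'
  · rw [Set.image_eq_range, mem_convexHull_range_iff] at ht
    obtain ⟨c, hc, hc1, hcx⟩ := ht
    set u := w (.inl (i, j))
    set v := w (.inl (i', j'))
    have happ : ∀ l, ∑ σ : S, c σ * a l (w σ) = a l u + t * (a l v - a l u) := by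
      intro l
      have := congrArg (a l) hcx
      rw [map_sum_smul _ _ _ _ hc1, map_add_smul, linear_sub_eq] at this
      exact this
    -- only the other two vertices of the quadrilateral can occur in the combination
    have hsupp : ∀ σ : S, σ.1 ≠ .inl (i, j') → σ.1 ≠ .inl (i', j) → c σ = 0 := by
      rintro ⟨σ, hσ⟩ h1 h2
      have hl : ∃ l : A ⊕ B ⊕ C, Off l σ ∧ a l u = 0 ∧ a l v = 0 := by
        simp only [u, v, hz]
        rcases σ with ⟨x, y⟩ | e
        · by_cases hx : x = i ∨ x = i'
          · refine ⟨.inr (.inl y), rfl, ?_, ?_⟩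
            · rintro (rfl : y = j)
              rcases hx with rfl | rfl
              · exact hσ.1 rfl
              · exact h2 rfl
            · rintro (rfl : y = j')
              rcases hx with rfl | rfl
              · exact h1 rfl
              · exact hσ.2 rfl
          · push Not at hx
            exact ⟨.inl x, rfl, hx.1, hx.2⟩
        · exact ⟨.inr (.inr e), rfl, id, id⟩
      obtain ⟨l, hl1, hl2, hl3⟩ := hl
      have h0 := happ l
      rw [hl2, hl3, sub_zero, mul_zero, add_zero] at h0
      have h3 := (Finset.sum_eq_zero_iff_of_nonneg
        (fun (σ : S) _ => mul_nonneg (hc σ) (hnn l σ))).1 h0 ⟨σ, hσ⟩ (Finset.mem_univ _)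
      exact (mul_eq_zero.1 h3).resolve_right fun h4 => (hz l σ).1 h4 hl1
    let s1 : S := ⟨_, hS1⟩
    let s2 : S := ⟨_, hS2⟩
    have hne : s1 ≠ s2 := fun h => hi (by
      have := congrArg Subtype.val h
      simp only [s1, s2, Sum.inl.injEq, Prod.mk.injEq] at this
      exact this.1)
    have hsupp' : ∀ σ, σ ≠ s1 → σ ≠ s2 → c σ = 0 := fun σ h1 h2 =>
      hsupp σ (fun h => h1 (Subtype.ext h)) (fun h => h2 (Subtype.ext h))
    have hc1' : c s1 + c s2 = 1 := by rw [← sum_eq_pair c hne hsupp', hc1]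
    have hcx' : c s1 • w (.inl (i, j')) + c s2 • w (.inl (i', j)) = u + t • (v - u) := by
      rw [← hcx]
      have := sum_eq_pair (fun σ => c σ • w σ) hne fun σ h1 h2 => by rw [hsupp' σ h1 h2, zero_smul]
      exact this.symm
    have hz0 : ∀ l σ, ¬ Off l σ → a l (w σ) = 0 := fun l σ h => (hz l σ).2 h
    have hp : ∀ l σ, Off l σ → 0 < a l (w σ) := fun l σ h =>
      lt_of_le_of_ne (hnn l σ) fun h0 => (hz l σ).1 h0.symm h
    have hA : ∀ l, c s1 * a l (w (.inl (i, j'))) + c s2 * a l (w (.inl (i', j)))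
        = (1 - t) * a l u + t * a l v := by
      intro l
      have := sum_eq_pair (fun σ => c σ * a l (w σ)) hne fun σ h1 h2 => by
        rw [hsupp' σ h1 h2, zero_mul]
      have h2 := happ l
      rw [this] at h2
      linear_combination h2
    have e1 := hA (.inl i)
    rw [hz0 (.inl i) (.inl (i', j)) hi, hz0 (.inl i) (.inl (i', j')) hi] at e1
    have e2 := hA (.inl i')
    rw [hz0 (.inl i') (.inl (i, j')) (Ne.symm hi), hz0 (.inl i') (.inl (i, j)) (Ne.symm hi)] at e2
    have e3 := hA (.inr (.inl j))
    rw [hz0 (.inr (.inl j)) (.inl (i, j')) hj, hz0 (.inr (.inl j)) (.inl (i', j')) hj] at e3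
    have p1 := hp (.inl i) (.inl (i, j')) rfl
    have p2 := hp (.inl i) (.inl (i, j)) rfl
    have p3 := hp (.inl i') (.inl (i', j)) rfl
    have p4 := hp (.inl i') (.inl (i', j')) rfl
    have p5 := hp (.inr (.inl j)) (.inl (i', j)) rfl
    have p6 := hp (.inr (.inl j)) (.inl (i, j)) rfl
    simp only [mul_zero, add_zero, zero_add] at e1 e2 e3
    have g1 := hc s1
    have g2 := hc s2
    have t1 : 0 < 1 - t := by
      by_contra hcon
      push Not at hcon
      have q1 : c s1 * a (.inl i) (w (.inl (i, j'))) ≤ 0 := by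
        rw [e1]; exact mul_nonpos_of_nonpos_of_nonneg hcon p2.le
      have q2 : c s2 * a (.inr (.inl j)) (w (.inl (i', j))) ≤ 0 := by
        rw [e3]; exact mul_nonpos_of_nonpos_of_nonneg hcon p6.le
      have r1 : c s1 ≤ 0 := nonpos_of_mul_nonpos_left q1 p1
      have r2 : c s2 ≤ 0 := nonpos_of_mul_nonpos_left q2 p5
      linarith
    have t2 : 0 < c s1 := pos_of_mul_pos_left (e1 ▸ mul_pos t1 p2) p1.le
    have t3 : 0 < c s2 := pos_of_mul_pos_left (e3 ▸ mul_pos t1 p6) p5.le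
    have t4 : 0 < t := pos_of_mul_pos_left (e2 ▸ mul_pos t3 p3) p4.le
    refine ⟨1 - t, t, c s1, c s2, t1, t4, t2, t3, by linarith, ?_⟩
    rw [hcx', smul_sub, sub_smul, one_smul]
    abel

/-- The vertices and facets of a `C`-fold pyramid over a product of simplices, and its quadrilateral
faces, can be recovered from the face lattice. -/
theorem exists_isPyrProd_of_combEquiv [FiniteDimensional ℝ E] [FiniteDimensional ℝ F]
    [Finite A] [Finite B] [Finite C] {Q : Set E} (hQ : IsPolytope Q)
    {w0 : A × B ⊕ C → F} {a0 : A ⊕ B ⊕ C → F →ᵃ[ℝ] ℝ} (h0 : IsPyrProd w0 a0)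
    (he : CombEquiv Q (convexHull ℝ (Set.range w0))) :
    ∃ (w : A × B ⊕ C → E) (a : A ⊕ B ⊕ C → E →ᵃ[ℝ] ℝ), IsPyrProd w a ∧
      Q = convexHull ℝ (Set.range w) := by
  obtain ⟨e⟩ := he
  let φ := e.trans h0.faceOrderIso
  -- the face of `Q` corresponding to a face set
  have hempty : ∀ J : IsPyrProd.FaceSet A B C, (φ.symm J).1 = ∅ → J.1 = ∅ := by
    intro J hJ
    have hE : ∅ ∈ IsPyrProd.FaceSet A B C := by
      refine ⟨Set.univ, ?_⟩
      ext σ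
      simp only [Set.mem_empty_iff_false, Set.mem_univ, true_imp_iff, Set.mem_ofPred_eq,
        false_iff, not_forall, not_not]
      rcases σ with ⟨i, j⟩ | c
      · exact ⟨.inl i, rfl⟩
      · exact ⟨.inr (.inr c), rfl⟩
    have h1 : φ.symm J ≤ φ.symm ⟨∅, hE⟩ := by
      change (φ.symm J).1 ⊆ _
      rw [hJ]; exact Set.empty_subset _
    have h2 := φ.symm.le_iff_le.1 h1
    exact Set.subset_empty_iff.1 h2
  have hempty' : ∀ G, (φ G).1 = ∅ → G.1 = ∅ := by
    intro G hG
    have h1 : φ G ≤ φ ⟨∅, isExposed_empty⟩ := by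
      change (φ G).1 ⊆ _
      rw [hG]; exact Set.empty_subset _
    have h2 := φ.le_iff_le.1 h1
    exact Set.subset_empty_iff.1 h2
  have hext : ∀ x ∈ Q.extremePoints ℝ, IsExposed ℝ Q {x} := by
    intro x hx
    obtain ⟨s, rfl⟩ := hQ
    have hxn : x ∉ convexHull ℝ ((s : Set E) \ {x}) := fun h => by
      have := (convex_convexHull ℝ (s : Set E)).mem_extremePoints_iff_mem_sdiff_convexHull_sdiff.1 hx
      exact this.2 (convexHull_mono
        (Set.sdiff_subset_sdiff_left (subset_convexHull ℝ (s : Set E))) h)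
    obtain ⟨f, u, hu, hux⟩ := geometric_hahn_banach_closed_point (convex_convexHull ℝ _)
      (Set.Finite.isCompact_convexHull (𝕜 := ℝ) (s.finite_toSet.subset Set.sdiff_subset)).isClosed
      hxn
    have hb : ∀ y ∈ (s : Set E), 0 ≤ (AffineMap.const ℝ E (f x) - f.toLinearMap.toAffineMap) y := by
      intro y hy
      by_cases hyx : y = x
      · simp [hyx]
      · have := hu y (subset_convexHull ℝ _ ⟨hy, hyx⟩)
        simp; linarith
    refine isExposed_iff.2 ⟨AffineMap.const ℝ E (f x) - f.toLinearMap.toAffineMap,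
      nonneg_on_convexHull _ hb, ?_⟩
    rw [face_convexHull _ hb]
    have : {y ∈ (s : Set E) | (AffineMap.const ℝ E (f x) - f.toLinearMap.toAffineMap) y = 0}
        = {x} := by
      ext y
      constructor
      · rintro ⟨hy, hy0⟩
        by_contra hyx
        have := hu y (subset_convexHull ℝ _ ⟨hy, hyx⟩)
        simp [sub_eq_zero] at hy0
        linarith
      · rintro rfl
        exact ⟨extremePoints_convexHull_subset hx, by simp⟩
    rw [this, convexHull_singleton]
  -- minimal nonempty faces are points
  have hatom : ∀ σ : A × B ⊕ C, ∃ x, (φ.symm ⟨{σ}, singleton_mem_faceSet σ⟩).1 = {x} := by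
    intro σ
    set G := φ.symm ⟨{σ}, singleton_mem_faceSet σ⟩ with hG
    have hGne : G.1.Nonempty := by
      rw [Set.nonempty_iff_ne_empty]
      intro h
      have := hempty _ h
      simp at this
    obtain ⟨x, hx⟩ := (hQ.exposed G.2).isCompact.extremePoints_nonempty hGne
    have hxQ := G.2.isExtreme.extremePoints_subset_extremePoints hx
    have hle : (⟨{x}, hext x hxQ⟩ : {G // IsExposed ℝ Q G}) ≤ G :=
      Set.singleton_subset_iff.2 (extremePoints_subset hx)
    have h1 : φ ⟨{x}, hext x hxQ⟩ ≤ ⟨{σ}, singleton_mem_faceSet σ⟩ := by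
      rw [← φ.symm.le_iff_le, OrderIso.symm_apply_apply]; exact hle
    have h2 : (φ ⟨{x}, hext x hxQ⟩).1 = {σ} := by
      refine (Set.subset_singleton_iff_eq.1 h1).resolve_left fun h => ?_
      have := hempty' _ h
      simp at this
    have h3 : φ ⟨{x}, hext x hxQ⟩ = ⟨{σ}, singleton_mem_faceSet σ⟩ := Subtype.ext h2
    exact ⟨x, by rw [hG, ← h3, OrderIso.symm_apply_apply]⟩
  choose w hw using hatom
  have hwmem : ∀ (J : IsPyrProd.FaceSet A B C) σ, w σ ∈ (φ.symm J).1 ↔ σ ∈ J.1 := by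
    intro J σ
    rw [← Set.singleton_subset_iff, ← hw σ, ← Set.singleton_subset_iff (a := σ)]
    exact φ.symm.le_iff_le
  have hwmem' : ∀ G σ, w σ ∈ G.1 ↔ σ ∈ (φ G).1 := by
    intro G σ
    rw [← hwmem, OrderIso.symm_apply_apply]
  have hwQ : ∀ σ, w σ ∈ Q := fun σ =>
    (φ.symm ⟨{σ}, singleton_mem_faceSet σ⟩).2.subset (by rw [hw σ]; rfl)
  have hQw : Q = convexHull ℝ (Set.range w) := by
    apply Set.Subset.antisymm
    · conv_lhs => rw [hQ.eq_convexHull]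
      refine convexHull_mono fun x hx => ?_
      have : (φ ⟨{x}, hext x hx⟩).1.Nonempty := by
        rw [Set.nonempty_iff_ne_empty]
        intro h
        have := hempty' _ h
        simp at this
      obtain ⟨σ, hσ⟩ := this
      exact ⟨σ, (hwmem' ⟨{x}, hext x hx⟩ σ).2 hσ⟩
    · exact convexHull_min (by rintro _ ⟨σ, rfl⟩; exact hwQ σ) hQ.convex
  have hfac : ∀ i : A ⊕ B ⊕ C, ∃ a : E →ᵃ[ℝ] ℝ, (∀ x ∈ Q, 0 ≤ a x) ∧
      ∀ σ, a (w σ) = 0 ↔ ¬ Off i σ := by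
    intro i
    obtain ⟨a, ha, haG⟩ := isExposed_iff.1 (φ.symm ⟨_, face_mem_faceSet i⟩).2
    refine ⟨a, ha, fun σ => ?_⟩
    have := hwmem ⟨_, face_mem_faceSet i⟩ σ
    rw [haG] at this
    simpa [hwQ σ] using this
  choose a ha ha0 using hfac
  refine ⟨w, a, cross_of_not_edge (fun i σ => ha i _ (hwQ σ)) ha0 ?_, hQw⟩
  intro b hb i i' j j' h1 h2
  have hbQ : ∀ x ∈ Q, 0 ≤ b x := by
    rw [hQw]; exact nonneg_on_convexHull b (by rintro _ ⟨σ, rfl⟩; exact hb σ)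
  let G : {G // IsExposed ℝ Q G} := ⟨{x ∈ Q | b x = 0}, isExposed_iff.2 ⟨b, hbQ, rfl⟩⟩
  have hG : ∀ σ, b (w σ) = 0 ↔ σ ∈ (φ G).1 := by
    intro σ
    rw [← hwmem']; simp [G, hwQ σ]
  rw [hG] at h1 h2 ⊢
  obtain ⟨I, hI⟩ := (φ G).2
  rw [hI] at h1 h2 ⊢
  rintro (x | x | x) hx
  · exact fun h => h1 _ hx h
  · exact fun h => h2 _ hx h
  · exact id

end

/-! ### Pyramids over the triangular prism -/

section

variable {E : Type*} [NormedAddCommGroup E] [NormedSpace ℝ E]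
variable {F : Type*} [NormedAddCommGroup F] [NormedSpace ℝ F]
variable {A B C : Type*}

lemma IsPyrProd.map {w : A × B ⊕ C → E} {a : A ⊕ B ⊕ C → E →ᵃ[ℝ] ℝ} (h : IsPyrProd w a)
    (f : E →ᵃ[ℝ] F) (a' : A ⊕ B ⊕ C → F →ᵃ[ℝ] ℝ) (ha' : ∀ i σ, a' i (f (w σ)) = a i (w σ)) :
    IsPyrProd (f ∘ w) a' where
  nonneg i σ := by rw [Function.comp_apply, ha']; exact h.nonneg i σ
  eq_zero_iff i σ := by rw [Function.comp_apply, ha']; exact h.eq_zero_iff i σ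
  cross i i' j j' := by
    obtain ⟨α, β, γ, δ, hα, hβ, hγ, hδ, hs, he⟩ := h.cross i i' j j'
    exact ⟨α, β, γ, δ, hα, hβ, hγ, hδ, hs, map_cross f hs he⟩

lemma off_map_iff {A' B' C' : Type*} (eA : A' ≃ A) (eB : B' ≃ B) (eC : C' ≃ C)
    (i : A' ⊕ B' ⊕ C') (σ : A' × B' ⊕ C') :
    Off (Sum.map eA (Sum.map eB eC) i) (Sum.map (Prod.map eA eB) eC σ) ↔ Off i σ := by
  rcases i with i | i | i <;> rcases σ with ⟨x, y⟩ | c <;> simp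

lemma IsPyrProd.reindex {A' B' C' : Type*} {w : A × B ⊕ C → E} {a : A ⊕ B ⊕ C → E →ᵃ[ℝ] ℝ}
    (h : IsPyrProd w a) (eA : A' ≃ A) (eB : B' ≃ B) (eC : C' ≃ C) :
    IsPyrProd (w ∘ Sum.map (Prod.map eA eB) eC) (a ∘ Sum.map eA (Sum.map eB eC)) where
  nonneg i σ := h.nonneg _ _
  eq_zero_iff i σ := by
    rw [← off_map_iff eA eB eC]; exact h.eq_zero_iff _ _
  cross i i' j j' := h.cross _ _ _ _

/-- The standard model of a pyramid over the prism. -/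
lemma exists_isPyrProd_pyr (k : ℕ) :
    ∃ (w : Fin 2 × Fin 3 ⊕ Fin k → ((Fin 2 → ℝ) × (Fin 3 → ℝ)) × (Fin k → ℝ))
      (a : Fin 2 ⊕ Fin 3 ⊕ Fin k → ((Fin 2 → ℝ) × (Fin 3 → ℝ)) × (Fin k → ℝ) →ᵃ[ℝ] ℝ),
      IsPyrProd w a ∧ pyr k prism = convexHull ℝ (Set.range w) := by
  let w : Fin 2 × Fin 3 ⊕ Fin k → ((Fin 2 → ℝ) × (Fin 3 → ℝ)) × (Fin k → ℝ) :=
    Sum.elim (fun p => ((Pi.single p.1 1, Pi.single p.2 1), 0)) (fun c => (0, Pi.single c 1))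
  let a : Fin 2 ⊕ Fin 3 ⊕ Fin k → ((Fin 2 → ℝ) × (Fin 3 → ℝ)) × (Fin k → ℝ) →ᵃ[ℝ] ℝ :=
    Sum.elim (fun i => (LinearMap.proj i ∘ₗ LinearMap.fst ℝ _ _ ∘ₗ LinearMap.fst ℝ _ _).toAffineMap)
      (Sum.elim
        (fun j => (LinearMap.proj j ∘ₗ LinearMap.snd ℝ _ _ ∘ₗ LinearMap.fst ℝ _ _).toAffineMap)
        (fun c => (LinearMap.proj c ∘ₗ LinearMap.snd ℝ _ _).toAffineMap))
  have hval : ∀ i σ, (Off i σ → a i (w σ) = 1) ∧ (¬ Off i σ → a i (w σ) = 0) := by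
    rintro (i | i | i) (⟨x, y⟩ | c) <;>
      simp [a, w, Pi.single_apply]
  refine ⟨w, a, ⟨fun i σ => ?_, fun i σ => ?_, fun i i' j j' => ?_⟩, ?_⟩
  · by_cases h : Off i σ
    · rw [(hval i σ).1 h]; exact zero_le_one
    · rw [(hval i σ).2 h]
  · by_cases h : Off i σ
    · simp [(hval i σ).1 h, h]
    · simp [(hval i σ).2 h, h]
  · refine ⟨1, 1, 1, 1, one_pos, one_pos, one_pos, one_pos, rfl, ?_⟩
    simp only [w, Sum.elim_inl, one_smul, Prod.mk_add_mk, add_zero]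
    exact congrArg (fun z => ((_, z), _)) (add_comm _ _)
  · have h1 : (prism ×ˢ {(0 : Fin k → ℝ)} : Set (((Fin 2 → ℝ) × (Fin 3 → ℝ)) × (Fin k → ℝ)))
        = convexHull ℝ (((Set.range fun i : Fin 2 => (Pi.single i 1 : Fin 2 → ℝ)) ×ˢ
          (Set.range fun j : Fin 3 => (Pi.single j 1 : Fin 3 → ℝ))) ×ˢ {0}) := by
      rw [prism, convexHull_prod, convexHull_prod, convexHull_rangle_single_eq_stdSimplex,
        convexHull_rangle_single_eq_stdSimplex, convexHull_singleton]
    rw [pyr, h1, convexHull_convexHull_union_left]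
    congr 1
    ext x
    constructor
    · rintro (⟨⟨⟨i, hi⟩, ⟨j, hj⟩⟩, h0⟩ | ⟨c, rfl⟩)
      · refine ⟨.inl (i, j), ?_⟩
        exact Prod.ext (Prod.ext hi hj) h0.symm
      · exact ⟨.inr c, rfl⟩
    · rintro ⟨⟨i, j⟩ | c, rfl⟩
      · exact Or.inl ⟨⟨⟨i, rfl⟩, ⟨j, rfl⟩⟩, rfl⟩
      · exact Or.inr ⟨c, rfl⟩

lemma exists_isPyrProd_prism :
    ∃ (w : Fin 2 × Fin 3 ⊕ Fin 0 → (Fin 2 → ℝ) × (Fin 3 → ℝ))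
      (a : Fin 2 ⊕ Fin 3 ⊕ Fin 0 → (Fin 2 → ℝ) × (Fin 3 → ℝ) →ᵃ[ℝ] ℝ),
      IsPyrProd w a ∧ prism = convexHull ℝ (Set.range w) := by
  obtain ⟨w, a, h, hw⟩ := exists_isPyrProd_pyr 0
  let f := (LinearMap.fst ℝ ((Fin 2 → ℝ) × (Fin 3 → ℝ)) (Fin 0 → ℝ)).toAffineMap
  let g := (LinearMap.inl ℝ ((Fin 2 → ℝ) × (Fin 3 → ℝ)) (Fin 0 → ℝ)).toAffineMap
  have hgf : ∀ x, g (f x) = x := fun x => Prod.ext rfl (Subsingleton.elim _ _)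
  refine ⟨f ∘ w, fun i => (a i).comp g, h.map f _ fun i σ => by
    rw [AffineMap.comp_apply, hgf], ?_⟩
  rw [Set.range_comp, ← AffineMap.image_convexHull, ← hw, pyr]
  have hpc : Convex ℝ (prism ×ˢ {(0 : Fin 0 → ℝ)}) :=
    ((convex_stdSimplex ℝ _).prod (convex_stdSimplex ℝ _)).prod (convex_singleton _)
  rw [Set.range_eq_empty, Set.union_empty, hpc.convexHull_eq]
  ext x
  constructor
  · intro hx; exact ⟨(x, 0), ⟨hx, rfl⟩, rfl⟩
  · rintro ⟨y, hy, rfl⟩; exact hy.1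

lemma isProjOfPyrPrism_of_isPyrProd [FiniteDimensional ℝ F] [Fintype A] [Fintype B] [Fintype C]
    {d : ℕ} (hA : Fintype.card A = 2) (hB : Fintype.card B = 3) (hC : Fintype.card C + 2 = d)
    {w : A × B ⊕ C → F} {a : A ⊕ B ⊕ C → F →ᵃ[ℝ] ℝ} (h : IsPyrProd w a) (ρ : F →ᵃ[ℝ] E) :
    IsProjOfPyrPrism d (ρ '' convexHull ℝ (Set.range w)) := by
  let e := toEuclidean (E := F)
  let f : F →ᵃ[ℝ] _ := e.toLinearEquiv.toLinearMap.toAffineMap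
  let g : _ →ᵃ[ℝ] F := e.symm.toLinearEquiv.toLinearMap.toAffineMap
  have hgf : ∀ x, g (f x) = x := fun x => by simp [f, g]
  let eA := (Fintype.equivFinOfCardEq hA).symm
  let eB := (Fintype.equivFinOfCardEq hB).symm
  let eC := (Fintype.equivFin C).symm
  have h2 := (h.map f (fun i => (a i).comp g) fun i σ => by
    rw [AffineMap.comp_apply, hgf]).reindex eA eB eC
  have hr : Set.range ((f ∘ w) ∘ Sum.map (Prod.map eA eB) eC) = f '' Set.range w := by
    rw [← Set.range_comp]
    refine Function.Surjective.range_comp ?_ _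
    exact Function.Surjective.sumMap (eA.surjective.prodMap eB.surjective) eC.surjective
  obtain ⟨w0, a0, h0, hw0⟩ := exists_isPyrProd_pyr (Fintype.card C)
  refine ⟨_, _, convexHull ℝ (Set.range ((f ∘ w) ∘ Sum.map (Prod.map eA eB) eC)), ρ.comp g, hC,
    isPolytope_range _, ?_, ?_⟩
  · rw [hw0]; exact h2.combEquiv h0
  · rw [hr, ← AffineMap.image_convexHull, ← Set.image_comp]
    congr 1
    funext x
    simp [hgf]

/-- The combinatorial equivalence in the definition made explicit by vertices and facet
functions. -/
lemma IsProjOfPyrPrism.exists_isPyrProd {d : ℕ} {P : Set E} (h : IsProjOfPyrPrism d P) :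
    ∃ (k N : ℕ) (w : Fin 2 × Fin 3 ⊕ Fin k → EuclideanSpace ℝ (Fin N))
      (a : Fin 2 ⊕ Fin 3 ⊕ Fin k → EuclideanSpace ℝ (Fin N) →ᵃ[ℝ] ℝ)
      (π : EuclideanSpace ℝ (Fin N) →ᵃ[ℝ] E),
      k + 2 = d ∧ IsPyrProd w a ∧ π '' convexHull ℝ (Set.range w) = P := by
  obtain ⟨k, N, Q, π, hk, hQ, he, hP⟩ := h
  obtain ⟨w0, a0, h0, hw0⟩ := exists_isPyrProd_pyr k
  rw [hw0] at he
  obtain ⟨w, a, hw, rfl⟩ := exists_isPyrProd_of_combEquiv hQ h0 he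
  exact ⟨k, N, w, a, π, hk, hw, hP⟩

/-- A `(d - 2)`-fold pyramid over the prism has at most `d + 3` facets. -/
lemma xc_le_of_isProjOfPyrPrism {d : ℕ} {P : Set E} (h : IsProjOfPyrPrism d P) :
    xc P ≤ d + 3 := by
  obtain ⟨k, N, w, a, π, rfl, hw, hP⟩ := h.exists_isPyrProd
  refine (xc_le_of_image (isPolytope_range w) π hP).trans (hw.numFacets_le.trans ?_)
  simp
  omega

end

/-! ### The model of a polytope with two more facets than its dimension -/

section

variable {A B C : Type*} {l : A ⊕ B ⊕ C → ℝ}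

/-- The affine space containing the standard model of a `C`-fold pyramid over a product of two
simplices, in coordinates given by the (suitably scaled) slacks of the facets. -/
def modelHull [Fintype A] [Fintype B] [Fintype C] (l : A ⊕ B ⊕ C → ℝ) : Set (A ⊕ B ⊕ C → ℝ) :=
  {s | ∑ i, s (.inl i) = ∑ j, s (.inr (.inl j)) ∧ ∑ x, l x * s x = 1}

/-- The nonnegative part of `modelHull l`. Up to an affine isomorphism, every polytope with two more
facets than its dimension is of this form. -/
def model [Fintype A] [Fintype B] [Fintype C] (l : A ⊕ B ⊕ C → ℝ) : Set (A ⊕ B ⊕ C → ℝ) :=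
  {s | s ∈ modelHull l ∧ ∀ x, 0 ≤ s x}

/-- The reciprocal of the nonzero coordinates of a vertex of the model. -/
def vertexWeight (l : A ⊕ B ⊕ C → ℝ) : A × B ⊕ C → ℝ
  | .inl (i, j) => l (.inl i) + l (.inr (.inl j))
  | .inr c => l (.inr (.inr c))

open Classical in
/-- The vertices of the model. -/
def modelVertex (l : A ⊕ B ⊕ C → ℝ) (σ : A × B ⊕ C) (x : A ⊕ B ⊕ C) : ℝ :=
  if Off x σ then (vertexWeight l σ)⁻¹ else 0

lemma vertexWeight_pos (hl : ∀ x, 0 < l x) (σ : A × B ⊕ C) : 0 < vertexWeight l σ := by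
  rcases σ with ⟨i, j⟩ | c
  · exact add_pos (hl _) (hl _)
  · exact hl _

lemma modelVertex_of_off {x : A ⊕ B ⊕ C} {σ : A × B ⊕ C} (h : Off x σ) :
    modelVertex l σ x = (vertexWeight l σ)⁻¹ := if_pos h

lemma modelVertex_of_not_off {x : A ⊕ B ⊕ C} {σ : A × B ⊕ C} (h : ¬ Off x σ) :
    modelVertex l σ x = 0 := if_neg h

lemma modelVertex_nonneg (hl : ∀ x, 0 < l x) (σ : A × B ⊕ C) (x) : 0 ≤ modelVertex l σ x := by
  by_cases h : Off x σ
  · rw [modelVertex_of_off h]; exact (inv_pos.2 (vertexWeight_pos hl σ)).le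
  · rw [modelVertex_of_not_off h]

lemma modelVertex_eq_zero_iff (hl : ∀ x, 0 < l x) (σ : A × B ⊕ C) (x) :
    modelVertex l σ x = 0 ↔ ¬ Off x σ := by
  by_cases h : Off x σ
  · rw [modelVertex_of_off h]; simp [h, (vertexWeight_pos hl σ).ne']
  · simp [modelVertex_of_not_off h, h]

lemma vertexWeight_smul (hl : ∀ x, 0 < l x) (i : A) (j : B) [DecidableEq A] [DecidableEq B]
    [DecidableEq C] : vertexWeight l (.inl (i, j)) • modelVertex l (.inl (i, j)) =
      (Pi.single (.inl i) 1 + Pi.single (.inr (.inl j)) 1 : A ⊕ B ⊕ C → ℝ) := by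
  funext x
  have hw := (vertexWeight_pos hl (.inl (i, j) : A × B ⊕ C)).ne'
  simp only [Pi.smul_apply, smul_eq_mul, Pi.add_apply, modelVertex]
  rcases x with k | k | k
  · by_cases hk : k = i
    · subst hk; simp [hw]
    · simp [hk]
  · by_cases hk : k = j
    · subst hk; simp [hw]
    · simp [hk]
  · simp

lemma modelVertex_cross (hl : ∀ x, 0 < l x) (i i' : A) (j j' : B) :
    ∃ α β γ δ : ℝ, 0 < α ∧ 0 < β ∧ 0 < γ ∧ 0 < δ ∧ α + β = γ + δ ∧
      α • modelVertex l (.inl (i, j)) + β • modelVertex l (.inl (i', j')) =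
        γ • modelVertex l (.inl (i, j')) + δ • modelVertex l (.inl (i', j)) := by
  classical
  refine ⟨_, _, _, _, vertexWeight_pos hl (.inl (i, j)), vertexWeight_pos hl (.inl (i', j')),
    vertexWeight_pos hl (.inl (i, j')), vertexWeight_pos hl (.inl (i', j)), ?_, ?_⟩
  · simp only [vertexWeight]; ring
  · simp only [vertexWeight_smul hl]; abel

/-- The coordinate functions, which are the facet functions of the model. -/
def coordFun (x : A ⊕ B ⊕ C) : (A ⊕ B ⊕ C → ℝ) →ᵃ[ℝ] ℝ :=
  (LinearMap.proj x : (A ⊕ B ⊕ C → ℝ) →ₗ[ℝ] ℝ).toAffineMap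

@[simp] lemma coordFun_apply (x : A ⊕ B ⊕ C) (s) : coordFun x s = s x := rfl

variable [Fintype A] [Fintype B] [Fintype C]

lemma convex_model : Convex ℝ (model l) := by
  rintro s ⟨⟨h1, h2⟩, h3⟩ t ⟨⟨k1, k2⟩, k3⟩ a b ha hb hab
  refine ⟨⟨?_, ?_⟩, fun x => ?_⟩
  · simp only [Pi.add_apply, Pi.smul_apply, smul_eq_mul, Finset.sum_add_distrib, ← Finset.mul_sum]
    rw [h1, k1]
  · simp only [Pi.add_apply, Pi.smul_apply, smul_eq_mul]
    have : ∑ x, l x * (a * s x + b * t x) = a * ∑ x, l x * s x + b * ∑ x, l x * t x := by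
      rw [Finset.mul_sum, Finset.mul_sum, ← Finset.sum_add_distrib]
      exact Finset.sum_congr rfl fun x _ => by ring
    rw [this, h2, k2]; linarith
  · have := h3 x; have := k3 x
    simp only [Pi.add_apply, Pi.smul_apply, smul_eq_mul]; positivity

lemma modelVertex_mem (hl : ∀ x, 0 < l x) (σ : A × B ⊕ C) : modelVertex l σ ∈ model l := by
  classical
  refine ⟨?_, modelVertex_nonneg hl σ⟩
  have h := (vertexWeight_pos hl σ).ne'
  rcases σ with ⟨i, j⟩ | c
  · constructor
    · simp [modelVertex]
    · simp only [modelVertex, Fintype.sum_sum_type, mul_ite, mul_zero]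
      simp only [vertexWeight] at h
      simp [vertexWeight]
      field_simp
  · constructor
    · simp [modelVertex]
    · simp only [modelVertex, Fintype.sum_sum_type, mul_ite, mul_zero]
      simp only [vertexWeight] at h
      simp [vertexWeight, h]

/-- A point of the model supported on the coordinates of a vertex is that vertex. -/
lemma eq_modelVertex {s : A ⊕ B ⊕ C → ℝ} (hs : s ∈ modelHull l) {σ : A × B ⊕ C}
    (h : ∀ x, ¬ Off x σ → s x = 0) : s = modelVertex l σ := by
  classical
  obtain ⟨h1, h2⟩ := hs
  rcases σ with ⟨i, j⟩ | c
  · rw [Finset.sum_eq_single i (fun i' _ hi => h (.inl i') hi) (by simp),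
      Finset.sum_eq_single j (fun j' _ hj => h (.inr (.inl j')) hj) (by simp)] at h1
    rw [sum_eq_pair (i := .inl i) (j := .inr (.inl j)) _ (by simp) (fun k hk hk' => by
      rw [h k, mul_zero]
      rcases k with k | k | k
      · exact fun h0 => hk (congrArg _ h0)
      · exact fun h0 => hk' (congrArg (fun z => Sum.inr (Sum.inl z)) h0)
      · exact id), ← h1, ← add_mul] at h2
    have h3 : s (.inl i) = (l (.inl i) + l (.inr (.inl j)))⁻¹ := eq_inv_of_mul_eq_one_right h2
    funext x
    by_cases hx : Off x (.inl (i, j))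
    · rw [modelVertex_of_off hx, vertexWeight, ← h3]
      rcases x with k | k | k
      · obtain rfl : k = i := hx; rfl
      · obtain rfl : k = j := hx; exact h1.symm
      · exact hx.elim
    · rw [modelVertex_of_not_off hx, h x hx]
  · rw [Finset.sum_eq_single (.inr (.inr c)) (fun k _ hk => by
      rw [h k, mul_zero]
      rcases k with k | k | k
      · exact id
      · exact id
      · exact fun h0 => hk (congrArg (fun z => Sum.inr (Sum.inr z)) h0)) (by simp)] at h2
    have h3 : s (.inr (.inr c)) = (l (.inr (.inr c)))⁻¹ := eq_inv_of_mul_eq_one_right h2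
    funext x
    by_cases hx : Off x (.inr c)
    · rw [modelVertex_of_off hx, vertexWeight, ← h3]
      rcases x with k | k | k
      · exact hx.elim
      · exact hx.elim
      · obtain rfl : k = c := hx; rfl
    · rw [modelVertex_of_not_off hx, h x hx]

/-- The model is generated by its vertices: a point is decomposed as in a transportation problem,
with the product coupling of its `A`- and `B`-coordinates. -/
lemma model_eq_convexHull (hl : ∀ x, 0 < l x) :
    model l = convexHull ℝ (Set.range (modelVertex l)) := by
  classical
  apply Set.Subset.antisymm
  · rintro s ⟨⟨h1, h2⟩, h3⟩
    set T := ∑ i, s (.inl i) with hT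
    let m : A → B → ℝ := fun i j => s (.inl i) * s (.inr (.inl j)) / T
    have hm1 : ∀ i, ∑ j, m i j = s (.inl i) := by
      intro i
      simp only [m]
      rw [← Finset.sum_div, ← Finset.mul_sum, ← h1]
      by_cases h0 : T = 0
      · rw [h0]
        have := (Finset.sum_eq_zero_iff_of_nonneg (fun i _ => h3 (.inl i))).1 (hT ▸ h0) i
          (Finset.mem_univ i)
        rw [this]; simp
      · rw [mul_div_cancel_right₀ _ h0]
    have hm2 : ∀ j, ∑ i, m i j = s (.inr (.inl j)) := by
      intro j
      simp only [m]
      rw [← Finset.sum_div, ← Finset.sum_mul, ← hT]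
      by_cases h0 : T = 0
      · have := (Finset.sum_eq_zero_iff_of_nonneg (fun i _ => h3 (.inr (.inl i)))).1 (h1 ▸ h0) j
          (Finset.mem_univ j)
        rw [this]; simp
      · rw [mul_div_cancel_left₀ _ h0]
    have hT0 : 0 ≤ T := Finset.sum_nonneg fun i _ => h3 _
    rw [mem_convexHull_range_iff]
    refine ⟨Sum.elim (fun p => m p.1 p.2 * vertexWeight l (.inl p))
      (fun c => s (.inr (.inr c)) * vertexWeight l (.inr c)), ?_, ?_, ?_⟩
    · rintro (⟨i, j⟩ | c)
      · have := h3 (.inl i); have := h3 (.inr (.inl j))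
        have := vertexWeight_pos hl (.inl (i, j))
        simp only [Sum.elim_inl, m]; positivity
      · have := h3 (.inr (.inr c)); have := vertexWeight_pos hl (.inr c)
        simp only [Sum.elim_inr]; positivity
    · simp only [Fintype.sum_sum_type, Fintype.sum_prod_type, Sum.elim_inl, Sum.elim_inr,
        vertexWeight, mul_add, Finset.sum_add_distrib] at h2 ⊢
      rw [Finset.sum_comm (f := fun i j => m i j * l (.inr (.inl j)))]
      simp only [← Finset.sum_mul, hm1, hm2]
      rw [← h2, ← add_assoc]
      simp only [mul_comm]
    · have hcw : ∀ (r : ℝ) σ x, (r * vertexWeight l σ) * modelVertex l σ x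
          = if Off x σ then r else 0 := by
        intro r σ x
        by_cases hx : Off x σ
        · rw [modelVertex_of_off hx, if_pos hx, mul_inv_cancel_right₀ (vertexWeight_pos hl σ).ne']
        · rw [modelVertex_of_not_off hx, if_neg hx, mul_zero]
      funext x
      simp only [Finset.sum_apply, Pi.smul_apply, smul_eq_mul, Fintype.sum_sum_type,
        Fintype.sum_prod_type, Sum.elim_inl, Sum.elim_inr, hcw]
      rcases x with k | k | k
      · simp [← hm1 k]
      · simp [← hm2 k]
      · simp
  · refine convexHull_min ?_ convex_model
    rintro _ ⟨σ, rfl⟩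
    exact modelVertex_mem hl σ

lemma isPyrProd_model (hl : ∀ x, 0 < l x) : IsPyrProd (modelVertex l) coordFun :=
  ⟨fun x σ => modelVertex_nonneg hl σ x, fun x σ => modelVertex_eq_zero_iff hl σ x,
    modelVertex_cross hl⟩

/-- Deleting the vertices `(i, j₀)` with `i ≠ i₁` from a product of simplices turns the vertex
`(i₁, j₀)` into the apex of a pyramid. -/
lemma isPyrProd_model_delete (hl : ∀ x, 0 < l x) (i₁ : A) (j₀ : B) :
    ∃ a : A ⊕ {j : B // j ≠ j₀} ⊕ Option C → (A ⊕ B ⊕ C → ℝ) →ᵃ[ℝ] ℝ,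
      IsPyrProd (Sum.elim (fun p => modelVertex l (.inl (p.1, p.2.1)))
        (fun o => o.elim (modelVertex l (.inl (i₁, j₀))) fun c => modelVertex l (.inr c))) a := by
  classical
  let a : A ⊕ {j : B // j ≠ j₀} ⊕ Option C → (A ⊕ B ⊕ C → ℝ) →ᵃ[ℝ] ℝ :=
    Sum.elim (fun i => coordFun (.inl i) - (if i = i₁ then 1 else 0 : ℝ) • coordFun (.inr (.inl j₀)))
      (Sum.elim (fun j => coordFun (.inr (.inl j.1)))
        (fun o => o.elim (coordFun (.inr (.inl j₀))) fun c => coordFun (.inr (.inr c))))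
  have hnn := fun σ x => modelVertex_nonneg hl σ x
  have hz := fun σ x => modelVertex_eq_zero_iff hl σ x
  have h1 : ∀ i p, a (.inl i) (modelVertex l (.inl p)) = modelVertex l (.inl p) (.inl i)
      - (if i = i₁ then 1 else 0) * modelVertex l (.inl p) (.inr (.inl j₀)) := fun i p => by
    by_cases hi : i = i₁ <;> simp [a, hi]
  have h1' : ∀ i c, a (.inl i) (modelVertex l (.inr c)) = 0 := fun i c => by
    by_cases hi : i = i₁ <;> simp [a, modelVertex, hi]
  have h2 : ∀ i (p : A × {j : B // j ≠ j₀}), a (.inl i) (modelVertex l (.inl (p.1, p.2.1))) =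
      modelVertex l (.inl (p.1, p.2.1)) (.inl i) := fun i p => by
    rw [h1, (hz (.inl (p.1, p.2.1)) (.inr (.inl j₀))).2 (fun h => p.2.2 h.symm)]; simp
  have h3 : ∀ i, a (.inl i) (modelVertex l (.inl (i₁, j₀))) = 0 := fun i => by
    rw [h1]
    by_cases hi : i = i₁
    · subst hi
      rw [modelVertex_of_off (by simp), modelVertex_of_off (by simp)]; simp
    · rw [modelVertex_of_not_off (by simpa using hi)]; simp [hi]
  refine ⟨a, ?_, ?_, fun i i' j j' => modelVertex_cross hl i i' j.1 j'.1⟩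
  · rintro (i | j | o) (⟨i', j'⟩ | o')
    · simp only [Sum.elim_inl]; rw [h2 i (i', j')]; exact hnn _ _
    · cases o' with
      | none => simp [h3]
      | some c => simp [h1']
    · exact hnn _ _
    · cases o' <;> exact hnn _ _
    · cases o <;> exact hnn _ _
    · cases o <;> cases o' <;> exact hnn _ _
  · rintro (i | j | o) (⟨i', j'⟩ | o')
    · simp only [Sum.elim_inl]; rw [h2 i (i', j'), hz]; simp
    · cases o' with
      | none => simp [h3]
      | some c => simp [h1']
    · refine (hz _ _).trans ?_
      simp [Subtype.ext_iff]
    · cases o' with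
      | none => exact (hz _ _).trans (by simpa using j.2)
      | some c => exact (hz _ _).trans (by simp)
    · cases o with
      | none => exact (hz _ _).trans (by simpa using j'.2.symm)
      | some c => exact (hz _ _).trans (by simp)
    · cases o with
      | none => cases o' with
        | none => exact (hz _ _).trans (by simp)
        | some c => exact (hz _ _).trans (by simp)
      | some c => cases o' with
        | none => exact (hz _ _).trans (by simp)
        | some c' => exact (hz _ _).trans (by simp)

end

section

variable {E : Type*} [NormedAddCommGroup E] [NormedSpace ℝ E]
universe u
variable {F : Type u} [NormedAddCommGroup F] [NormedSpace ℝ F]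

/-- A proper linear section `{s ∈ M | ∑ l i * s i = 1}` of codimension one in its hyperplane is, up
to scaling the coordinates, the affine hull of a model. -/
lemma exists_rescale {ι : Type u} [Fintype ι] {M : Submodule ℝ (ι → ℝ)} {l : ι → ℝ}
    (hM : Module.finrank ℝ M + 1 = Fintype.card ι) (hl : ∀ i, 0 < l i)
    (hpos : ∃ s ∈ M, ∀ i, 0 < s i) :
    ∃ (A B C : Type u) (_ : Fintype A) (_ : Fintype B) (_ : Fintype C) (l' : A ⊕ B ⊕ C → ℝ)
      (D : (ι → ℝ) ≃ₗ[ℝ] (A ⊕ B ⊕ C → ℝ)), Nonempty A ∧ Nonempty B ∧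
      Fintype.card A ≤ Fintype.card B ∧
      Fintype.card A + Fintype.card B + Fintype.card C = Fintype.card ι ∧ (∀ x, 0 < l' x) ∧
      (∀ s, (s ∈ M ∧ ∑ i, l i * s i = 1) ↔ D s ∈ modelHull l') ∧
      ∀ s, (∀ i, 0 ≤ s i) ↔ ∀ x, 0 ≤ D s x := by
  classical
  obtain ⟨μ, hμ0, hμM, hcard⟩ : ∃ μ : ι → ℝ, μ ≠ 0 ∧ (∀ s, s ∈ M ↔ ∑ i, μ i * s i = 0) ∧
      Fintype.card {i // 0 < μ i} ≤ Fintype.card {i // μ i < 0} := by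
    have hlt : M < ⊤ := by
      refine lt_top_iff_ne_top.2 fun h => ?_
      rw [h, finrank_top, Module.finrank_fintype_fun_eq_card] at hM
      omega
    obtain ⟨f, hf0, hfM⟩ := Submodule.exists_le_ker_of_lt_top M hlt
    have hfr := LinearMap.finrank_range_add_finrank_ker f
    have hrange : Module.finrank ℝ (LinearMap.range f) = 1 := by
      rw [LinearMap.range_eq_top.2 (LinearMap.surjective hf0), finrank_top, Module.finrank_self]
    rw [Module.finrank_fintype_fun_eq_card, hrange] at hfr
    have hker : M = LinearMap.ker f := Submodule.eq_of_le_of_finrank_eq hfM (by omega)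
    have hfs : ∀ s, f s = ∑ i, f (Pi.single i 1) * s i := by
      intro s
      conv_lhs => rw [pi_eq_sum_univ' s, map_sum]
      refine Finset.sum_congr rfl fun i _ => ?_
      rw [map_smul, smul_eq_mul, mul_comm]
    have hne : (fun i => f (Pi.single i 1)) ≠ 0 := fun h => hf0 (LinearMap.ext fun s => by
      rw [hfs]; simp [fun i => congrFun h i])
    by_cases hc : Fintype.card {i // 0 < f (Pi.single i 1)} ≤
        Fintype.card {i // f (Pi.single i 1) < 0}
    · exact ⟨_, hne, fun s => by rw [hker, LinearMap.mem_ker, hfs], hc⟩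
    · refine ⟨fun i => -f (Pi.single i 1), ?_, fun s => ?_, ?_⟩
      · intro h; exact hne (funext fun i => by simpa using congrFun h i)
      · rw [hker, LinearMap.mem_ker, hfs]; simp
      · simp only [Left.neg_pos_iff, Left.neg_neg_iff]; omega
  let A := {i // 0 < μ i}
  let B := {i // μ i < 0}
  let C := {i // μ i = 0}
  let ε : A ⊕ B ⊕ C → ι := Sum.elim (fun a => a.1) (Sum.elim (fun b => b.1) (fun c => c.1))
  have hε : Function.Bijective ε := by
    constructor
    · rintro (⟨a, ha⟩ | ⟨b, hb⟩ | ⟨c, hc⟩) (⟨a', ha'⟩ | ⟨b', hb'⟩ | ⟨c', hc'⟩) h <;>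
        simp only [ε, Sum.elim_inl, Sum.elim_inr] at h <;> subst h <;>
        first | rfl | (exfalso; linarith)
    · intro i
      rcases lt_trichotomy (μ i) 0 with h | h | h
      · exact ⟨.inr (.inl ⟨i, h⟩), rfl⟩
      · exact ⟨.inr (.inr ⟨i, h⟩), rfl⟩
      · exact ⟨.inl ⟨i, h⟩, rfl⟩
  let e : A ⊕ B ⊕ C ≃ ι := Equiv.ofBijective ε hε
  let κ : ι → ℝ := fun i => if μ i = 0 then 1 else |μ i|
  have hκ : ∀ i, 0 < κ i := fun i => by
    by_cases h : μ i = 0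
    · simp [κ, h]
    · simp [κ, h]
  let D : (ι → ℝ) ≃ₗ[ℝ] (A ⊕ B ⊕ C → ℝ) :=
    (LinearEquiv.piCongrRight fun i => LinearEquiv.smulOfNeZero ℝ ℝ (κ i) (hκ i).ne').trans
      (LinearEquiv.funCongrLeft ℝ ℝ e)
  have hD : ∀ s x, D s x = κ (ε x) * s (ε x) := fun s x => rfl
  have hsum : ∀ g : ι → ℝ, ∑ i, g i = ∑ a : A, g a.1 + (∑ b : B, g b.1 + ∑ c : C, g c.1) := by
    intro g
    rw [← e.sum_comp g, Fintype.sum_sum_type, Fintype.sum_sum_type]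
    rfl
  have hμs : ∀ s : ι → ℝ, ∑ i, μ i * s i =
      ∑ a : A, D s (.inl a) - ∑ b : B, D s (.inr (.inl b)) := by
    intro s
    rw [hsum, sub_eq_add_neg, ← Finset.sum_neg_distrib]
    have hc : ∑ c : C, μ c.1 * s c.1 = 0 :=
      Finset.sum_eq_zero fun c _ => by rw [c.2, zero_mul]
    rw [hc, add_zero]
    congr 1
    · refine Finset.sum_congr rfl fun a _ => ?_
      rw [hD]; simp [ε, κ, a.2.ne', abs_of_pos a.2]
    · refine Finset.sum_congr rfl fun b _ => ?_
      rw [hD]; simp [ε, κ, b.2.ne, abs_of_neg b.2]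
  have hls : ∀ s : ι → ℝ, ∑ i, l i * s i = ∑ x, l (ε x) / κ (ε x) * D s x := by
    intro s
    rw [← e.sum_comp]
    refine Finset.sum_congr rfl fun x _ => ?_
    rw [hD]
    have := (hκ (ε x)).ne'
    change l (ε x) * s (ε x) = _
    field_simp
  obtain ⟨s, hsM, hs⟩ := hpos
  rw [hμM] at hsM
  have hA : Nonempty A := by
    by_contra hA
    have h0 : ∀ i, μ i * s i ≤ 0 := fun i => by
      have : μ i ≤ 0 := by
        by_contra hc; exact hA ⟨⟨i, not_le.1 hc⟩⟩
      exact mul_nonpos_of_nonpos_of_nonneg this (hs i).le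
    refine hμ0 (funext fun i => ?_)
    have := (Finset.sum_eq_zero_iff_of_nonpos fun i _ => h0 i).1 hsM i (Finset.mem_univ i)
    exact (mul_eq_zero.1 this).resolve_right (hs i).ne'
  have hB : Nonempty B := by
    by_contra hB
    have h0 : ∀ i, 0 ≤ μ i * s i := fun i => by
      have : 0 ≤ μ i := by
        by_contra hc; exact hB ⟨⟨i, not_le.1 hc⟩⟩
      exact mul_nonneg this (hs i).le
    refine hμ0 (funext fun i => ?_)
    have := (Finset.sum_eq_zero_iff_of_nonneg fun i _ => h0 i).1 hsM i (Finset.mem_univ i)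
    exact (mul_eq_zero.1 this).resolve_right (hs i).ne'
  refine ⟨A, B, C, inferInstance, inferInstance, inferInstance, fun x => l (ε x) / κ (ε x), D, hA,
    hB, hcard, ?_, fun x => div_pos (hl _) (hκ _), fun s => ?_, fun s => ?_⟩
  · rw [← Fintype.card_congr e, Fintype.card_sum, Fintype.card_sum]; ring
  · rw [hμM, hμs, sub_eq_zero, hls]; rfl
  · constructor
    · intro h x; rw [hD]; exact mul_nonneg (hκ _).le (h _)
    · intro h i
      obtain ⟨x, rfl⟩ := hε.2 i
      have := h x
      rw [hD] at this
      exact nonneg_of_mul_nonneg_right this (hκ _)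

/-- A projection, of one dimension less, of a polytope with two more facets than its dimension is
the projection of a model along a direction `v`. -/
lemma exists_model [FiniteDimensional ℝ F] {Q : Set F} (hQ : IsPolytope Q) (hd : 1 ≤ dim Q)
    (hm : numFacets Q = dim Q + 2) (π : F →ᵃ[ℝ] E) (hdim : dim (π '' Q) + 1 = dim Q) :
    ∃ (A B C : Type u) (_ : Fintype A) (_ : Fintype B) (_ : Fintype C) (l : A ⊕ B ⊕ C → ℝ)
      (ρ : (A ⊕ B ⊕ C → ℝ) →ᵃ[ℝ] E) (v : A ⊕ B ⊕ C → ℝ), Nonempty A ∧ Nonempty B ∧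
      Fintype.card A ≤ Fintype.card B ∧
      Fintype.card A + Fintype.card B + Fintype.card C = numFacets Q ∧ (∀ x, 0 < l x) ∧
      π '' Q = ρ '' model l ∧ v ≠ 0 ∧ ∑ x, l x * v x = 0 ∧ ρ.linear v = 0 ∧
      (∀ s ∈ modelHull l, s + v ∈ modelHull l) ∧
      ∀ s ∈ modelHull l, ∀ s' ∈ modelHull l, ρ s = ρ s' → ∃ t : ℝ, s' = s + t • v := by
  have := hQ.facets_finite.fintype
  have hcard : Fintype.card (facets Q) = numFacets Q := by
    rw [numFacets, ← Nat.card_coe_set_eq, Nat.card_eq_fintype_card]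
  obtain ⟨σ, M, l, hM, hl, hinj, hσ, hsurj, hQσ, hpos⟩ := exists_slack_model hQ hd
  obtain ⟨A, B, C, _, _, _, l', D, hA, hB, hAB, hABC, hl', hD, hDnn⟩ :=
    exists_rescale (by rw [hM, hcard, hm]) hl hpos
  let τ : F →ᵃ[ℝ] (A ⊕ B ⊕ C → ℝ) := D.toLinearMap.toAffineMap.comp σ
  have hτ : ∀ x, τ x = D (σ x) := fun x => rfl
  have hτinj : Set.InjOn τ (affineSpan ℝ Q) := fun x hx y hy hxy =>
    hinj hx hy (D.injective hxy)
  have hτhull : ∀ x ∈ affineSpan ℝ Q, τ x ∈ modelHull l' := fun x hx =>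
    (hD _).1 (hσ x hx)
  have hτsurj : ∀ s ∈ modelHull l', ∃ x ∈ affineSpan ℝ Q, τ x = s := by
    intro s hs
    obtain ⟨s, rfl⟩ := D.surjective s
    obtain ⟨h1, h2⟩ := (hD s).2 hs
    obtain ⟨x, hx, rfl⟩ := hsurj s h1 h2
    exact ⟨x, hx, rfl⟩
  obtain ⟨ρ, hρ⟩ := exists_affine_factor τ π hτinj
  have hsub := subset_affineSpan ℝ Q
  have hne : Q.Nonempty := by
    by_contra h
    rw [Set.not_nonempty_iff_eq_empty] at h
    rw [h, dim, vectorSpan_empty, finrank_bot] at hd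
    omega
  obtain ⟨x0, hx0⟩ := hne
  have hx0 := hsub hx0
  -- the kernel of the projection is a line
  let p := π.linear.domRestrict (vectorSpan ℝ Q)
  have hker : Module.finrank ℝ (LinearMap.ker p) = 1 := by
    have h1 := LinearMap.finrank_range_add_finrank_ker p
    rw [LinearMap.range_domRestrict, AffineMap.map_vectorSpan] at h1
    have h2 : Module.finrank ℝ (vectorSpan ℝ (π '' Q)) = dim (π '' Q) := rfl
    have h3 : Module.finrank ℝ (vectorSpan ℝ Q) = dim Q := rfl
    omega
  obtain ⟨⟨⟨w, hw⟩, hwker⟩, hw0, hwspan⟩ := finrank_eq_one_iff'.1 hker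
  have hwπ : π.linear w = 0 := hwker
  have hw0 : w ≠ 0 := fun h => hw0 (by ext; exact h)
  have hstep : ∀ x ∈ affineSpan ℝ Q, τ (x + w) = τ x + τ.linear w := fun x _ => by
    have := map_add_smul τ x w 1
    rwa [one_smul, one_smul] at this
  have hπstep : π (x0 + w) = π x0 := by
    have := map_add_smul π x0 w 1
    rwa [one_smul, one_smul, hwπ, add_zero] at this
  have hx0w := add_mem_affineSpan hx0 hw
  refine ⟨A, B, C, _, _, _, l', ρ, τ.linear w, hA, hB, hAB, hABC.trans hcard, hl', ?_, ?_, ?_, ?_,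
    ?_, ?_⟩
  · ext y
    constructor
    · rintro ⟨x, hx, rfl⟩
      exact ⟨τ x, ⟨hτhull x (hsub hx), (hDnn _).1 ((hQσ x (hsub hx)).1 hx)⟩, hρ x (hsub hx)⟩
    · rintro ⟨s, ⟨hs, hs0⟩, rfl⟩
      obtain ⟨x, hx, rfl⟩ := hτsurj s hs
      exact ⟨x, (hQσ x hx).2 ((hDnn _).2 hs0), (hρ x hx).symm⟩
  · intro h
    have := hτinj hx0w hx0 (by rw [hstep x0 hx0, h, add_zero])
    exact hw0 (by simpa using this)
  · have h1 := (hτhull _ hx0w).2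
    rw [hstep x0 hx0] at h1
    simp only [Pi.add_apply, mul_add, Finset.sum_add_distrib] at h1
    have h2 := (hτhull _ hx0).2
    linarith
  · have h1 := hρ _ hx0w
    rw [hstep x0 hx0, hπstep, ← hρ _ hx0] at h1
    have h2 := map_add_smul ρ (τ x0) (τ.linear w) 1
    rw [one_smul, h1, one_smul] at h2
    simpa using h2
  · intro s hs
    obtain ⟨x, hx, rfl⟩ := hτsurj s hs
    rw [← hstep x hx]
    exact hτhull _ (add_mem_affineSpan hx hw)
  · intro s hs s' hs' hss
    obtain ⟨x, hx, rfl⟩ := hτsurj s hs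
    obtain ⟨x', hx', rfl⟩ := hτsurj s' hs'
    rw [hρ x hx, hρ x' hx'] at hss
    have hv := (mem_affineSpan_iff hx).1 hx'
    have hk : (⟨x' - x, hv⟩ : vectorSpan ℝ Q) ∈ LinearMap.ker p := by
      change π.linear (x' - x) = 0
      rw [linear_sub_eq, hss, sub_self]
    obtain ⟨t, ht⟩ := hwspan ⟨_, hk⟩
    have ht' : t • w = x' - x := congrArg (fun z : LinearMap.ker p => ((z : vectorSpan ℝ Q) : F)) ht
    refine ⟨t, ?_⟩
    rw [← map_add_smul, ht', add_sub_cancel]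

end

/-! ### Projections of the model and lower bounds on the extension complexity -/

lemma off_cases {A B C : Type*} {σ : A × B ⊕ C} {x y : A ⊕ B ⊕ C} (hx : Off x σ) (hy : Off y σ)
    (hxy : x ≠ y) :
    ∃ i j, σ = .inl (i, j) ∧ (x = .inl i ∧ y = .inr (.inl j) ∨ x = .inr (.inl j) ∧ y = .inl i) := by
  rcases σ with ⟨i, j⟩ | c
  · refine ⟨i, j, rfl, ?_⟩
    rcases x with x | x | x <;> rcases y with y | y | y <;> simp_all
  · rcases x with x | x | x <;> rcases y with y | y | y <;> simp_all

section

variable {E : Type*} [NormedAddCommGroup E] [NormedSpace ℝ E]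
variable {A B C : Type*} [Fintype A] [Fintype B] [Fintype C]

lemma affineSpan_model_subset (l : A ⊕ B ⊕ C → ℝ) {s : A ⊕ B ⊕ C → ℝ}
    (hs : s ∈ affineSpan ℝ (model l)) : s ∈ modelHull l := by
  have happ : ∀ (g : A ⊕ B ⊕ C → ℝ) s, (∑ x, g x • (coordFun x)) s = ∑ x, g x * s x := fun g s => by
    rw [sum_smul_affine_apply]; rfl
  constructor
  · have h1 : ∀ s : A ⊕ B ⊕ C → ℝ, ∑ x, (Sum.elim (fun _ => 1) (Sum.elim (fun _ => -1)
        fun _ => 0) : A ⊕ B ⊕ C → ℝ) x * s x = ∑ i, s (.inl i) - ∑ j, s (.inr (.inl j)) := by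
      intro s; simp [Fintype.sum_sum_type, sub_eq_add_neg]
    have h2 := eq_on_affineSpan (S := model l) (∑ x, (Sum.elim (fun _ => 1) (Sum.elim (fun _ => -1)
        fun _ => 0) : A ⊕ B ⊕ C → ℝ) x • (coordFun x)) (AffineMap.const ℝ _ 0)
      (fun s hs => by rw [happ, h1, hs.1.1, sub_self]; rfl) hs
    rw [happ, h1] at h2
    exact sub_eq_zero.1 h2
  · have h2 := eq_on_affineSpan (S := model l) (∑ x, l x • (coordFun x)) (AffineMap.const ℝ _ 1)
      (fun s hs => by rw [happ, hs.1.2]; rfl) hs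
    rw [happ] at h2
    exact h2

/-- Fourier–Motzkin elimination: the facets of a projection of a model along `v` come from the
coordinates vanishing on `v` and from pairs of coordinates of opposite sign on `v`. -/
lemma numFacets_image_model_le [FiniteDimensional ℝ E] {l : A ⊕ B ⊕ C → ℝ}
    {ρ : (A ⊕ B ⊕ C → ℝ) →ᵃ[ℝ] E} {v : A ⊕ B ⊕ C → ℝ} (hv : ρ.linear v = 0)
    (hadd : ∀ s ∈ modelHull l, ∀ t : ℝ, s + t • v ∈ modelHull l)
    (hker : ∀ s ∈ modelHull l, ∀ s' ∈ modelHull l, ρ s = ρ s' → ∃ t : ℝ, s' = s + t • v)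
    (hpos : ∃ x, 0 < v x) :
    numFacets (ρ '' model l) ≤
      Fintype.card {x // v x < 0} * Fintype.card {x // 0 < v x} + Fintype.card {x // v x = 0} := by
  classical
  let a : ({x // v x < 0} × {x // 0 < v x}) ⊕ {x // v x = 0} → (A ⊕ B ⊕ C → ℝ) →ᵃ[ℝ] ℝ :=
    Sum.elim (fun p => v p.2.1 • coordFun p.1.1 - v p.1.1 • coordFun p.2.1) (fun x => coordFun x.1)
  have ha1 : ∀ (p : {x // v x < 0} × {x // 0 < v x}) s,
      a (.inl p) s = v p.2.1 * s p.1.1 - v p.1.1 * s p.2.1 := fun p s => by simp [a]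
  have ha2 : ∀ (x : {x // v x = 0}) s, a (.inr x) s = s x.1 := fun x s => rfl
  have hav : ∀ i s (t : ℝ), a i (s + t • v) = a i s := by
    rintro (p | x) s t
    · rw [ha1, ha1]; simp only [Pi.add_apply, Pi.smul_apply, smul_eq_mul]; ring
    · rw [ha2, ha2]; simp [x.2]
  rcases (model l).eq_empty_or_nonempty with h0 | ⟨s0, hs0⟩
  · have : facets (ρ '' model l) = ∅ := by
      ext G
      simp only [Set.mem_empty_iff_false, iff_false]
      rintro ⟨h1, ⟨g, hg⟩, -⟩
      have := h1.subset hg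
      simp [h0] at this
    rw [numFacets, this]; simp
  have hb : ∀ i, ∃ b : E →ᵃ[ℝ] ℝ, ∀ s ∈ affineSpan ℝ (model l), b (ρ s) = a i s := by
    intro i
    refine exists_affine_descend ρ (model l) (a i) fun w hw hw0 => ?_
    have hs0' := subset_affineSpan ℝ _ hs0
    have h1 := affineSpan_model_subset l (add_mem_affineSpan hs0' hw)
    have h2 := map_add_smul ρ s0 w 1
    rw [hw0, smul_zero, add_zero, one_smul] at h2
    obtain ⟨t, ht⟩ := hker s0 hs0.1 _ h1 h2.symm
    have h3 := map_add_smul (a i) s0 w 1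
    rw [one_smul, ht, hav, one_smul] at h3
    linarith
  choose b hb using hb
  have hsub := subset_affineSpan ℝ (model l)
  refine (numFacets_le_of_halfspaces b (convex_model.affine_image ρ) ?_ ?_).trans
    (by rw [Fintype.card_sum, Fintype.card_prod])
  · rintro i _ ⟨s, hs, rfl⟩
    rw [hb i s (hsub hs)]
    rcases i with p | x
    · rw [ha1]
      have h1 := mul_nonneg p.2.2.le (hs.2 p.1.1)
      have h2 := mul_nonneg (neg_nonneg.2 p.1.2.le) (hs.2 p.2.1)
      linarith
    · exact hs.2 x.1
  · intro y hy h
    rw [← AffineSubspace.map_span] at hy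
    obtain ⟨s, hs, rfl⟩ := hy
    simp only [hb _ s hs] at h
    have hsH := affineSpan_model_subset l hs
    -- the largest lower bound on `t` for `s + t • v` to be nonnegative
    obtain ⟨x0, hx0, hmax⟩ := Finset.exists_max_image (Finset.univ.filter fun x => 0 < v x)
      (fun x => - s x / v x) (by obtain ⟨x, hx⟩ := hpos; exact ⟨x, by simp [hx]⟩)
    have hx0 : 0 < v x0 := by simpa using hx0
    refine ⟨s + (- s x0 / v x0) • v, ⟨hadd s hsH _, fun x => ?_⟩, ?_⟩
    · simp only [Pi.add_apply, Pi.smul_apply, smul_eq_mul]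
      rcases lt_trichotomy (v x) 0 with hx | hx | hx
      · have := h (.inl (⟨x, hx⟩, ⟨x0, hx0⟩))
        rw [ha1] at this
        have h2 : s x + - s x0 / v x0 * v x = (v x0 * s x - v x * s x0) / v x0 := by
          field_simp; ring
        rw [h2]; exact div_nonneg this hx0.le
      · have := h (.inr ⟨x, hx⟩)
        rw [ha2] at this
        rw [hx]; simpa using this
      · have := hmax x (by simp [hx])
        rw [div_le_iff₀ hx] at this
        linarith
    · rw [map_add_smul, hv, smul_zero, add_zero]

/-- A vertex of the model at which the fibre direction `v` leaves the orthant both ways is alone in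
its fibre, and projects to a vertex. -/
lemma modelVertex_extreme {l : A ⊕ B ⊕ C → ℝ} (hl : ∀ x, 0 < l x)
    {ρ : (A ⊕ B ⊕ C → ℝ) →ᵃ[ℝ] E} {v : A ⊕ B ⊕ C → ℝ}
    (hker : ∀ s ∈ modelHull l, ∀ s' ∈ modelHull l, ρ s = ρ s' → ∃ t : ℝ, s' = s + t • v)
    {σ : A × B ⊕ C} (hneg : ∃ x, v x < 0 ∧ ¬ Off x σ) (hpos : ∃ x, 0 < v x ∧ ¬ Off x σ) :
    (∀ s ∈ model l, ρ s = ρ (modelVertex l σ) → s = modelVertex l σ) ∧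
      ρ (modelVertex l σ) ∈ (ρ '' model l).extremePoints ℝ := by
  have hmem := modelVertex_mem hl σ
  have hfib : ∀ s ∈ model l, ρ s = ρ (modelVertex l σ) → s = modelVertex l σ := by
    intro s hs hρ
    obtain ⟨t, ht⟩ := hker _ hmem.1 _ hs.1 hρ.symm
    obtain ⟨x, hx, hxσ⟩ := hneg
    obtain ⟨y, hy, hyσ⟩ := hpos
    have h1 := hs.2 x
    have h2 := hs.2 y
    rw [ht] at h1 h2
    simp only [Pi.add_apply, Pi.smul_apply, smul_eq_mul, modelVertex_of_not_off hxσ,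
      modelVertex_of_not_off hyσ, zero_add] at h1 h2
    have h3 : t = 0 := le_antisymm (by nlinarith) (by nlinarith)
    rw [ht, h3, zero_smul, add_zero]
  refine ⟨hfib, mem_extremePoints_iff_left.2 ⟨⟨_, hmem, rfl⟩, ?_⟩⟩
  rintro _ ⟨s, hs, rfl⟩ _ ⟨s', hs', rfl⟩ ⟨a, b, ha, hb, hab, heq⟩
  have h1 : a • s + b • s' = modelVertex l σ := by
    refine hfib _ (convex_model hs hs' ha.le hb.le hab) ?_
    rw [← heq]
    exact Convex.combo_affine_apply hab
  congr 1
  refine eq_modelVertex hs.1 fun x hx => ?_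
  have h2 := congrFun h1 x
  rw [modelVertex_of_not_off hx] at h2
  simp only [Pi.add_apply, Pi.smul_apply, smul_eq_mul] at h2
  have h3 := mul_nonneg ha.le (hs.2 x)
  have h4 := mul_nonneg hb.le (hs'.2 x)
  have h5 : a * s x = 0 := by linarith
  exact (mul_eq_zero.1 h5).resolve_left ha.ne'

/-- Classification of the projections with `d + 4` vertices of a model of dimension `d + 1`.

Let `n` and `p` be the numbers of facet coordinates that are negative and positive on the fibre
direction `v`. If `n = 1`, `p = 1` or `n = p = 2`, Fourier–Motzkin elimination leaves at most
`d + 3` facets. Otherwise at most one vertex of the model is lost in the projection, so the model has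
`d + 4` or `d + 5` vertices, and counting vertices and facets leaves a pyramid over `Δ₁ × Δ₂`, or one
over `Δ₁ × Δ₃` with a lost vertex. In the latter case deleting the lost vertex leaves a pyramid over
`Δ₁ × Δ₂` again. -/
lemma numFacets_le_or_isProj [FiniteDimensional ℝ E] {d : ℕ} {l : A ⊕ B ⊕ C → ℝ}
    (hl : ∀ x, 0 < l x) [Nonempty A] [Nonempty B] (hAB : Fintype.card A ≤ Fintype.card B)
    (hcard : Fintype.card A + Fintype.card B + Fintype.card C = d + 3)
    {ρ : (A ⊕ B ⊕ C → ℝ) →ᵃ[ℝ] E} {v : A ⊕ B ⊕ C → ℝ} (hv0 : v ≠ 0) (hlv : ∑ x, l x * v x = 0)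
    (hv : ρ.linear v = 0) (hadd : ∀ s ∈ modelHull l, s + v ∈ modelHull l)
    (hker : ∀ s ∈ modelHull l, ∀ s' ∈ modelHull l, ρ s = ρ s' → ∃ t : ℝ, s' = s + t • v)
    (hvert : ((ρ '' model l).extremePoints ℝ).ncard = d + 4) :
    numFacets (ρ '' model l) ≤ d + 3 ∨ IsProjOfPyrPrism d (ρ '' model l) := by
  classical
  have hadd' : ∀ s ∈ modelHull l, ∀ t : ℝ, s + t • v ∈ modelHull l := by
    rintro s hs t
    obtain ⟨h1, h2⟩ := hadd s hs
    simp only [Pi.add_apply, Finset.sum_add_distrib, hs.1] at h1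
    refine ⟨?_, ?_⟩
    · simp only [Pi.add_apply, Pi.smul_apply, smul_eq_mul, Finset.sum_add_distrib,
        ← Finset.mul_sum, hs.1, add_left_cancel h1]
    · simp only [Pi.add_apply, Pi.smul_apply, smul_eq_mul, mul_add, Finset.sum_add_distrib, hs.2]
      have : ∑ x, l x * (t * v x) = t * ∑ x, l x * v x := by
        rw [Finset.mul_sum]; exact Finset.sum_congr rfl fun x _ => by ring
      rw [this, hlv, mul_zero, add_zero]
  have hneg : ∃ x, v x < 0 := by
    by_contra hc
    push Not at hc
    refine hv0 (funext fun x => ?_)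
    have := (Finset.sum_eq_zero_iff_of_nonneg fun x _ => mul_nonneg (hl x).le (hc x)).1 hlv x
      (Finset.mem_univ x)
    exact (mul_eq_zero.1 this).resolve_left (hl x).ne'
  have hpos : ∃ x, 0 < v x := by
    by_contra hc
    push Not at hc
    refine hv0 (funext fun x => ?_)
    have := (Finset.sum_eq_zero_iff_of_nonpos
      fun x _ => mul_nonpos_of_nonneg_of_nonpos (hl x).le (hc x)).1 hlv x (Finset.mem_univ x)
    exact (mul_eq_zero.1 this).resolve_left (hl x).ne'
  have hfm := numFacets_image_model_le hv hadd' hker hpos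
  have hsum : Fintype.card {x // v x < 0} + Fintype.card {x // 0 < v x} +
      Fintype.card {x // v x = 0} = d + 3 := by
    rw [← hcard, Fintype.card_subtype, Fintype.card_subtype, Fintype.card_subtype, add_assoc,
      ← Finset.card_union_of_disjoint, ← Finset.card_union_of_disjoint]
    · have : (Finset.univ.filter fun x => v x < 0) ∪ ((Finset.univ.filter fun x => 0 < v x) ∪
          Finset.univ.filter fun x => v x = 0) = Finset.univ := by
        ext x
        simp only [Finset.mem_union, Finset.mem_filter, Finset.mem_univ, true_and, iff_true]
        rcases lt_trichotomy (v x) 0 with h | h | h <;> simp [h]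
      rw [this, Finset.card_univ, Fintype.card_sum, Fintype.card_sum, add_assoc]
    · rw [Finset.disjoint_left]
      intro x; simp only [Finset.mem_union, Finset.mem_filter, Finset.mem_univ, true_and]
      intro h h2; rcases h2 with h2 | h2 <;> linarith
    · rw [Finset.disjoint_left]
      intro x; simp only [Finset.mem_filter, Finset.mem_univ, true_and]
      intro h h2; linarith
  have hN0 : 0 < Fintype.card {x // v x < 0} :=
    Fintype.card_pos_iff.2 (by obtain ⟨x, hx⟩ := hneg; exact ⟨⟨x, hx⟩⟩)
  have hP0 : 0 < Fintype.card {x // 0 < v x} :=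
    Fintype.card_pos_iff.2 (by obtain ⟨x, hx⟩ := hpos; exact ⟨⟨x, hx⟩⟩)
  set n := Fintype.card {x // v x < 0}
  set p := Fintype.card {x // 0 < v x}
  by_cases hsmall : n = 1 ∨ p = 1 ∨ (n = 2 ∧ p = 2)
  · left
    refine hfm.trans ?_
    rcases hsmall with h | h | ⟨h, h'⟩
    · rw [h]; omega
    · rw [h]; omega
    · rw [h, h']; omega
  right
  push Not at hsmall
  obtain ⟨hn1, hp1, hnp⟩ := hsmall
  -- at most one vertex of the model fails to survive the projection
  let Surv : A × B ⊕ C → Prop := fun σ => (∃ x, v x < 0 ∧ ¬ Off x σ) ∧ ∃ x, 0 < v x ∧ ¬ Off x σ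
  have h2 : ∀ {q : A ⊕ B ⊕ C → Prop}, 2 ≤ Fintype.card {x // q x} → ∀ σ, (∀ x, q x → Off x σ) →
      Fintype.card {x // q x} = 2 ∧ (∃ i j, σ = .inl (i, j)) ∧
        ∀ τ, (∀ x, q x → Off x τ) → τ = σ := by
    intro q hq σ hσ
    obtain ⟨⟨x, hx⟩, ⟨y, hy⟩, hxy⟩ := Fintype.exists_pair_of_one_lt_card hq
    have hxy' : x ≠ y := fun h => hxy (Subtype.ext h)
    obtain ⟨i, j, rfl, hij⟩ := off_cases (hσ x hx) (hσ y hy) hxy'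
    refine ⟨le_antisymm ?_ hq, ⟨i, j, rfl⟩, fun τ hτ => ?_⟩
    · rw [Fintype.card_subtype]
      refine (Finset.card_le_card (t := {.inl i, .inr (.inl j)}) fun z hz => ?_).trans
        Finset.card_le_two
      have hz := hσ z (by simpa using hz)
      rcases z with z | z | z <;> simp_all
    · obtain ⟨i', j', rfl, hij'⟩ := off_cases (hτ x hx) (hτ y hy) hxy'
      rcases hij with ⟨rfl, rfl⟩ | ⟨rfl, rfl⟩ <;> simp_all
  have hns : ∀ σ, ¬ Surv σ → (∃ i j, σ = .inl (i, j)) ∧ ∀ τ, ¬ Surv τ → τ = σ := by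
    have hor : ∀ σ, ¬ Surv σ → (∀ x, v x < 0 → Off x σ) ∨ ∀ x, 0 < v x → Off x σ := by
      intro σ hσ
      by_contra hc
      push Not at hc
      exact hσ hc
    intro σ hσ
    rcases hor σ hσ with h | h
    · obtain ⟨e1, e2, e3⟩ := h2 (q := fun x => v x < 0) (by omega) σ h
      refine ⟨e2, fun τ hτ => ?_⟩
      rcases hor τ hτ with h' | h'
      · exact e3 τ h'
      · exact absurd (h2 (q := fun x => 0 < v x) (by omega) τ h').1 (hnp e1)
    · obtain ⟨e1, e2, e3⟩ := h2 (q := fun x => 0 < v x) (by omega) σ h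
      refine ⟨e2, fun τ hτ => ?_⟩
      rcases hor τ hτ with h' | h'
      · exact absurd e1 (hnp (h2 (q := fun x => v x < 0) (by omega) τ h').1)
      · exact e3 τ h'
  have hmodel := model_eq_convexHull hl
  have hP : ρ '' model l = convexHull ℝ (Set.range (ρ ∘ modelVertex l)) := by
    rw [hmodel, AffineMap.image_convexHull, Set.range_comp]
  have hpoly : IsPolytope (ρ '' model l) := by rw [hP]; exact isPolytope_range _
  have hext : (ρ '' model l).extremePoints ℝ ⊆ Set.range (ρ ∘ modelVertex l) := by
    rw [hP]; exact extremePoints_convexHull_subset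
  have hupper : d + 4 ≤ Fintype.card (A × B ⊕ C) := by
    rw [← hvert, hP]; exact ncard_extremePoints_le _
  have hwinj : ∀ σ τ, modelVertex l σ = modelVertex l τ → σ = τ := by
    intro σ τ h
    have hoff : ∀ x, Off x σ ↔ Off x τ := fun x => by
      rw [← not_iff_not, ← modelVertex_eq_zero_iff hl, ← modelVertex_eq_zero_iff hl, h]
    rcases σ with ⟨i, j⟩ | c <;> rcases τ with ⟨i', j'⟩ | c'
    · have h1 : i = i' := (hoff (.inl i)).1 rfl
      have h2 : j = j' := (hoff (.inr (.inl j))).1 rfl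
      rw [h1, h2]
    · exact ((hoff (.inl i)).1 rfl).elim
    · exact ((hoff (.inl i')).2 rfl).elim
    · have h1 : c = c' := (hoff (.inr (.inr c))).1 rfl
      rw [h1]
  -- the images of the surviving vertices
  let S : Set E := (ρ ∘ modelVertex l) '' {σ | Surv σ}
  have hSext : S ⊆ (ρ '' model l).extremePoints ℝ := by
    rintro _ ⟨σ, hσ, rfl⟩
    exact (modelVertex_extreme hl hker hσ.1 hσ.2).2
  have hScard : S.ncard = Fintype.card {σ // Surv σ} := by
    rw [Set.InjOn.ncard_image, ← Nat.card_coe_set_eq, Nat.card_eq_fintype_card]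
    · rfl
    · intro σ hσ τ hτ h
      exact hwinj _ _ ((modelVertex_extreme hl hker hτ.1 hτ.2).1 _ (modelVertex_mem hl σ) h)
  have hSle : Fintype.card {σ // Surv σ} ≤ d + 4 := by
    rw [← hScard, ← hvert]; exact Set.ncard_le_ncard hSext hpoly.finite_extremePoints
  have hcompl := Fintype.card_subtype_compl Surv
  have hns1 : Fintype.card {σ // ¬ Surv σ} ≤ 1 := by
    rw [Fintype.card_le_one_iff]
    rintro ⟨σ, hσ⟩ ⟨τ, hτ⟩
    exact Subtype.ext ((hns τ hτ).2 σ hσ)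
  have hle := Fintype.card_subtype_le Surv
  have hcardσ : Fintype.card (A × B ⊕ C) = Fintype.card A * Fintype.card B + Fintype.card C := by
    rw [Fintype.card_sum, Fintype.card_prod]
  have hA1 : 0 < Fintype.card A := Fintype.card_pos
  by_cases hfull : Fintype.card (A × B ⊕ C) = d + 4
  · -- every vertex of the model projects to a vertex
    -- that is, `(|A| - 1) * (|B| - 1) = 2`
    have hAB' : Fintype.card A = 2 ∧ Fintype.card B = 3 := by
      have heq : Fintype.card A * Fintype.card B + 0 = Fintype.card A + Fintype.card B + 1 := by omega
      have hA3 : Fintype.card A ≤ 2 := by nlinarith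
      interval_cases hA : Fintype.card A
      · omega
      · omega
    rw [hmodel]
    exact isProjOfPyrPrism_of_isPyrProd hAB'.1 hAB'.2 (by omega) (isPyrProd_model hl) ρ
  · have hone : Fintype.card {σ // ¬ Surv σ} = 1 := by omega
    have heq : Fintype.card A * Fintype.card B = Fintype.card A + Fintype.card B + 2 := by omega
    -- that is, `(|A| - 1) * (|B| - 1) = 3`
    have hAB' : Fintype.card A = 2 ∧ Fintype.card B = 4 := by
      have hA3 : Fintype.card A ≤ 2 := by
        by_contra hc
        push Not at hc
        have : Fintype.card A ≤ 3 := by nlinarith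
        have hA : Fintype.card A = 3 := by omega
        rw [hA] at heq; omega
      interval_cases hA : Fintype.card A
      · omega
      · omega
    obtain ⟨⟨σ0, hσ0⟩, -⟩ := Fintype.card_eq_one_iff.1 hone
    obtain ⟨⟨i₀, j₀, rfl⟩, huniq⟩ := hns σ0 hσ0
    obtain ⟨i₁, hi₁⟩ : ∃ i₁, i₁ ≠ i₀ := by
      have := Fintype.one_lt_card_iff_nontrivial.1 (by omega : 1 < Fintype.card A)
      exact exists_ne i₀
    have hA2 : ∀ i, i ≠ i₀ → i = i₁ := by
      intro i hi
      by_contra hc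
      have := Finset.card_le_univ ({i, i₀, i₁} : Finset A)
      rw [Finset.card_insert_of_notMem (by simp [hi, hc]),
        Finset.card_pair hi₁.symm] at this
      omega
    have hSeq : S = (ρ '' model l).extremePoints ℝ :=
      Set.eq_of_subset_of_ncard_le hSext (by rw [hScard, hvert]; omega) hpoly.finite_extremePoints
    obtain ⟨a, ha⟩ := isPyrProd_model_delete (C := C) hl i₁ j₀
    have hPeq : ρ '' model l = ρ '' convexHull ℝ (Set.range
        (Sum.elim (fun p : A × {j : B // j ≠ j₀} => modelVertex l (.inl (p.1, p.2.1)))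
        (fun o : Option C => o.elim (modelVertex l (.inl (i₁, j₀)))
          fun c => modelVertex l (.inr c)))) := by
      apply Set.Subset.antisymm
      · conv_lhs => rw [hpoly.eq_convexHull, ← hSeq]
        rw [AffineMap.image_convexHull]
        refine convexHull_mono ?_
        rintro _ ⟨σ, hσ, rfl⟩
        refine ⟨modelVertex l σ, ?_, rfl⟩
        rcases σ with ⟨i, j⟩ | c
        · by_cases hj : j = j₀
          · subst hj
            have hi : i ≠ i₀ := by rintro rfl; exact hσ0 hσ
            exact ⟨.inr none, by rw [hA2 i hi]; rfl⟩
          · exact ⟨.inl (i, ⟨j, hj⟩), rfl⟩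
        · exact ⟨.inr (some c), rfl⟩
      · refine Set.image_mono ?_
        rw [hmodel]
        refine convexHull_mono ?_
        rintro _ ⟨⟨i, j⟩ | _ | c, rfl⟩ <;> exact ⟨_, rfl⟩
    rw [hPeq]
    refine isProjOfPyrPrism_of_isPyrProd hAB'.1 ?_ ?_ ha ρ
    · rw [Fintype.card_subtype_compl, hAB'.2]; simp
    · rw [Fintype.card_option]; omega

end

section

variable {E : Type*} [NormedAddCommGroup E] [NormedSpace ℝ E]
variable {F : Type*} [NormedAddCommGroup F] [NormedSpace ℝ F] [FiniteDimensional ℝ F]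

lemma one_le_dim_of_ncard [FiniteDimensional ℝ E] {P : Set E}
    (h : 1 < (P.extremePoints ℝ).ncard) : 1 ≤ dim P := by
  by_contra hc
  have h0 : dim P = 0 := by omega
  have hbot : vectorSpan ℝ P = ⊥ := Submodule.finrank_eq_zero.1 h0
  have : (P.extremePoints ℝ).ncard ≤ 1 := by
    have hs : (P.extremePoints ℝ).Subsingleton := fun x hx y hy => by
      have := vsub_mem_vectorSpan ℝ (extremePoints_subset hx) (extremePoints_subset hy)
      rw [hbot, Submodule.mem_bot, vsub_eq_sub] at this
      exact sub_eq_zero.1 this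
    rcases hs.eq_empty_or_singleton with h | ⟨x, h⟩ <;> simp [h]
  omega

/-- A polytope of dimension `n` has at least `n + 1` facets, and with exactly `n + 1` facets it is a
simplex: its projections have at most `n + 1` vertices. -/
lemma dim_add_one_le_numFacets {Q : Set F} (hQ : IsPolytope Q) (hd : 1 ≤ dim Q) :
    dim Q + 1 ≤ numFacets Q ∧ (numFacets Q = dim Q + 1 → ∀ π : F →ᵃ[ℝ] E,
      ((π '' Q).extremePoints ℝ).ncard ≤ numFacets Q) := by
  classical
  have := hQ.facets_finite.fintype
  have hcard : Fintype.card (facets Q) = numFacets Q := by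
    rw [numFacets, ← Nat.card_coe_set_eq, Nat.card_eq_fintype_card]
  obtain ⟨σ, M, l, hM, hl, hinj, hσ, hsurj, hQσ, hpos⟩ := exists_slack_model hQ hd
  have hle := M.finrank_le
  rw [Module.finrank_fintype_fun_eq_card, hM, hcard] at hle
  refine ⟨hle, fun heq π => ?_⟩
  have hMtop : M = ⊤ := Submodule.eq_top_of_finrank_eq (by
    rw [Module.finrank_fintype_fun_eq_card, hM, hcard, heq])
  obtain ⟨ρ, hρ⟩ := exists_affine_factor σ π hinj
  have hsub := subset_affineSpan ℝ Q
  have himg : π '' Q = ρ '' {s : facets Q → ℝ | (∀ i, 0 ≤ s i) ∧ ∑ i, l i * s i = 1} := by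
    ext y
    constructor
    · rintro ⟨x, hx, rfl⟩
      exact ⟨σ x, ⟨(hQσ x (hsub hx)).1 hx, (hσ x (hsub hx)).2⟩, hρ x (hsub hx)⟩
    · rintro ⟨s, ⟨hs0, hs1⟩, rfl⟩
      obtain ⟨x, hx, rfl⟩ := hsurj s (hMtop ▸ Submodule.mem_top) hs1
      exact ⟨x, (hQσ x hx).2 hs0, (hρ x hx).symm⟩
  rw [himg, weighted_simplex_eq hl, AffineMap.image_convexHull, ← Set.range_comp, ← hcard]
  exact ncard_extremePoints_le _

/-- Lower bounds on the extension complexity of a `d`-polytope with `d + 4` vertices: an extension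
with fewer than `d + 4` facets is no simplex, so it has at least two more facets than its dimension.
With at most `d + 3` facets it has dimension `d`, and is affinely isomorphic to the polytope, or it
has dimension `d + 1` and exactly `d + 3` facets, and is a model. -/
theorem xc_lower [FiniteDimensional ℝ E] {d : ℕ} {P : Set E} (hP : IsPolytope P) (hdim : dim P = d)
    (hvert : (P.extremePoints ℝ).ncard = d + 4) :
    d + 2 ≤ xc P ∧ (xc P = d + 2 → numFacets P ≤ d + 2) ∧
      (xc P = d + 3 → numFacets P ≤ d + 3 ∨ IsProjOfPyrPrism d P) := by
  obtain ⟨N, Q, π, hQ, rfl, hm⟩ := exists_of_xc hP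
  have hd1 : 1 ≤ dim (π '' Q) := one_le_dim_of_ncard (by omega)
  have hdle := dim_image_le π Q
  obtain ⟨hlow, hsimp⟩ := dim_add_one_le_numFacets (E := E) hQ (hd1.trans hdle)
  have hsimp' : numFacets Q = dim Q + 1 → d + 4 ≤ numFacets Q := fun h => by
    rw [← hvert]; exact hsimp h π
  have hsame : dim Q = d → numFacets (π '' Q) ≤ numFacets Q := fun h =>
    numFacets_image_le hQ π (injOn_of_dim_eq π (by rw [hdim, h]))
  rw [← hm]
  refine ⟨?_, fun h => ?_, fun h => ?_⟩
  · by_contra hc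
    have : numFacets Q = dim Q + 1 := by omega
    have := hsimp' this
    omega
  · have : dim Q = d := by
      by_contra hc
      have := hsimp' (by omega)
      omega
    rw [← h]; exact hsame this
  · by_cases hdQ : dim Q = d
    · left; rw [← h]; exact hsame hdQ
    · have hdQ' : dim Q = d + 1 := by
        by_contra hc
        have := hsimp' (by omega)
        omega
      obtain ⟨A, B, C, _, _, _, l, ρ, v, _, _, hAB, hABC, hl, himg, hv0, hlv, hv, hadd, hker⟩ :=
        exists_model hQ (hd1.trans hdle) (by omega) π (by omega)
      rw [himg] at hvert ⊢
      exact numFacets_le_or_isProj hl hAB (by omega) hv0 hlv hv hadd hker hvert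

end

/-! ### Determinants of vectors in convex position -/

section

/-- The determinant of three vectors of `ℝ³`, as a linear form in the third one. -/
def det3 (x y : Fin 3 → ℝ) : (Fin 3 → ℝ) →ₗ[ℝ] ℝ where
  toFun z := x 0 * (y 1 * z 2 - y 2 * z 1) - x 1 * (y 0 * z 2 - y 2 * z 0) +
    x 2 * (y 0 * z 1 - y 1 * z 0)
  map_add' z z' := by simp only [Pi.add_apply]; ring
  map_smul' t z := by simp only [Pi.smul_apply, smul_eq_mul, RingHom.id_apply]; ring

lemma det3_apply (x y z : Fin 3 → ℝ) : det3 x y z = x 0 * (y 1 * z 2 - y 2 * z 1) -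
    x 1 * (y 0 * z 2 - y 2 * z 0) + x 2 * (y 0 * z 1 - y 1 * z 0) := rfl

/-- Cramer's rule. -/
lemma det3_cramer (x a b c : Fin 3 → ℝ) :
    det3 a b c • x = det3 x b c • a - det3 x a c • b + det3 x a b • c := by
  ext i
  simp only [det3_apply, Pi.add_apply, Pi.sub_apply, Pi.smul_apply, smul_eq_mul]
  fin_cases i <;> simp <;> ring

lemma det3_swap (x a b : Fin 3 → ℝ) : det3 x b a = - det3 x a b := by
  simp only [det3_apply]; ring

lemma exists_dependent_of_det3_eq_zero {x y z : Fin 3 → ℝ} (h : det3 x y z = 0) :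
    ∃ a b c : ℝ, (a ≠ 0 ∨ b ≠ 0 ∨ c ≠ 0) ∧ a • x + b • y + c • z = 0 := by
  have hdet : (Matrix.of ![x, y, z]).det = 0 := by
    rw [Matrix.det_fin_three, ← h, det3_apply]
    simp
    ring
  obtain ⟨v, hv, hv0⟩ := Matrix.exists_vecMul_eq_zero_iff.2 hdet
  refine ⟨v 0, v 1, v 2, ?_, ?_⟩
  · by_contra hc
    push Not at hc
    refine hv (funext fun i => ?_)
    fin_cases i
    exacts [hc.1, hc.2.1, hc.2.2]
  · rw [← hv0]
    ext i
    simp [Matrix.vecMul, dotProduct, Fin.sum_univ_three]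

/-- No vector of the family `W` is a nonnegative combination of three others. -/
def ConeFree {ι : Type*} (W : ι → Fin 3 → ℝ) : Prop :=
  ∀ σ σ₁ σ₂ σ₃, σ₁ ≠ σ → σ₂ ≠ σ → σ₃ ≠ σ → ∀ m c₁ c₂ c₃ : ℝ, 0 < m → 0 ≤ c₁ → 0 ≤ c₂ → 0 ≤ c₃ →
    m • W σ ≠ c₁ • W σ₁ + c₂ • W σ₂ + c₃ • W σ₃

variable {X : Fin 3 → ℝ} {R : Fin 3 → Fin 3 → ℝ}

/-- Two of the three lines through `X` do not coincide, since of four points on a line only two are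
extreme. -/
lemma det3_ne_zero (hR : ∀ j, 0 < R j 0) (hX : 0 ≤ X 0)
    (hW : ConeFree (Sum.elim (fun j => X + R j) R)) {a b : Fin 3} (hab : a ≠ b) :
    det3 X (R a) (R b) ≠ 0 := by
  intro h
  obtain ⟨x, y, z, hne, h0⟩ := exists_dependent_of_det3_eq_zero h
  have h00 := congrFun h0 0
  simp only [Pi.add_apply, Pi.smul_apply, smul_eq_mul, Pi.zero_apply] at h00
  have hRa := hR a
  have hRb := hR b
  by_cases hx : x = 0
  · subst hx
    have hy : y ≠ 0 := by
      rintro rfl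
      simp only [zero_mul, zero_add, mul_eq_zero, hRb.ne', or_false] at h00
      simp [h00] at hne
    have hyz : -(z / y) = R a 0 / R b 0 := by field_simp; linarith
    have hpos : 0 < -(z / y) := by rw [hyz]; exact div_pos hRa hRb
    refine hW (.inr a) (.inr b) (.inr b) (.inr b) (by simpa using hab.symm)
      (by simpa using hab.symm) (by simpa using hab.symm) 1 (-(z / y)) 0 0 one_pos hpos.le
      le_rfl le_rfl ?_
    ext i
    have hi := congrFun h0 i
    simp only [Pi.add_apply, Pi.smul_apply, smul_eq_mul, Pi.zero_apply, Sum.elim_inr] at hi ⊢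
    field_simp
    linarith
  · -- solve for `X = s R_a + t R_b`
    obtain ⟨s, t, hst⟩ : ∃ s t : ℝ, X = s • R a + t • R b := by
      refine ⟨-(y / x), -(z / x), ?_⟩
      ext i
      have hi := congrFun h0 i
      simp only [Pi.add_apply, Pi.smul_apply, smul_eq_mul, Pi.zero_apply] at hi ⊢
      field_simp
      linarith
    have hX0 : 0 ≤ s * R a 0 + t * R b 0 := by
      have := congrFun hst 0
      simp only [Pi.add_apply, Pi.smul_apply, smul_eq_mul] at this
      rw [← this]; exact hX
    have hab' := hab.symm
    rcases lt_or_ge s 0 with hs | hs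
    · have ht : 0 < t := by
        by_contra hc
        push Not at hc
        nlinarith
      refine hW (.inr b) (.inl b) (.inr a) (.inr a) (by simp) (by simpa using hab)
        (by simpa using hab) (1 + t) 1 (-s) 0 (by linarith) zero_le_one (by linarith) le_rfl ?_
      simp only [Sum.elim_inl, Sum.elim_inr]
      rw [hst]; module
    rcases lt_or_ge t 0 with ht | ht
    · have hs' : 0 ≤ s := hs
      refine hW (.inr a) (.inl a) (.inr b) (.inr b) (by simp) (by simpa using hab')
        (by simpa using hab') (1 + s) 1 (-t) 0 (by linarith) zero_le_one (by linarith) le_rfl ?_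
      simp only [Sum.elim_inl, Sum.elim_inr]
      rw [hst]; module
    · refine hW (.inl a) (.inr a) (.inr b) (.inr b) (by simp) (by simp) (by simp)
        1 (1 + s) t 0 one_pos (by linarith) ht le_rfl ?_
      simp only [Sum.elim_inl, Sum.elim_inr]
      rw [hst]; module

/-- The directions from the common point `X` to the three lines are not spread over a full turn. -/
lemma not_cyclic (hR : ∀ j, 0 < R j 0) (hX : 0 ≤ X 0)
    (hW : ConeFree (Sum.elim (fun j => X + R j) R)) {a b c : Fin 3}
    (h1 : 0 < det3 X (R a) (R b)) (h2 : 0 < det3 X (R b) (R c)) (h3 : 0 < det3 X (R c) (R a)) :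
    False := by
  have hc := det3_cramer X (R a) (R b) (R c)
  rw [det3_swap X (R c) (R a)] at hc
  set Δ := det3 (R a) (R b) (R c)
  have hc0 := congrFun hc 0
  simp only [Pi.add_apply, Pi.sub_apply, Pi.smul_apply, smul_eq_mul] at hc0
  have p1 := mul_pos h2 (hR a)
  have p2 := mul_pos h3 (hR b)
  have p3 := mul_pos h1 (hR c)
  have hΔ : 0 < Δ := by
    by_contra hcon
    push Not at hcon
    have := mul_nonpos_of_nonpos_of_nonneg hcon hX
    linarith
  refine hW (.inl a) (.inr a) (.inr b) (.inr c) (by simp) (by simp) (by simp) Δ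
    (det3 X (R b) (R c) + Δ) (det3 X (R c) (R a)) (det3 X (R a) (R b)) hΔ (by linarith) h3.le
    h1.le ?_
  simp only [Sum.elim_inl, Sum.elim_inr]
  rw [smul_add, hc]
  module

/-- The lines through `X` can be ordered by their directions, within a half turn. -/
lemma exists_perm (hR : ∀ j, 0 < R j 0) (hX : 0 ≤ X 0)
    (hW : ConeFree (Sum.elim (fun j => X + R j) R)) :
    ∃ e : Equiv.Perm (Fin 3), 0 < det3 X (R (e 0)) (R (e 1)) ∧ 0 < det3 X (R (e 1)) (R (e 2)) ∧
      0 < det3 X (R (e 0)) (R (e 2)) := by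
  have key : ∀ a b : Fin 3, a ≠ b → 0 < det3 X (R a) (R b) ∨ 0 < det3 X (R b) (R a) := by
    intro a b hab
    rw [det3_swap X (R a) (R b)]
    rcases lt_or_gt_of_ne (det3_ne_zero hR hX hW hab) with h | h
    · right; linarith
    · left; exact h
  rcases key 0 1 (by decide) with h1 | h1 <;> rcases key 1 2 (by decide) with h2 | h2 <;>
    rcases key 0 2 (by decide) with h3 | h3
  · exact ⟨1, h1, h2, h3⟩
  · exact (not_cyclic hR hX hW h1 h2 h3).elim
  · exact ⟨Equiv.swap 1 2, h3, h2, h1⟩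
  · exact ⟨(finRotate 3)⁻¹, h3, h1, h2⟩
  · exact ⟨Equiv.swap 0 1, h1, h3, h2⟩
  · exact ⟨finRotate 3, h2, h3, h1⟩
  · exact (not_cyclic hR hX hW h3 h2 h1).elim
  · exact ⟨Equiv.swap 0 2, h2, h1, h3⟩

/-- On the middle one of the three lines, `R 1` and `X + R 1` lie outside the quadrilateral of the
other four points, beyond its sides `R 0`, `R 2` and `X + R 0`, `X + R 2`. -/
lemma det3_pos (hW : ConeFree (Sum.elim (fun j => X + R j) R))
    (h1 : 0 < det3 X (R 0) (R 1)) (h2 : 0 < det3 X (R 1) (R 2)) (h3 : 0 < det3 X (R 0) (R 2)) :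
    0 < det3 (R 0) (R 1) (R 2) ∧
      det3 X (R 0) (R 1) + det3 X (R 1) (R 2) + det3 (R 0) (R 1) (R 2) < det3 X (R 0) (R 2) := by
  have hc := det3_cramer X (R 0) (R 1) (R 2)
  set Δ := det3 (R 0) (R 1) (R 2)
  constructor
  · by_contra hcon
    push Not at hcon
    refine hW (.inr 1) (.inr 0) (.inr 2) (.inl 1) (by simp) (by simp) (by simp)
      (det3 X (R 0) (R 2) - Δ) (det3 X (R 1) (R 2)) (det3 X (R 0) (R 1)) (-Δ)
      (by linarith) h2.le h1.le (by linarith) ?_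
    simp only [Sum.elim_inl, Sum.elim_inr]
    have : det3 X (R 0) (R 2) • R 1 =
        det3 X (R 1) (R 2) • R 0 + det3 X (R 0) (R 1) • R 2 - Δ • X := by
      rw [hc]; abel
    rw [sub_smul, this]; module
  · by_contra hcon
    push Not at hcon
    refine hW (.inl 1) (.inl 0) (.inl 2) (.inr 1) (by simp) (by simp) (by simp)
      (det3 X (R 0) (R 1) + det3 X (R 1) (R 2) + Δ) (det3 X (R 1) (R 2)) (det3 X (R 0) (R 1))
      (det3 X (R 0) (R 1) + det3 X (R 1) (R 2) + Δ - det3 X (R 0) (R 2))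
      (by linarith) h2.le h1.le (by linarith) ?_
    simp only [Sum.elim_inl, Sum.elim_inr]
    have : det3 X (R 0) (R 2) • R 1 =
        det3 X (R 1) (R 2) • R 0 + det3 X (R 0) (R 1) • R 2 - Δ • X := by
      rw [hc]; abel
    rw [sub_smul, this]; module

/-- The six points in cyclic order: along one triangle and back along the other. -/
def cyclicHexagon {V : Type*} (q r : Fin 3 → V) : Fin 6 → V := ![q 0, r 0, r 1, r 2, q 2, q 1]

/-- Each plane through two consecutive vectors has the other four strictly on its positive side. -/
lemma det3_cyclicHexagon
    (h1 : 0 < det3 X (R 0) (R 1)) (h2 : 0 < det3 X (R 1) (R 2)) (h3 : 0 < det3 (R 0) (R 1) (R 2))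
    (h4 : det3 X (R 0) (R 1) + det3 X (R 1) (R 2) + det3 (R 0) (R 1) (R 2) < det3 X (R 0) (R 2))
    (i j : Fin 6) :
    (j = i ∨ j = i + 1 → det3 (cyclicHexagon (fun j => X + R j) R i)
      (cyclicHexagon (fun j => X + R j) R (i + 1)) (cyclicHexagon (fun j => X + R j) R j) = 0) ∧
    (j ≠ i → j ≠ i + 1 → 0 < det3 (cyclicHexagon (fun j => X + R j) R i)
      (cyclicHexagon (fun j => X + R j) R (i + 1)) (cyclicHexagon (fun j => X + R j) R j)) := by
  refine ⟨?_, ?_⟩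
  · rintro (rfl | rfl) <;> simp only [det3_apply] <;> ring
  · intro hj hj'
    simp only [det3_apply] at h1 h2 h3 h4 ⊢
    fin_cases i <;> fin_cases j <;> first | exact absurd rfl hj | exact absurd rfl hj' | skip
    all_goals
      simp [cyclicHexagon] at h1 h2 h3 h4 ⊢
      linarith

end

/-! ### Desarguian hexagons -/

section

variable {E : Type*} [NormedAddCommGroup E] [NormedSpace ℝ E]

lemma dim_pair [FiniteDimensional ℝ E] {u v : E} (h : u ≠ v) : dim ({u, v} : Set E) = 1 := by
  rw [dim_insert_of_notMem (Set.singleton_nonempty v)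
    (by rwa [AffineSubspace.mem_affineSpan_singleton])]
  simp [dim, vectorSpan_singleton]

/-- Six points in convex position, in cyclic order: each of the six edges is cut out by one of the
functions `a i`. -/
lemma isHexagon_of_functions [FiniteDimensional ℝ E] {p : Fin 6 → E} (hp : Function.Injective p)
    (hext : Set.range p ⊆ (convexHull ℝ (Set.range p)).extremePoints ℝ)
    (hdim : dim (Set.range p) = 2) (a : Fin 6 → E →ᵃ[ℝ] ℝ)
    (h0 : ∀ i j, j = i ∨ j = i + 1 → a i (p j) = 0)
    (hpos : ∀ i j, j ≠ i → j ≠ i + 1 → 0 < a i (p j)) :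
    IsHexagon (convexHull ℝ (Set.range p)) p ∧ 6 ≤ numFacets (convexHull ℝ (Set.range p)) := by
  have hnn : ∀ i j, 0 ≤ a i (p j) := fun i j => by
    by_cases h : j = i ∨ j = i + 1
    · exact (h0 i j h).ge
    · push Not at h
      exact (hpos i j h.1 h.2).le
  have hpoly : IsPolytope (convexHull ℝ (Set.range p)) := isPolytope_range p
  have hseg : ∀ i, {x ∈ convexHull ℝ (Set.range p) | a i x = 0} = segment ℝ (p i) (p (i + 1)) := by
    intro i
    rw [face_convexHull_range (a i) (hnn i), ← convexHull_pair, ← Set.image_pair]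
    congr 2
    ext j
    constructor
    · intro hj
      by_contra hc
      simp only [Set.mem_insert_iff, Set.mem_singleton_iff, not_or] at hc
      exact (hpos i j hc.1 hc.2).ne' hj
    · exact h0 i j
  have hexp : ∀ i, IsExposed ℝ (convexHull ℝ (Set.range p)) (segment ℝ (p i) (p (i + 1))) :=
    fun i => isExposed_iff.2 ⟨a i, nonneg_on_convexHull _ (by rintro _ ⟨j, rfl⟩; exact hnn i j),
      (hseg i).symm⟩
  have hne : ∀ i : Fin 6, i ≠ i + 1 := by decide
  refine ⟨⟨hpoly, by rw [dim_convexHull, hdim], hp,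
    hext.antisymm extremePoints_convexHull_subset, hexp⟩, ?_⟩
  have hfac : ∀ i, segment ℝ (p i) (p (i + 1)) ∈ facets (convexHull ℝ (Set.range p)) := by
    intro i
    refine ⟨hexp i, ⟨p i, left_mem_segment ℝ _ _⟩, ?_⟩
    rw [dim_convexHull, hdim, ← convexHull_pair, dim_convexHull, dim_pair (hp.ne (hne i))]
  have hinj : Function.Injective fun i => segment ℝ (p i) (p (i + 1)) := by
    intro i j (hij : segment ℝ (p i) (p (i + 1)) = segment ℝ (p j) (p (j + 1)))
    have hmem : ∀ k, p k ∈ segment ℝ (p j) (p (j + 1)) → k = j ∨ k = j + 1 := by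
      intro k hk
      rw [← hseg j] at hk
      by_contra hc
      push Not at hc
      exact (hpos j k hc.1 hc.2).ne' hk.2
    have h1 := hmem i (hij ▸ left_mem_segment ℝ _ _)
    have h2 := hmem (i + 1) (hij ▸ right_mem_segment ℝ _ _)
    revert h1 h2; clear * -; revert i j; decide
  have hle := Set.ncard_le_ncard (Set.range_subset_iff.2 hfac) hpoly.facets_finite
  rw [← Set.image_univ, Set.InjOn.ncard_image hinj.injOn, Set.ncard_univ, Nat.card_eq_fintype_card,
    Fintype.card_fin] at hle
  exact hle

/-- Homogeneous coordinates on a plane. -/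
lemma exists_homogeneous_coordinates {S : Set E} (hdim : dim S = 2) :
    ∃ h : E →ᵃ[ℝ] (Fin 3 → ℝ), (∀ z, h z 0 = 1) ∧ Set.InjOn h (affineSpan ℝ S) := by
  have hfin : FiniteDimensional ℝ (vectorSpan ℝ S) :=
    Module.finite_of_finrank_pos (by rw [dim] at hdim; omega)
  obtain ⟨e⟩ : Nonempty (vectorSpan ℝ S ≃ₗ[ℝ] (Fin 2 → ℝ)) :=
    FiniteDimensional.nonempty_linearEquiv_of_finrank_eq (by
      rw [Module.finrank_fin_fun]; exact hdim)
  obtain ⟨g, hg⟩ := LinearMap.exists_extend (e : vectorSpan ℝ S →ₗ[ℝ] (Fin 2 → ℝ))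
  refine ⟨AffineMap.pi ![AffineMap.const ℝ E 1,
    (LinearMap.proj 0 ∘ₗ g).toAffineMap, (LinearMap.proj 1 ∘ₗ g).toAffineMap],
    fun z => rfl, fun x hx y hy hxy => ?_⟩
  have h1 : g x 0 = g y 0 := congrFun hxy 1
  have h2 : g x 1 = g y 1 := congrFun hxy 2
  have hm : x - y ∈ vectorSpan ℝ S := (mem_affineSpan_iff hy).1 hx
  have h3 : e ⟨x - y, hm⟩ = 0 := by
    have : e ⟨x - y, hm⟩ = g (x - y) := (DFunLike.congr_fun hg ⟨x - y, hm⟩).symm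
    rw [this, map_sub]
    ext i
    fin_cases i <;> simp [h1, h2]
  rw [LinearEquiv.map_eq_zero_iff, Submodule.mk_eq_zero, sub_eq_zero] at h3
  exact h3

/-- Positive multiples of the homogeneous coordinates of the vertices of a polygon are cone-free. -/
lemma coneFree_of_extreme {ι : Type*} {p : ι → E} (hp : Function.Injective p)
    (hext : Set.range p ⊆ (convexHull ℝ (Set.range p)).extremePoints ℝ)
    {h : E →ᵃ[ℝ] (Fin 3 → ℝ)} (h1 : ∀ z, h z 0 = 1)
    (hinj : Set.InjOn h (affineSpan ℝ (Set.range p))) {ω : ι → ℝ} (hω : ∀ σ, 0 < ω σ) :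
    ConeFree fun σ => ω σ • h (p σ) := by
  intro σ σ₁ σ₂ σ₃ n1 n2 n3 m c₁ c₂ c₃ hm hc₁ hc₂ hc₃ heq
  have hM : 0 < m * ω σ := mul_pos hm (hω σ)
  set d₁ := c₁ * ω σ₁ / (m * ω σ)
  set d₂ := c₂ * ω σ₂ / (m * ω σ)
  set d₃ := c₃ * ω σ₃ / (m * ω σ)
  have hd₁ : 0 ≤ d₁ := div_nonneg (mul_nonneg hc₁ (hω _).le) hM.le
  have hd₂ : 0 ≤ d₂ := div_nonneg (mul_nonneg hc₂ (hω _).le) hM.le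
  have hd₃ : 0 ≤ d₃ := div_nonneg (mul_nonneg hc₃ (hω _).le) hM.le
  have hi : ∀ i, h (p σ) i = d₁ * h (p σ₁) i + d₂ * h (p σ₂) i + d₃ * h (p σ₃) i := by
    intro i
    have := congrFun heq i
    simp only [Pi.add_apply, Pi.smul_apply, smul_eq_mul] at this
    have hne := hM.ne'
    simp only [d₁, d₂, d₃]
    have hmne := hm.ne'
    have hωne := (hω σ).ne'
    field_simp
    linarith
  have hsum : d₁ + d₂ + d₃ = 1 := by
    have := hi 0
    simp only [h1, mul_one] at this
    exact this.symm
  let y := d₁ • p σ₁ + d₂ • p σ₂ + d₃ • p σ₃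
  have hconv : ∀ T : Set E, Convex ℝ T → p σ₁ ∈ T → p σ₂ ∈ T → p σ₃ ∈ T → y ∈ T := by
    intro T hT t1 t2 t3
    have := hT.sum_mem (t := Finset.univ) (w := ![d₁, d₂, d₃]) (z := ![p σ₁, p σ₂, p σ₃])
      (by intro i _; fin_cases i <;> assumption) (by simp [Fin.sum_univ_three, hsum])
      (by intro i _; fin_cases i <;> assumption)
    simpa [Fin.sum_univ_three] using this
  have hmem : ∀ τ, p τ ∈ affineSpan ℝ (Set.range p) := fun τ => subset_affineSpan ℝ _ ⟨τ, rfl⟩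
  have hy : y ∈ affineSpan ℝ (Set.range p) :=
    hconv _ (AffineSubspace.convex _) (hmem _) (hmem _) (hmem _)
  have hhy : h y = h (p σ) := by
    have := map_sum_smul Finset.univ h ![d₁, d₂, d₃] ![p σ₁, p σ₂, p σ₃]
      (by simp [Fin.sum_univ_three, hsum])
    simp only [Fin.sum_univ_three] at this
    have this' : h y = d₁ • h (p σ₁) + d₂ • h (p σ₂) + d₃ • h (p σ₃) := this
    rw [this']
    ext i
    rw [hi i]
    rfl
  have hyσ := hinj hy (hmem σ) hhy
  have hx := ((convex_convexHull ℝ (Set.range p)).mem_extremePoints_iff_mem_sdiff_convexHull_sdiff).1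
    (hext ⟨σ, rfl⟩)
  have hin : ∀ τ, τ ≠ σ → p τ ∈ convexHull ℝ (Set.range p) \ {p σ} := fun τ hτ =>
    ⟨subset_convexHull ℝ _ ⟨τ, rfl⟩, fun hc => hτ (hp hc)⟩
  have hyx := hconv _ (convex_convexHull ℝ _) (subset_convexHull ℝ _ (hin _ n1))
    (subset_convexHull ℝ _ (hin _ n2)) (subset_convexHull ℝ _ (hin _ n3))
  rw [hyσ] at hyx
  exact hx.2 hyx

lemma vectorSpan_pair_eq_span (u v : E) : vectorSpan ℝ {u, v} = Submodule.span ℝ {u - v} := by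
  ext x
  rw [mem_vectorSpan_pair, Submodule.mem_span_singleton]
  rfl

/-- Three lines whose points satisfy a common weighted relation are concurrent: at a common point if
the total weight `τ` is nonzero, at infinity if it vanishes. -/
lemma concurrent_of_relation {q r : Fin 3 → E} {α γ : Fin 3 → ℝ} {τ : ℝ} (hα : ∀ j, 0 < α j)
    (hτ : ∀ j, α j - γ j = τ)
    (hrel : ∀ j j', α j • q j - γ j • r j = α j' • q j' - γ j' • r j') :
    Concurrent line[ℝ, q 0, r 0] line[ℝ, q 1, r 1] line[ℝ, r 2, q 2] := by
  by_cases h0 : τ = 0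
  · right
    have hspan : ∀ j, vectorSpan ℝ {q j, r j} = Submodule.span ℝ {α 0 • q 0 - γ 0 • r 0} := by
      intro j
      have hγ : γ j = α j := by have := hτ j; rw [h0] at this; linarith
      rw [hrel 0 j, hγ, ← smul_sub, Submodule.span_singleton_smul_eq (IsUnit.mk0 _ (hα j).ne'),
        vectorSpan_pair_eq_span]
    rw [Set.pair_comm (r 2), AffineSubspace.affineSpan_pair_parallel_iff_vectorSpan_eq,
      AffineSubspace.affineSpan_pair_parallel_iff_vectorSpan_eq, hspan, hspan, hspan]
    exact ⟨rfl, rfl⟩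
  · left
    have hmem : ∀ j, τ⁻¹ • (α 0 • q 0 - γ 0 • r 0) ∈ line[ℝ, q j, r j] := by
      intro j
      have : τ⁻¹ • (α 0 • q 0 - γ 0 • r 0) = AffineMap.lineMap (q j) (r j) (-(γ j / τ)) := by
        have hαj : α j = τ + γ j := by linarith [hτ j]
        rw [hrel 0 j, AffineMap.lineMap_apply, vsub_eq_sub, vadd_eq_add, hαj]
        have : τ⁻¹ • ((τ + γ j) • q j - γ j • r j) =
            (τ⁻¹ * τ) • q j + (γ j / τ) • (q j - r j) := by
          rw [div_eq_mul_inv]; module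
        rw [this, inv_mul_cancel₀ h0]
        module
      rw [this]
      exact AffineMap.lineMap_mem_affineSpan_pair _ _ _
    exact ⟨_, hmem 0, hmem 1, Set.pair_comm (q 2) (r 2) ▸ hmem 2⟩

lemma range_cyclicHexagon {V : Type*} (q r : Fin 3 → V) :
    Set.range (cyclicHexagon q r) = Set.range (Sum.elim q r) := by
  rw [Set.Sum.elim_range]
  ext x
  constructor
  · rintro ⟨i, rfl⟩
    fin_cases i
    exacts [.inl ⟨0, rfl⟩, .inr ⟨0, rfl⟩, .inr ⟨1, rfl⟩, .inr ⟨2, rfl⟩, .inl ⟨2, rfl⟩, .inl ⟨1, rfl⟩]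
  · rintro (⟨i, rfl⟩ | ⟨i, rfl⟩) <;> fin_cases i
    exacts [⟨0, rfl⟩, ⟨5, rfl⟩, ⟨4, rfl⟩, ⟨1, rfl⟩, ⟨2, rfl⟩, ⟨3, rfl⟩]

lemma cyclicHexagon_eq_comp {V : Type*} (q r : Fin 3 → V) :
    cyclicHexagon q r = Sum.elim q r ∘ cyclicHexagon Sum.inl Sum.inr := by
  funext i; fin_cases i <;> rfl

/-- The case in which the total weight `τ` is nonnegative. The point of concurrency is recorded by
its homogeneous coordinates `X`, of weight `τ`, so that a common point at infinity needs no separate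
treatment. -/
lemma isDesarguian_of_relation_of_nonneg [FiniteDimensional ℝ E] {q r : Fin 3 → E}
    {α γ : Fin 3 → ℝ} {τ : ℝ}
    (hα : ∀ j, 0 < α j) (hγ : ∀ j, 0 < γ j) (hτ : ∀ j, α j - γ j = τ) (hτ0 : 0 ≤ τ)
    (hrel : ∀ j j', α j • q j - γ j • r j = α j' • q j' - γ j' • r j')
    (hinj : Function.Injective (Sum.elim q r))
    (hext : Set.range (Sum.elim q r) ⊆ (convexHull ℝ (Set.range (Sum.elim q r))).extremePoints ℝ)
    (hdim : dim (Set.range (Sum.elim q r)) = 2) :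
    IsDesarguianHexagon (convexHull ℝ (Set.range (Sum.elim q r))) ∧
      6 ≤ numFacets (convexHull ℝ (Set.range (Sum.elim q r))) := by
  obtain ⟨h, h1, hinjh⟩ := exists_homogeneous_coordinates hdim
  obtain ⟨X, hX⟩ : ∃ X : Fin 3 → ℝ, ∀ j, α j • h (q j) = X + γ j • h (r j) := by
    refine ⟨α 0 • h (q 0) - γ 0 • h (r 0), fun j => ?_⟩
    have := map_cross h (α := α j) (β := γ 0) (γ := α 0) (δ := γ j) (x := q j) (y := r 0) (z := q 0)
      (t := r j) (by linarith [hτ j, hτ 0]) (by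
        have := hrel j 0
        rw [sub_eq_sub_iff_add_eq_add] at this
        exact this)
    rw [eq_comm, sub_add_eq_add_sub, sub_eq_iff_eq_add]
    exact this.symm
  let ω : Fin 3 ⊕ Fin 3 → ℝ := Sum.elim α γ
  have hω : ∀ σ, 0 < ω σ := by rintro (j | j); exacts [hα j, hγ j]
  let R : Fin 3 → Fin 3 → ℝ := fun j => γ j • h (r j)
  have hWeq : (fun σ => ω σ • h (Sum.elim q r σ)) = Sum.elim (fun j => X + R j) R := by
    funext σ
    rcases σ with j | j
    · exact hX j
    · rfl
  have hW := coneFree_of_extreme hinj hext h1 hinjh hω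
  rw [hWeq] at hW
  have hR0 : ∀ j, 0 < R j 0 := fun j => by simp [R, h1, hγ]
  have hX0 : 0 ≤ X 0 := by
    have := congrFun (hX 0) 0
    simp only [Pi.add_apply, Pi.smul_apply, smul_eq_mul, h1, mul_one] at this
    linarith [hτ 0]
  obtain ⟨e, g1, g2, g3⟩ := exists_perm hR0 hX0 hW
  have hWe : ConeFree (Sum.elim (fun j => X + R (e j)) (R ∘ e)) := by
    intro σ σ₁ σ₂ σ₃ n1 n2 n3
    have hmap : ∀ σ, Sum.elim (fun j => X + R (e j)) (R ∘ e) σ =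
        Sum.elim (fun j => X + R j) R (Sum.map e e σ) := by
      rintro (j | j) <;> rfl
    have hi : Function.Injective (Sum.map e e) := e.injective.sumMap e.injective
    simp only [hmap]
    exact hW _ _ _ _ (hi.ne n1) (hi.ne n2) (hi.ne n3)
  obtain ⟨g4, g5⟩ := det3_pos (R := R ∘ e) hWe g1 g2 g3
  have hdet := det3_cyclicHexagon (R := R ∘ e) g1 g2 g4 g5
  let p := cyclicHexagon (q ∘ e) (r ∘ e)
  let W := cyclicHexagon (fun j => X + R (e j)) (R ∘ e)
  -- the vectors `W` are positive multiples of the homogenized points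
  obtain ⟨ω', hω', hWp⟩ : ∃ ω' : Fin 6 → ℝ, (∀ i, 0 < ω' i) ∧ ∀ i, W i = ω' i • h (p i) := by
    refine ⟨cyclicHexagon (α ∘ e) (γ ∘ e), fun i => ?_, fun i => ?_⟩
    · rw [cyclicHexagon_eq_comp, Function.comp_apply]
      rcases cyclicHexagon (V := Fin 3 ⊕ Fin 3) Sum.inl Sum.inr i with j | j
      exacts [hα _, hγ _]
    · simp only [W, p]
      rw [cyclicHexagon_eq_comp, cyclicHexagon_eq_comp (α ∘ e), cyclicHexagon_eq_comp (q ∘ e)]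
      simp only [Function.comp_apply]
      rcases cyclicHexagon (V := Fin 3 ⊕ Fin 3) Sum.inl Sum.inr i with j | j
      · exact (hX (e j)).symm
      · rfl
  have hval : ∀ i j, det3 (W i) (W (i + 1)) (W j) =
      ω' j * (det3 (W i) (W (i + 1))) (h (p j)) := fun i j => by
    rw [hWp j, map_smul, smul_eq_mul]
  have hrange : Set.range p = Set.range (Sum.elim q r) := by
    rw [range_cyclicHexagon]
    have : Sum.elim (q ∘ e) (r ∘ e) = Sum.elim q r ∘ Sum.map e e := by
      funext σ; rcases σ with j | j <;> rfl
    rw [this]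
    exact (e.surjective.sumMap e.surjective).range_comp _
  have hpinj : Function.Injective p := by
    have : p = (Sum.elim q r ∘ Sum.map e e) ∘ cyclicHexagon Sum.inl Sum.inr := by
      simp only [p]
      rw [cyclicHexagon_eq_comp]
      congr 1
      funext σ; rcases σ with j | j <;> rfl
    rw [this]
    refine (hinj.comp (e.injective.sumMap e.injective)).comp ?_
    decide
  rw [← hrange] at hext hdim ⊢
  obtain ⟨hhex, hfac⟩ := isHexagon_of_functions hpinj hext hdim
    (fun i => (det3 (W i) (W (i + 1))).toAffineMap.comp h)
    (fun i j hij => by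
      have := (hval i j).symm.trans ((hdet i j).1 hij)
      exact (mul_eq_zero.1 this).resolve_left (hω' j).ne')
    (fun i j hij hij' => by
      have := ((hdet i j).2 hij hij').trans_eq (hval i j)
      exact pos_of_mul_pos_right this (hω' j).le)
  refine ⟨⟨p, hhex, ?_⟩, hfac⟩
  exact concurrent_of_relation (q := q ∘ e) (r := r ∘ e) (α := α ∘ e) (γ := γ ∘ e)
    (fun j => hα _) (fun j => hτ _) (fun j j' => hrel _ _)

end

/-! ### Projections of pyramids over the prism and the classification -/

lemma union_range_succ {X : Type*} (S : Set X) {k : ℕ} (u : Fin (k + 1) → X) :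
    S ∪ Set.range u = insert (u (Fin.last k)) (S ∪ Set.range (u ∘ Fin.castSucc)) := by
  ext x
  constructor
  · rintro (hx | ⟨i, rfl⟩)
    · exact .inr (.inl hx)
    · refine Fin.lastCases (.inl rfl) (fun i => .inr (.inr ⟨i, rfl⟩)) i
  · rintro (rfl | hx | ⟨i, rfl⟩)
    exacts [.inr ⟨_, rfl⟩, .inl hx, .inr ⟨_, rfl⟩]

section

variable {E : Type*} [NormedAddCommGroup E] [NormedSpace ℝ E]
variable {F : Type*} [NormedAddCommGroup F] [NormedSpace ℝ F]

/-- The three lines through the pairs of corresponding vertices of the two triangles of a prism meet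
in one point, possibly at infinity. -/
lemma IsPyrProd.exists_relation {C : Type*} {w : Fin 2 × Fin 3 ⊕ C → E}
    {a : Fin 2 ⊕ Fin 3 ⊕ C → E →ᵃ[ℝ] ℝ} (h : IsPyrProd w a) :
    ∃ (α γ : Fin 3 → ℝ) (τ : ℝ), (∀ j, 0 < α j) ∧ (∀ j, 0 < γ j) ∧ (∀ j, α j - γ j = τ) ∧
      ∀ j j', α j • w (.inl (0, j)) - γ j • w (.inl (1, j)) =
        α j' • w (.inl (0, j')) - γ j' • w (.inl (1, j')) := by
  -- the function of a quadrilateral facet vanishes at all vertices of the prism but two, and its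
  -- values there fix the ratio of the weights
  set b := a (.inr (.inl 0))
  set s := b (w (.inl (0, 0)))
  set t := b (w (.inl (1, 0)))
  have hs : 0 < s := h.pos rfl
  have ht : 0 < t := h.pos rfl
  have key : ∀ j : Fin 3, ∃ α γ : ℝ, 0 < α ∧ 0 < γ ∧ α - γ = t - s ∧
      α • w (.inl (0, j)) - γ • w (.inl (1, j)) =
        t • w (.inl (0, 0)) - s • w (.inl (1, 0)) := by
    intro j
    by_cases hj : j = 0
    · subst hj
      exact ⟨t, s, ht, hs, rfl, rfl⟩
    obtain ⟨A, B, C, D, hA, hB, hC, hD, hsum, he⟩ := h.cross 0 1 0 j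
    have h1 := map_cross b hsum he
    have h2 : ∀ i, b (w (.inl (i, j))) = 0 := fun i =>
      (h.eq_zero_iff _ _).2 fun hc : (0 : Fin 3) = j => hj hc.symm
    simp only [smul_eq_mul, h2, mul_zero, add_zero, zero_add] at h1
    have hAD : A * s = D * t := h1
    have hm : 0 < t / A := div_pos ht hA
    have h3 : t / A * A = t := div_mul_cancel₀ _ hA.ne'
    have h4 : t / A * D = s := by
      field_simp
      linarith
    refine ⟨t / A * C, t / A * B, mul_pos hm hC, mul_pos hm hB, ?_, ?_⟩
    · linear_combination h3 - h4 - t / A * hsum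
    · have e1 : t • w (.inl (0, 0)) = (t / A) • A • w (.inl (0, 0)) := by rw [smul_smul, h3]
      have e2 : s • w (.inl (1, 0)) = (t / A) • D • w (.inl (1, 0)) := by rw [smul_smul, h4]
      rw [e1, e2, mul_smul, mul_smul, ← smul_sub, ← smul_sub]
      congr 1
      rw [sub_eq_sub_iff_add_eq_add]
      exact he.symm
  choose α γ hα hγ hαγ hrel using key
  exact ⟨α, γ, t - s, hα, hγ, hαγ, fun j j' => by rw [hrel, hrel]⟩

lemma dim_le_of_subset_affineSpan [FiniteDimensional ℝ E] {S T : Set E}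
    (h : S ⊆ affineSpan ℝ T) : dim S ≤ dim T := by
  refine (dim_mono h).trans_eq ?_
  rw [dim, dim, ← direction_affineSpan ℝ T]
  rfl

/-- Four of the six vertices, together with the relation, span the affine hull. -/
lemma dim_le_three_of_relation [FiniteDimensional ℝ E] {q r : Fin 3 → E} {α γ : Fin 3 → ℝ} {τ : ℝ}
    (hα : ∀ j, 0 < α j) (hτ : ∀ j, α j - γ j = τ)
    (hrel : ∀ j j', α j • q j - γ j • r j = α j' • q j' - γ j' • r j') :
    dim (Set.range (Sum.elim q r)) ≤ 3 := by
  have h1 : dim (Set.range r) ≤ 2 := finrank_vectorSpan_range_le ℝ r (Fintype.card_fin 3)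
  have h2 := dim_insert_le (Set.range r) (q 0)
  refine (dim_le_of_subset_affineSpan (T := insert (q 0) (Set.range r)) ?_).trans
    (h2.trans (Nat.succ_le_succ h1))
  have hq0 : q 0 ∈ affineSpan ℝ (insert (q 0) (Set.range r)) :=
    subset_affineSpan ℝ _ (Set.mem_insert _ _)
  have hr : ∀ j, r j ∈ affineSpan ℝ (insert (q 0) (Set.range r)) := fun j =>
    subset_affineSpan ℝ _ (Set.mem_insert_of_mem _ ⟨j, rfl⟩)
  rintro _ ⟨j | j, rfl⟩
  · have hj : q j - q 0 = (α j)⁻¹ • (γ j • (r j - q 0) - γ 0 • (r 0 - q 0)) := by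
      rw [eq_inv_smul_iff₀ (hα j).ne']
      have hr0 := hrel j 0
      have e1 : α j = τ + γ j := by linarith [hτ j]
      have e2 : α 0 = τ + γ 0 := by linarith [hτ 0]
      have e3 : α j • q j = (α 0 • q 0 - γ 0 • r 0) + γ j • r j := by rw [← hr0]; abel
      rw [smul_sub, e3, e1, e2]
      module
    refine (mem_affineSpan_iff hq0).2 ?_
    change q j - q 0 ∈ _
    rw [hj]
    exact Submodule.smul_mem _ _ (Submodule.sub_mem _
      (Submodule.smul_mem _ _ ((mem_affineSpan_iff hq0).1 (hr j)))
      (Submodule.smul_mem _ _ ((mem_affineSpan_iff hq0).1 (hr 0))))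
  · exact hr j

lemma dim_union_range_le [FiniteDimensional ℝ E] (S : Set E) : ∀ {k : ℕ} (u : Fin k → E),
    dim (S ∪ Set.range u) ≤ dim S + k
  | 0, u => by simp
  | k + 1, u => by
    rw [union_range_succ]
    have := dim_insert_le (S ∪ Set.range (u ∘ Fin.castSucc)) (u (Fin.last k))
    have := dim_union_range_le S (u ∘ Fin.castSucc)
    omega

/-- Adding `k` points that raise the dimension by `k` forms an iterated pyramid. -/
lemma isIteratedPyramid_of_dim [FiniteDimensional ℝ E] (S : Set E) : ∀ {k : ℕ} (u : Fin k → E),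
    dim S + k ≤ dim (S ∪ Set.range u) →
      IsIteratedPyramid k (convexHull ℝ S) (convexHull ℝ (S ∪ Set.range u))
  | 0, u, _ => by
    change _ = _
    simp
  | k + 1, u, h => by
    rw [union_range_succ] at h ⊢
    set T := S ∪ Set.range (u ∘ Fin.castSucc)
    have h1 := dim_insert_le T (u (Fin.last k))
    have h2 : dim T ≤ dim S + k := dim_union_range_le S (u ∘ Fin.castSucc)
    have h3 : dim S + k ≤ dim T := by omega
    refine ⟨convexHull ℝ T, isIteratedPyramid_of_dim S _ h3, u (Fin.last k), ?_, ?_⟩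
    · rw [affineSpan_convexHull]
      intro hc
      have := dim_insert_of_mem hc
      omega
    · rw [Set.insert_eq, Set.insert_eq, convexHull_convexHull_union_right]

/-- A planar image of a triangular prism whose six vertices stay in convex position is a Desarguian
hexagon. The scalars `α`, `γ` express that the three lines `q j`, `r j` pass through one point. -/
lemma isDesarguian_of_relation [FiniteDimensional ℝ E] {q r : Fin 3 → E} {α γ : Fin 3 → ℝ} {τ : ℝ}
    (hα : ∀ j, 0 < α j) (hγ : ∀ j, 0 < γ j) (hτ : ∀ j, α j - γ j = τ)
    (hrel : ∀ j j', α j • q j - γ j • r j = α j' • q j' - γ j' • r j')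
    (hinj : Function.Injective (Sum.elim q r))
    (hext : Set.range (Sum.elim q r) ⊆ (convexHull ℝ (Set.range (Sum.elim q r))).extremePoints ℝ)
    (hdim : dim (Set.range (Sum.elim q r)) = 2) :
    IsDesarguianHexagon (convexHull ℝ (Set.range (Sum.elim q r))) ∧
      6 ≤ numFacets (convexHull ℝ (Set.range (Sum.elim q r))) := by
  rcases le_total 0 τ with h0 | h0
  · exact isDesarguian_of_relation_of_nonneg hα hγ hτ h0 hrel hinj hext hdim
  · -- exchanging the two triangles changes the sign of `τ`
    have hswap : Sum.elim r q = Sum.elim q r ∘ Sum.swap := by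
      funext σ; rcases σ with j | j <;> rfl
    have hrange : Set.range (Sum.elim r q) = Set.range (Sum.elim q r) := by
      rw [hswap]
      exact (Equiv.sumComm (Fin 3) (Fin 3)).surjective.range_comp _
    rw [← hrange] at hext hdim ⊢
    refine isDesarguian_of_relation_of_nonneg (τ := -τ) hγ hα (fun j => by rw [← hτ j]; ring)
      (by linarith)
      (fun j j' => ?_) ?_ hext hdim
    · rw [← neg_sub, hrel j j', neg_sub]
    · rw [hswap]
      exact hinj.comp (Equiv.sumComm (Fin 3) (Fin 3)).injective

/-- The base of a pyramid over a product of simplices. -/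
lemma IsPyrProd.base {A B C : Type*} {w : A × B ⊕ C → E} {a : A ⊕ B ⊕ C → E →ᵃ[ℝ] ℝ}
    (h : IsPyrProd w a) :
    IsPyrProd (w ∘ Sum.map id (Fin.elim0 : Fin 0 → C))
      (a ∘ Sum.map id (Sum.map id (Fin.elim0 : Fin 0 → C))) where
  nonneg i σ := h.nonneg _ _
  eq_zero_iff i σ := by
    refine (h.eq_zero_iff _ _).trans (not_congr ?_)
    rcases i with i | i | i
    · rcases σ with σ | c
      · rfl
      · exact c.elim0
    · rcases σ with σ | c
      · rfl
      · exact c.elim0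
    · exact i.elim0
  cross i i' j j' := h.cross _ _ _ _

lemma IsPyrProd.map_of_injOn [FiniteDimensional ℝ E] {A B C : Type*} {w : A × B ⊕ C → E}
    {a : A ⊕ B ⊕ C → E →ᵃ[ℝ] ℝ} (h : IsPyrProd w a) (f : E →ᵃ[ℝ] F)
    (hf : Set.InjOn f (affineSpan ℝ (Set.range w))) :
    ∃ a' : A ⊕ B ⊕ C → F →ᵃ[ℝ] ℝ, IsPyrProd (f ∘ w) a' := by
  have hmem : ∀ σ, w σ ∈ affineSpan ℝ (Set.range w) := fun σ => subset_affineSpan ℝ _ ⟨σ, rfl⟩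
  have hb : ∀ i, ∃ b : F →ᵃ[ℝ] ℝ, ∀ x ∈ affineSpan ℝ (Set.range w), b (f x) = a i x := by
    intro i
    refine exists_affine_descend f _ (a i) fun v hv hv0 => ?_
    rcases isEmpty_or_nonempty (A × B ⊕ C) with _ | ⟨⟨σ⟩⟩
    · rw [Set.range_eq_empty, vectorSpan_empty, Submodule.mem_bot] at hv
      rw [hv, map_zero]
    · have h1 := map_add_smul f (w σ) v 1
      rw [hv0, smul_zero, add_zero, one_smul] at h1
      have h2 := hf (add_mem_affineSpan (hmem σ) hv) (hmem σ) h1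
      rw [add_eq_left.1 h2, map_zero]
  choose b hb using hb
  exact ⟨b, h.map f b fun i σ => hb i _ (hmem σ)⟩

/-- The two shapes of a projection with `d + 4` vertices of a pyramid over the prism: either the
prism at its base is projected injectively, or it is flattened to a hexagon. -/
theorem IsProjOfPyrPrism.dichotomy [FiniteDimensional ℝ E] {d : ℕ} {P : Set E} (hdim : dim P = d)
    (hvert : (P.extremePoints ℝ).ncard = d + 4) (h : IsProjOfPyrPrism d P) :
    (∃ (k : ℕ) (H : Set E), k + 2 = d ∧ IsDesarguianHexagon H ∧ xc H = 5 ∧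
      IsIteratedPyramid k H P) ∨
    ∃ S : Set E, S ⊆ P.extremePoints ℝ ∧ S.ncard = 6 ∧ CombEquiv (convexHull ℝ S) prism := by
  obtain ⟨k, N, w, a, π, hk, hw, hπ⟩ := h.exists_isPyrProd
  have hPp : P = convexHull ℝ (Set.range (π ∘ w)) := by
    rw [← hπ, AffineMap.image_convexHull, Set.range_comp]
  have hcard : Nat.card (Fin 2 × Fin 3 ⊕ Fin k) = d + 4 := by
    rw [Nat.card_eq_fintype_card]; simp; omega
  -- all vertices of the pyramid survive the projection
  have hextr : P.extremePoints ℝ = Set.range (π ∘ w) := by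
    refine Set.eq_of_subset_of_ncard_le ?_ ?_ (Set.finite_range _)
    · rw [hPp]; exact extremePoints_convexHull_subset
    · rw [hvert, ← hcard, ← Set.image_univ, ← Set.ncard_univ]
      exact Set.ncard_image_le Set.finite_univ
  have hinj : Function.Injective (π ∘ w) := by
    rw [← Set.injOn_univ]
    refine Set.injOn_of_ncard_image_eq ?_ Set.finite_univ
    rw [Set.image_univ, ← hextr, hvert, Set.ncard_univ, hcard]
  obtain ⟨α, γ, τ, hα, hγ, hτ, hrelw⟩ := hw.exists_relation
  let ι : Fin 3 ⊕ Fin 3 → Fin 2 × Fin 3 ⊕ Fin k :=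
    Sum.elim (fun j => .inl (0, j)) (fun j => .inl (1, j))
  have hι : Function.Injective ι := by
    rintro (i | i) (j | j) hij <;> simp_all [ι]
  set w₀ : Fin 2 × Fin 3 ⊕ Fin 0 → EuclideanSpace ℝ (Fin N) := w ∘ Sum.map id Fin.elim0
  have hw₀ := hw.base
  have hr₀ : Set.range w₀ = Set.range (w ∘ ι) := by
    ext x
    constructor
    · rintro ⟨⟨i, j⟩ | c, rfl⟩
      · fin_cases i
        exacts [⟨.inl j, rfl⟩, ⟨.inr j, rfl⟩]
      · exact c.elim0
    · rintro ⟨j | j, rfl⟩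
      exacts [⟨.inl (0, j), rfl⟩, ⟨.inl (1, j), rfl⟩]
  let q : Fin 3 → E := fun j => π (w (.inl (0, j)))
  let r : Fin 3 → E := fun j => π (w (.inl (1, j)))
  have hqr : Sum.elim q r = (π ∘ w) ∘ ι := by
    funext σ; rcases σ with j | j <;> rfl
  have hS : π '' Set.range w₀ = Set.range (Sum.elim q r) := by
    rw [hr₀, hqr, ← Set.range_comp]; rfl
  have hrel : ∀ j j', α j • q j - γ j • r j = α j' • q j' - γ j' • r j' := by
    intro j j'
    have h1 := hrelw j j'
    rw [sub_eq_sub_iff_add_eq_add] at h1 ⊢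
    exact map_cross π (by linarith [hτ j, hτ j']) h1
  have hinj' : Function.Injective (Sum.elim q r) := by rw [hqr]; exact hinj.comp hι
  set S := Set.range (Sum.elim q r)
  have hSP : S ⊆ P.extremePoints ℝ := by
    rw [hextr]; simp only [S, hqr]; exact Set.range_comp_subset_range _ _
  have hext : S ⊆ (convexHull ℝ S).extremePoints ℝ := by
    have hsub : convexHull ℝ S ⊆ P := by
      rw [hPp, ← hextr]; exact convexHull_mono hSP
    exact fun x hx => inter_extremePoints_subset_extremePoints_of_subset hsub
      ⟨subset_convexHull ℝ S hx, hSP hx⟩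
  have hScard : S.ncard = 6 := by
    rw [show S = Sum.elim q r '' Set.univ from Set.image_univ.symm,
      Set.InjOn.ncard_image hinj'.injOn, Set.ncard_univ, Nat.card_eq_fintype_card]
    rfl
  have hPS : P = convexHull ℝ (S ∪ Set.range fun c => π (w (.inr c))) := by
    rw [hPp]
    congr 1
    ext x
    constructor
    · rintro ⟨⟨i, j⟩ | c, rfl⟩
      · left
        fin_cases i
        exacts [⟨.inl j, rfl⟩, ⟨.inr j, rfl⟩]
      · exact .inr ⟨c, rfl⟩
    · rintro (⟨j | j, rfl⟩ | ⟨c, rfl⟩)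
      exacts [⟨.inl (0, j), rfl⟩, ⟨.inl (1, j), rfl⟩, ⟨.inr c, rfl⟩]
  have hdimP : dim (S ∪ Set.range fun c => π (w (.inr c))) = k + 2 := by
    rw [← dim_convexHull, ← hPS, hdim, hk]
  have hle3 : dim S ≤ 3 := dim_le_three_of_relation hα hτ hrel
  have hge2 := dim_union_range_le S fun c => π (w (.inr c))
  by_cases hdS : dim S = 2
  · left
    obtain ⟨hdes, hfac⟩ := isDesarguian_of_relation hα hγ hτ hrel hinj' hext hdS
    change 6 ≤ numFacets (convexHull ℝ S) at hfac
    refine ⟨k, convexHull ℝ S, hk, hdes, ?_, ?_⟩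
    · have hup : xc (convexHull ℝ S) ≤ 5 := by
        refine (xc_le_of_image (isPolytope_range w₀) π ?_).trans (hw₀.numFacets_le.trans (by simp))
        rw [AffineMap.image_convexHull, hS]
      have hlow := xc_lower (d := 2) (P := convexHull ℝ S) (isPolytope_range _)
        (by rw [dim_convexHull, hdS])
        (by rw [← hext.antisymm extremePoints_convexHull_subset, hScard])
      obtain ⟨h1, h2, -⟩ := hlow
      by_contra hc
      have := h2 (by omega)
      omega
    · rw [hPS]
      exact isIteratedPyramid_of_dim S _ (by omega)
  · right
    have hdS3 : dim S = 3 := by omega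
    have hw3 : dim (Set.range w₀) ≤ 3 := by
      rw [hr₀]
      have : w ∘ ι = Sum.elim (fun j => w (.inl (0, j))) (fun j => w (.inl (1, j))) := by
        funext σ; rcases σ with j | j <;> rfl
      rw [this]
      exact dim_le_three_of_relation hα hτ hrelw
    have hge := dim_image_le π (Set.range w₀)
    rw [hS, hdS3] at hge
    obtain ⟨a', ha'⟩ := hw₀.map_of_injOn π
      (injOn_of_dim_eq π (by rw [hS, hdS3]; exact le_antisymm hge hw3))
    obtain ⟨w1, a1, h1, hprism⟩ := exists_isPyrProd_prism
    refine ⟨S, hSP, hScard, ?_⟩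
    have := ha'.combEquiv h1
    rwa [← hprism, Set.range_comp, hS] at this

end

end Polytope

end

theorem theorem1 {E : Type*} [NormedAddCommGroup E] [NormedSpace ℝ E] [FiniteDimensional ℝ E]
    (d : ℕ) (P : Set E) (hP : Polytope.IsPolytope P) (hdim : Polytope.dim P = d)
    (hvert : (P.extremePoints ℝ).ncard = d + 4) :
    (Polytope.xc P = d + 2 ↔ Polytope.numFacets P = d + 2) ∧
    (Polytope.xc P = d + 3 ↔
      Polytope.numFacets P ≠ d + 2 ∧
        (Polytope.numFacets P = d + 3 ∨ Polytope.IsProjOfPyrPrism d P)) ∧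
    (Polytope.IsProjOfPyrPrism d P →
      (∃ (k : ℕ) (H : Set E), k + 2 = d ∧ Polytope.IsDesarguianHexagon H ∧
        Polytope.xc H = 5 ∧ Polytope.IsIteratedPyramid k H P) ∨
      (∃ S : Set E, S ⊆ P.extremePoints ℝ ∧ S.ncard = 6 ∧
        Polytope.CombEquiv (convexHull ℝ S) Polytope.prism)) ∧
    (Polytope.numFacets P ≠ d + 2 → Polytope.numFacets P ≠ d + 3 →
      ¬ Polytope.IsProjOfPyrPrism d P → Polytope.xc P = d + 4) := by
  have hfac := Polytope.xc_le_numFacets hP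
  have hvtx := Polytope.xc_le_ncard_extremePoints hP
  rw [hvert] at hvtx
  obtain ⟨hlow, h2, h3⟩ := Polytope.xc_lower hP hdim hvert
  have hproj : Polytope.IsProjOfPyrPrism d P → Polytope.xc P ≤ d + 3 :=
    Polytope.xc_le_of_isProjOfPyrPrism
  refine ⟨⟨fun h => ?_, fun h => by omega⟩, ⟨fun h => ⟨by omega, ?_⟩, ?_⟩,
    fun h => h.dichotomy hdim hvert, fun hn2 hn3 hnp => ?_⟩
  · have := h2 h
    omega
  · exact (h3 h).imp_left fun h4 => by omega
  · rintro ⟨hn2, h4⟩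
    have hle : Polytope.xc P ≤ d + 3 := by
      rcases h4 with h4 | h4
      · omega
      · exact hproj h4
    have hne : Polytope.xc P ≠ d + 2 := fun h => by
      have := h2 h
      omega
    omega
  · have hne2 : Polytope.xc P ≠ d + 2 := fun h => by
      have := h2 h
      omega
    have hne3 : Polytope.xc P ≠ d + 3 := fun h => by
      rcases h3 h with h4 | h4
      · omega
      · exact hnp h4
    omega
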